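/- Let $d\ge 1$, let $E_d$ be the set of unordered pairs $\{x,y\}$ of sites of $\mathbb Z^d$ with $|x-y|=1$, and let $\lambda=\{\lambda_t(b): b\in E_d,\ t\ge 0\}$ be a deterministic family of conductances such that, for every $b \in E_d$, the map $t\mapsto\lambda_t(b)$ is càdlàg with values in $[0,\alpha]$, where the constant $\alpha$ does not depend on $b$ or $t$. On a probability space $(\Omega,\mathcal F,\mathbb P)$, let $\{\mathcal N(b): b\in E_d\}$ be independent inhomogeneous Poisson processes, $\mathcal N(b)$ having intensity measure $\lambda_r(b)\,dr$. For $s\le t$ and $x\in\mathbb Z^d$, let $X_{s,t}^x$ be the position at time $t$ of the càdlàg walk that is at $x$ at time $s$, that crosses the bond $\{z,v\}$ at each event time of $\mathcal N(\{z,v\})$ in $(s,t]$ just before which it is at $z$ or $v$, and that does not move otherwise. Let the backward walk $\widehat X_{s,t}^y$ be the site defined by $X_{s,t}^{\widehat X_{s,t}^y}=y$. Put $$\widehat p_{s,t}(y,x)=\mathbb P(\widehat X_{s,t}^y=x),\qquad \widehat S_{s,t}f(x)=\sum_{y\in\mathbb Z^d}\widehat p_{s,t}(x,y)f(y).$$ For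 an initial configuration $\eta\in\{0,1\}^{\mathbb Z^d}$, let $\eta_t(x)=\eta(\widehat X_{0,t}^x)$ be the stirring process started from $\eta$ (the symmetric simple exclusion process in the environment $\lambda$), and let $$dM_r(\eta_{r-},y)=\sum_{z:\{y,z\}\in E_d}\big(\eta_{r-}(z)-\eta_{r-}(y)\big)\big(d\mathcal N_r(\{y,z\})-\lambda_r(\{y,z\})\,dr\big),$$ integrals against which are pathwise Lebesgue–Stieltjes integrals over $(0,t]$; $d|M_r(\eta_{r-},y)|$ denotes the measure obtained by replacing each difference by its absolute value and the last factor by $d\mathcal N_r(\{y,z\})+\lambda_r(\{y,z\})\,dr$ (almost surely, the total variation of $dM_r(\eta_{r-},y)$). **Proposition.** Fix an initial configuration $\eta\in\{0,1\}^{\mathbb Z^d}$. Then, for $\mathbb P$-a.e. $\omega\in\Omega$, the forward and backward walks are well defined (existence and uniqueness) for all starting points and all times and, for all $x\in\mathbb Z^d$ and $t\ge 0$ simultaneously: all the integrals below exist; the sums are absolutely convergent, $$\sum_{y\in\mathbb Z^d}\widehat p_{0,t}(x,y)\,\eta(y)<\infty,\qquad \sum_{y\in\mathbb Z^d}\int_0^t\widehat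 p_{r,t}(x,y)\,d|M_r(\eta_{r-},y)|<\infty ;$$ and $$\eta_t(x)=\widehat S_{0,t}\eta(x)+\int_0^t\sum_{y\in\mathbb Z^d}\widehat p_{r,t}(x,y)\,dM_r(\eta_{r-},y),$$ where the last term is the absolutely convergent sum $\sum_{y}\int_0^t\widehat p_{r,t}(x,y)\,dM_r(\eta_{r-},y)$. -/

import Mathlib

open MeasureTheory ProbabilityTheory Filter Topology Set
open scoped NNReal ENNReal

noncomputable section

namespace Stirring

/-! ### The lattice and the environment -/

/-- The sites of the lattice. -/
abbrev Site (d : ℕ) : Type := Fin d → ℤ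

/-- The graph of nearest neighbours on the integer lattice: `x ∼ y` iff `|x - y| = 1`. -/
def lattice (d : ℕ) : SimpleGraph (Site d) where
  Adj x y := ∑ i, |x i - y i| = 1
  symm := ⟨fun x y h => by simpa only [abs_sub_comm] using h⟩
  loopless := ⟨fun x h => by simp at h⟩

/-- The bonds: unordered pairs of nearest neighbours. -/
abbrev Bond (d : ℕ) : Type := (lattice d).edgeSet

/-- The bond `{x, y}` joining two nearest neighbours. -/
def bond {d : ℕ} {x y : Site d} (h : (lattice d).Adj x y) : Bond d := ⟨s(x, y), h⟩

lemma finite_neighborSet {d : ℕ} (x : Site d) : ((lattice d).neighborSet x).Finite := by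
  refine (Set.finite_Icc (x - 1) (x + 1)).subset fun y hy => ?_
  have hy' : ∑ i, |x i - y i| = 1 := hy
  have key : ∀ i, |x i - y i| ≤ 1 := fun i =>
    hy' ▸ Finset.single_le_sum (f := fun i => |x i - y i|) (fun j _ => abs_nonneg _)
      (Finset.mem_univ i)
  refine ⟨fun i => ?_, fun i => ?_⟩ <;> have := abs_le.1 (key i) <;> simp <;> omega

instance {d : ℕ} (x : Site d) : Fintype ((lattice d).neighborSet x) :=
  (finite_neighborSet x).fintype

/-- Right-continuous functions of time with left limits. -/
def IsCadlag {E : Type*} [TopologicalSpace E] (f : ℝ≥0 → E) : Prop :=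
  ∀ t, ContinuousWithinAt f (Ici t) t ∧ ∃ l, Tendsto f (𝓝[<] t) (𝓝 l)

/-! ### Inhomogeneous Poisson processes -/

/-- Lebesgue measure on the time half-line `[0, ∞)`. -/
def timeVolume : Measure ℝ≥0 := (volume : Measure ℝ).comap ((↑) : ℝ≥0 → ℝ)

/-- The measure `ℓ(r) dr` on `[0, ∞)`. -/
def intensityMeasure (l : ℝ≥0 → ℝ≥0) : Measure ℝ≥0 :=
  timeVolume.withDensity fun r => (l r : ℝ≥0∞)

/-- `N` is a Poisson process (on the probability space carrying `P`) with intensity measure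
`ℓ(r) dr`: almost surely a counting path (zero at time zero, nondecreasing, right-continuous),
with independent increments, the increment over `(s, t]` being Poisson distributed with
parameter `∫_s^t ℓ(r) dr`. -/
structure IsPoissonProcess {Ω : Type*} [MeasurableSpace Ω] (P : Measure Ω)
    (l : ℝ≥0 → ℝ≥0) (N : ℝ≥0 → Ω → ℕ) : Prop where
  measurable : ∀ t, Measurable (N t)
  path : ∀ᵐ ω ∂P, N 0 ω = 0 ∧ Monotone (fun t => N t ω) ∧
    ∀ t, ContinuousWithinAt (fun u => N u ω) (Ici t) t
  law : ∀ s t, s ≤ t → HasLaw (fun ω => N t ω - N s ω)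
    (poissonMeasure (intensityMeasure l (Ioc s t)).toNNReal) P
  indep : HasIndepIncrements N P

/-- A family of independent Poisson processes, one for each bond, the one attached to the bond `b`
having intensity measure `λ_r(b) dr`. -/
structure IsPoissonFamily {d : ℕ} {Ω : Type*} [MeasurableSpace Ω] (P : Measure Ω)
    (lam : Bond d → ℝ≥0 → ℝ≥0) (N : Bond d → ℝ≥0 → Ω → ℕ) : Prop where
  poisson : ∀ b, IsPoissonProcess P (lam b) (N b)
  indep : iIndepFun (fun b ω t => N b t ω) P

/-- The realization of all the counting paths at the sample point `ω`. -/
def realization {d : ℕ} {Ω : Type*} (N : Bond d → ℝ≥0 → Ω → ℕ) (ω : Ω) : Bond d → ℝ≥0 → ℕ :=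
  fun b t => N b t ω

/-! ### The graphical construction, for a fixed realization `n` of the counting paths -/

/-- The counting path `n` jumps at time `r`, i.e. `r` is one of its event times. -/
def IsEvent (n : ℝ≥0 → ℕ) (r : ℝ≥0) : Prop := ¬ ∀ᶠ u in 𝓝[<] r, n u = n r

/-- `γ` (on `[s, ∞)`) is a trajectory which is at `x` at time `s`, is right-continuous with left
limits, and which crosses a bond at an event time of this bond whenever it is at one of its two
endpoints just before this time (and does not move otherwise). -/
structure IsForwardPath {d : ℕ} (n : Bond d → ℝ≥0 → ℕ) (s : ℝ≥0) (x : Site d)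
    (γ : ℝ≥0 → Site d) : Prop where
  start : γ s = x
  right : ∀ r, s ≤ r → ∀ᶠ u in 𝓝[>] r, γ u = γ r
  jump : ∀ r, s < r → ∃ y, (∀ᶠ u in 𝓝[<] r, γ u = y) ∧
    ((γ r = y ∧ ∀ z, ∀ h : (lattice d).Adj y z, ¬ IsEvent (n (bond h)) r) ∨
      ∃ h : (lattice d).Adj y (γ r), IsEvent (n (bond h)) r)

open Classical in
/-- `X_{s,t}^x`: the position at time `t` of the forward random walk which is at `x` at time `s`
(with a dummy value on those realizations for which there is no such trajectory). -/
def forwardWalk {d : ℕ} (n : Bond d → ℝ≥0 → ℕ) (s t : ℝ≥0) (x : Site d) : Site d :=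
  if h : ∃ γ, IsForwardPath n s x γ then h.choose t else x

open Classical in
/-- The backward random walk: its position at time `s` when started from `y` at time `t` is the site
`x` such that `X_{s,t}^x = y` (with a dummy value on those realizations for which there is none). -/
def backwardWalk {d : ℕ} (n : Bond d → ℝ≥0 → ℕ) (s t : ℝ≥0) (y : Site d) : Site d :=
  if h : ∃ x, forwardWalk n s t x = y then h.choose else y

/-- The graphical construction makes sense for the realization `n`: every site and time is the
starting point of exactly one forward trajectory, and between two times the forward walks
induce a bijection of the lattice, so that backward walks are well defined too. -/
def WalksWellDefined {d : ℕ} (n : Bond d → ℝ≥0 → ℕ) : Prop :=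
  (∀ s x, ∃ γ, IsForwardPath n s x γ ∧ ∀ γ', IsForwardPath n s x γ' → EqOn γ' γ (Ici s)) ∧
  ∀ s t, s ≤ t → Function.Bijective (forwardWalk n s t)

/-- The occupation variable `η_t(x)` of the stirring process started from `η`. -/
def occupation {d : ℕ} (n : Bond d → ℝ≥0 → ℕ) (η : Site d → ℝ) (t : ℝ≥0) (x : Site d) : ℝ :=
  η (backwardWalk n 0 t x)

/-! ### Transition probabilities and semigroup of the backward walks -/

/-- The probability that the backward walk started from `x` at time `t` is at `y` at time `s`. -/
def backwardProb {d : ℕ} {Ω : Type*} [MeasurableSpace Ω] (P : Measure Ω)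
    (N : Bond d → ℝ≥0 → Ω → ℕ) (s t : ℝ≥0) (x y : Site d) : ℝ :=
  P.real {ω | backwardWalk (realization N ω) s t x = y}

/-- The semigroup of the backward walks, acting on bounded functions. -/
def backwardSemigroup {d : ℕ} {Ω : Type*} [MeasurableSpace Ω] (P : Measure Ω)
    (N : Bond d → ℝ≥0 → Ω → ℕ) (s t : ℝ≥0) (f : Site d → ℝ) (x : Site d) : ℝ :=
  ∑' y, backwardProb P N s t x y * f y

/-! ### Pathwise integrals -/

open Classical in
/-- The Lebesgue–Stieltjes measure `dn` of a counting path (zero if the path is not monotone; the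
measure of an interval `(a, b]` is `n b - n a` if `n` is monotone and right-continuous). -/
def countingMeasure (n : ℝ≥0 → ℕ) : Measure ℝ≥0 :=
  if h : Monotone (fun r => (n r : ℝ)) then h.stieltjesFunction.measure else 0

/-- `ζ_{r-}(z) - ζ_{r-}(y)`. -/
def leftDiff {d : ℕ} (ζ : ℝ≥0 → Site d → ℝ) (r : ℝ≥0) (y z : Site d) : ℝ :=
  Function.leftLim (fun u => ζ u z) r - Function.leftLim (fun u => ζ u y) r

/-- Integrability over `(0, t]` of `f` with respect to
`dM_r(ζ_{r-}, y) = ∑_{z ∼ y} (ζ_{r-}(z) - ζ_{r-}(y)) (dN_r({y,z}) - λ_r({y,z}) dr)`. -/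
def IntegrableM {d : ℕ} (lam : Bond d → ℝ≥0 → ℝ≥0) (n : Bond d → ℝ≥0 → ℕ)
    (ζ : ℝ≥0 → Site d → ℝ) (t : ℝ≥0) (y : Site d) (f : ℝ≥0 → ℝ) : Prop :=
  ∀ z : (lattice d).neighborSet y,
    IntegrableOn (fun r => f r * leftDiff ζ r y z) (Ioc 0 t)
      (countingMeasure (n (bond z.2))) ∧
    IntegrableOn (fun r => f r * leftDiff ζ r y z) (Ioc 0 t)
      (intensityMeasure (lam (bond z.2)))

/-- `∫_0^t f(r) dM_r(ζ_{r-}, y)`, where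
`dM_r(ζ_{r-}, y) = ∑_{z ∼ y} (ζ_{r-}(z) - ζ_{r-}(y)) (dN_r({y,z}) - λ_r({y,z}) dr)`. -/
def integralM {d : ℕ} (lam : Bond d → ℝ≥0 → ℝ≥0) (n : Bond d → ℝ≥0 → ℕ)
    (ζ : ℝ≥0 → Site d → ℝ) (t : ℝ≥0) (y : Site d) (f : ℝ≥0 → ℝ) : ℝ :=
  ∑ z : (lattice d).neighborSet y,
    ((∫ r in Ioc 0 t, f r * leftDiff ζ r y z ∂countingMeasure (n (bond z.2))) -
      ∫ r in Ioc 0 t, f r * leftDiff ζ r y z ∂intensityMeasure (lam (bond z.2)))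

/-- `∫_0^t |f(r)| d|M|_r(ζ_{r-}, y)`, where
`d|M|_r(ζ_{r-}, y) = ∑_{z ∼ y} |ζ_{r-}(z) - ζ_{r-}(y)| (dN_r({y,z}) + λ_r({y,z}) dr)`. For `ζ` with
values in `{0,1}`, all the differences `ζ_{r-}(z) - ζ_{r-}(y)`, `z ∼ y`, have the same sign, so that
this is the total variation of `dM_r(ζ_{r-}, y)` as soon as no two bonds have a common event. -/
def integralAbsM {d : ℕ} (lam : Bond d → ℝ≥0 → ℝ≥0) (n : Bond d → ℝ≥0 → ℕ)
    (ζ : ℝ≥0 → Site d → ℝ) (t : ℝ≥0) (y : Site d) (f : ℝ≥0 → ℝ) : ℝ :=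
  ∑ z : (lattice d).neighborSet y,
    ((∫ r in Ioc 0 t, |f r * leftDiff ζ r y z| ∂countingMeasure (n (bond z.2))) +
      ∫ r in Ioc 0 t, |f r * leftDiff ζ r y z| ∂intensityMeasure (lam (bond z.2)))

/-- The mild solution
`ζ_t(x) = Ŝ_{0,t} η(x) + ∫_0^t ∑_y p̂_{r,t}(x, y) dM_r(η_{r-}, y)` at the sample point `ω`, where
`η_r` is the stirring process started from `η`. -/
def mildSolution {d : ℕ} {Ω : Type*} [MeasurableSpace Ω] (P : Measure Ω)
    (lam : Bond d → ℝ≥0 → ℝ≥0) (N : Bond d → ℝ≥0 → Ω → ℕ) (η : Site d → ℝ) (t : ℝ≥0)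
    (x : Site d) (ω : Ω) : ℝ :=
  backwardSemigroup P N 0 t η x +
    ∑' y, integralM lam (realization N ω) (occupation (realization N ω) η) t y
      (fun r => backwardProb P N r t x y)

end Stirring

end

/-! The identity is integration by parts in time, done site by site and then summed. For fixed `t`,
`x`, `y`, put f(r) = p̂_{r,t}(x,y) and g(r) = η_r(y). The occupation variable g moves only when a
bond {y,z} rings and then takes the value that z had just before, so dg = ∑_z (η_{r-}(z) -
η_{r-}(y)) dN_r({y,z}). The function f solves a Kolmogorov equation, df = ∑_z (p̂_{r,t}(x,y) -
p̂_{r,t}(x,z)) λ_r({y,z}) dr. Expanding f(t)g(t) - f(0)g(0) and compensating dN, the integral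
against dM equals the boundary terms minus a sum over z of ∫ (p̂(x,y) η_{r-}(z) - p̂(x,z) η_{r-}(y))
λ dr (`integralM_backwardProb`). This exchange is antisymmetric in (y,z) and absolutely summable
over oriented bonds, so its total vanishes (`hasSum_exchange`). The boundary terms sum to η_t(x),
because p̂_{t,t}(x,·) is a point mass, and to -Ŝ_{0,t}η(x).

The graphical construction is deterministic on good realizations (`IsGood`). Almost every
realization is good: coincident events have probability of second order in the mesh, and in short
time slabs the bonds that ring form subcritical percolation (`IsPoissonFamily.ae_isGood`).
Continuous induction (`rel_of_local`) then gives trajectories and their uniqueness in both time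
directions.

The Kolmogorov equation is the expectation of a pathwise jump formula for the indicator of the
backward walk (`backInd_sub`). Its integrand at time u depends only on increments in (u,t], hence is
independent of earlier increments, and the compensation formula replaces dN by λ dr. Measurability
and independence both come from writing the backward walk as an eventual value of walks discretized
on grids (`backwardWalk_eq_iff_eventually`).

Absolute convergence for one time t follows from an expectation bound, since ∑_y p̂_{r,t}(x,y) ≤ 1.
To have it for all t on one event of full probability, it is imposed at integer times T only and
transferred to t ≤ T through p̂_{r,t}(x,·) ≤ C p̂_{r,T}(x,·) (`exists_backwardProb_le`). -/

namespace Stirring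

/-! ### Continuous induction and counting paths -/

/-- Continuous induction: a transitive relation between times which holds locally to the right and to
the left of every point of `[a, b]` holds between `a` and `b`. -/
lemma rel_of_local {R : ℝ≥0 → ℝ≥0 → Prop} {a b : ℝ≥0} (hab : a ≤ b) (refl : R a a)
    (trans : ∀ u v w, a ≤ u → u ≤ v → v ≤ w → w ≤ b → R u v → R v w → R u w)
    (right : ∀ r, a ≤ r → r < b → ∀ᶠ u in 𝓝[>] r, R r u)
    (left : ∀ r, a < r → r ≤ b → ∀ᶠ u in 𝓝[<] r, R u r) : R a b := by
  set S : Set ℝ≥0 := {r | a ≤ r ∧ r ≤ b ∧ R a r} with hS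
  have haS : a ∈ S := ⟨le_rfl, hab, refl⟩
  have hbdd : BddAbove S := ⟨b, fun r hr => hr.2.1⟩
  set c := sSup S
  have hac : a ≤ c := le_csSup hbdd haS
  have hcb : c ≤ b := csSup_le ⟨a, haS⟩ fun r hr => hr.2.1
  -- The left condition puts the supremum `c` itself in the set; the right condition would then push
  -- the set beyond `c` if `c < b`.
  have hc : R a c := by
    rcases hac.eq_or_lt with h | h
    · rw [← h]; exact refl
    · obtain ⟨l, hl, hlc⟩ := (mem_nhdsLT_iff_exists_Ioo_subset' h).1 (left c h hcb)
      obtain ⟨u, huS, hlu⟩ := exists_lt_of_lt_csSup ⟨a, haS⟩ (show l < sSup S from hl)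
      have huc : u ≤ c := le_csSup hbdd huS
      rcases huc.eq_or_lt with h' | h'
      · exact h' ▸ huS.2.2
      · exact trans a u c le_rfl huS.1 huc hcb huS.2.2 (hlc ⟨hlu, h'⟩)
  rcases hcb.eq_or_lt with h | h
  · exact h ▸ hc
  · exfalso
    obtain ⟨v, hv, hcv⟩ := (mem_nhdsGT_iff_exists_Ioo_subset' h).1 (right c hac h)
    obtain ⟨u, hu1, hu2⟩ := exists_between (lt_min (show c < v from hv) h)
    have hub : u ≤ b := (hu2.le.trans (min_le_right _ _))
    have : u ∈ S := ⟨hac.trans hu1.le, hub,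
      trans a c u le_rfl hac hu1.le hub hc (hcv ⟨hu1, hu2.trans_le (min_le_left _ _)⟩)⟩
    exact absurd (le_csSup hbdd this) (not_le.2 hu1)

lemma nhdsLT_neBot_of_pos {r : ℝ≥0} (h : 0 < r) : (𝓝[<] r).NeBot :=
  nhdsLT_neBot_of_exists_lt ⟨0, h⟩

lemma eventually_left_eq_leftLim {n : ℝ≥0 → ℕ} (hn : Monotone n) (r : ℝ≥0) :
    ∀ᶠ u in 𝓝[<] r, n u = Function.leftLim n r := by
  have := hn.tendsto_leftLim r
  rwa [nhds_discrete, tendsto_pure] at this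

lemma isEvent_iff {n : ℝ≥0 → ℕ} (hn : Monotone n) (r : ℝ≥0) :
    IsEvent n r ↔ Function.leftLim n r ≠ n r := by
  rw [IsEvent, not_iff_not]
  constructor
  · intro h
    -- At time zero the left filter is trivial, so there is no event, and `leftLim` takes the value
    -- of the function by default.
    rcases eq_zero_or_pos (a := r) with rfl | hr
    · exact leftLim_eq_of_isBot isBot_bot
    · have := nhdsLT_neBot_of_pos hr
      obtain ⟨u, h1, h2⟩ := (h.and (eventually_left_eq_leftLim hn r)).exists
      exact h2.symm.trans h1
  · intro h
    filter_upwards [eventually_left_eq_leftLim hn r] with u hu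
    rw [hu, h]

lemma not_isEvent_of_eq {n : ℝ≥0 → ℕ} (hn : Monotone n) {a b r : ℝ≥0} (h : n a = n b)
    (har : a < r) (hrb : r ≤ b) : ¬ IsEvent n r := by
  rw [IsEvent, not_not]
  filter_upwards [Ioo_mem_nhdsLT har] with u hu
  exact le_antisymm (hn hu.2.le) ((hn hrb).trans (h.symm.le.trans (hn hu.1.le)))

lemma pos_of_isEvent {n : ℝ≥0 → ℕ} {r : ℝ≥0} (h : IsEvent n r) : 0 < r := by
  by_contra h0
  have : r = 0 := by simpa using h0
  subst this
  refine h ?_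
  rw [show 𝓝[<] (0 : ℝ≥0) = ⊥ by simp]
  exact eventually_bot

/-! ### Good realizations -/

/-- Realizations of the counting paths for which the graphical construction can be performed: the
paths are simple counting paths, without common events, and the bonds which have an event in a time
slab `(kδ, (k+1)δ]` form finite clusters. -/
structure IsGood {d : ℕ} (n : Bond d → ℝ≥0 → ℕ) : Prop where
  mono : ∀ b, Monotone (n b)
  right : ∀ b t, ∀ᶠ u in 𝓝[>] t, n b u = n b t
  simple : ∀ b r, n b r ≤ Function.leftLim (n b) r + 1
  distinct : ∀ b b' r, IsEvent (n b) r → IsEvent (n b') r → b = b'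
  clusters : ∃ δ : ℝ≥0, 0 < δ ∧ ∀ (k : ℕ) (x : Site d), ∃ C : Set (Site d), C.Finite ∧ x ∈ C ∧
    ∀ y ∈ C, ∀ z, ∀ h : (lattice d).Adj y z, z ∉ C →
      n (bond h) (k * δ) = n (bond h) ((k + 1) * δ)

variable {d : ℕ} {n : Bond d → ℝ≥0 → ℕ}

lemma bond_symm {y z : Site d} (h : (lattice d).Adj y z) : bond h.symm = bond h :=
  Subtype.ext Sym2.eq_swap

lemma eq_of_bond_eq {y z z' : Site d} {h : (lattice d).Adj y z} {h' : (lattice d).Adj y z'}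
    (e : bond h = bond h') : z = z' := by
  have : s(y, z) = s(y, z') := congrArg Subtype.val e
  exact Sym2.congr_right.1 this

/-- A walk which is at `y` just before time `r` is at `z` at time `r`. -/
def Cross (n : Bond d → ℝ≥0 → ℕ) (r : ℝ≥0) (y z : Site d) : Prop :=
  (z = y ∧ ∀ w, ∀ h : (lattice d).Adj y w, ¬ IsEvent (n (bond h)) r) ∨
    ∃ h : (lattice d).Adj y z, IsEvent (n (bond h)) r

/-- An event exchanges the two endpoints of its bond. This reversibility lets every forward
uniqueness statement serve backwards as well. -/
lemma Cross.symm {r : ℝ≥0} {y z : Site d} (h : Cross n r y z) : Cross n r z y := by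
  rcases h with ⟨rfl, h⟩ | ⟨h, he⟩
  · exact Or.inl ⟨rfl, h⟩
  · exact Or.inr ⟨h.symm, by rwa [bond_symm]⟩

lemma exists_cross (n : Bond d → ℝ≥0 → ℕ) (r : ℝ≥0) (y : Site d) : ∃ z, Cross n r y z := by
  by_cases h : ∀ w, ∀ h : (lattice d).Adj y w, ¬ IsEvent (n (bond h)) r
  · exact ⟨y, Or.inl ⟨rfl, h⟩⟩
  · push Not at h
    obtain ⟨w, hw, he⟩ := h
    exact ⟨w, Or.inr ⟨hw, he⟩⟩

lemma Cross.unique (hn : IsGood n) {r : ℝ≥0} {y z z' : Site d} (h : Cross n r y z)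
    (h' : Cross n r y z') : z = z' := by
  rcases h with ⟨rfl, h⟩ | ⟨h, he⟩ <;> rcases h' with ⟨rfl, h'⟩ | ⟨h', he'⟩
  · rfl
  · exact absurd he' (h _ h')
  · exact absurd he (h' _ h)
  · exact eq_of_bond_eq (hn.distinct _ _ r he he')

lemma Cross.unique_left (hn : IsGood n) {r : ℝ≥0} {y y' z : Site d} (h : Cross n r y z)
    (h' : Cross n r y' z) : y = y' := h.symm.unique hn h'.symm

lemma cross_self {r : ℝ≥0} {y : Site d} (h : ∀ w, ∀ h : (lattice d).Adj y w,
    ¬ IsEvent (n (bond h)) r) : Cross n r y y := Or.inl ⟨rfl, h⟩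

/-- Sites have finitely many neighbours, so local constancy in time is uniform over the bonds at one
site. It is not uniform over the whole lattice, which is why clusters are needed later. -/
lemma eventually_forall_adj {l : Filter ℝ≥0} {y : Site d}
    {p : (z : Site d) → (lattice d).Adj y z → ℝ≥0 → Prop}
    (h : ∀ z hz, ∀ᶠ u in l, p z hz u) : ∀ᶠ u in l, ∀ z hz, p z hz u := by
  have : ∀ᶠ u in l, ∀ z : (lattice d).neighborSet y, p z.1 z.2 u :=
    eventually_all.2 fun z => h z.1 z.2
  filter_upwards [this] with u hu z hz using hu ⟨z, hz⟩

/-! ### Trajectories on a compact time interval -/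

/-- `γ` is, on the time interval `[a, b]`, a trajectory of the graphical construction. -/
structure IsTraj (n : Bond d → ℝ≥0 → ℕ) (a b : ℝ≥0) (γ : ℝ≥0 → Site d) : Prop where
  right : ∀ r, a ≤ r → r < b → ∀ᶠ u in 𝓝[>] r, γ u = γ r
  left : ∀ r, a < r → r ≤ b → ∃ y, (∀ᶠ u in 𝓝[<] r, γ u = y) ∧ Cross n r y (γ r)

lemma IsTraj.mono {a b a' b' : ℝ≥0} {γ : ℝ≥0 → Site d} (h : IsTraj n a b γ) (ha : a ≤ a')
    (hb : b' ≤ b) : IsTraj n a' b' γ :=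
  ⟨fun r h1 h2 => h.right r (ha.trans h1) (h2.trans_le hb),
    fun r h1 h2 => h.left r (ha.trans_lt h1) (h2.trans hb)⟩

lemma isTraj_self (a : ℝ≥0) (γ : ℝ≥0 → Site d) : IsTraj n a a γ :=
  ⟨fun _ h1 h2 => absurd h1 (not_le.2 h2), fun _ h1 h2 => absurd h2 (not_le.2 h1)⟩

lemma IsTraj.congr {a b : ℝ≥0} {γ γ' : ℝ≥0 → Site d} (h : IsTraj n a b γ)
    (e : EqOn γ' γ (Icc a b)) : IsTraj n a b γ' := by
  refine ⟨fun r h1 h2 => ?_, fun r h1 h2 => ?_⟩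
  · filter_upwards [h.right r h1 h2, Ioo_mem_nhdsGT h2] with u hu hu'
    rw [e ⟨h1.trans hu'.1.le, hu'.2.le⟩, e ⟨h1, h2.le⟩, hu]
  · obtain ⟨y, hy, hc⟩ := h.left r h1 h2
    refine ⟨y, ?_, by rwa [e ⟨h1.le, h2⟩]⟩
    filter_upwards [hy, Ioo_mem_nhdsLT h1] with u hu hu'
    rw [e ⟨hu'.1.le, hu'.2.le.trans h2⟩, hu]

lemma IsTraj.glue {a b c : ℝ≥0} {γ₁ γ₂ : ℝ≥0 → Site d}
    (h₁ : IsTraj n a b γ₁) (h₂ : IsTraj n b c γ₂) (e : γ₁ b = γ₂ b) :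
    IsTraj n a c (fun u => if u ≤ b then γ₁ u else γ₂ u) := by
  refine ⟨fun r h1 h2 => ?_, fun r h1 h2 => ?_⟩
  · rcases lt_or_ge r b with hr | hr
    · filter_upwards [h₁.right r h1 hr, Ioo_mem_nhdsGT hr] with u hu hu'
      simp [hu'.2.le, hr.le, hu]
    · filter_upwards [h₂.right r hr h2, self_mem_nhdsWithin] with u hu (hu' : r < u)
      rw [if_neg (not_le.2 (hr.trans_lt hu')), hu]
      split_ifs with hrb
      · rw [le_antisymm hrb hr, e]
      · rfl
  · rcases le_or_gt r b with hr | hr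
    · obtain ⟨y, hy, hc⟩ := h₁.left r h1 hr
      refine ⟨y, ?_, by simpa [hr] using hc⟩
      filter_upwards [hy, self_mem_nhdsWithin] with u hu (hu' : u < r)
      rw [if_pos (hu'.le.trans hr), hu]
    · obtain ⟨y, hy, hc⟩ := h₂.left r hr h2
      refine ⟨y, ?_, by simpa [not_le.2 hr] using hc⟩
      filter_upwards [hy, Ioo_mem_nhdsLT hr] with u hu hu'
      rw [if_neg (not_le.2 hu'.1), hu]

/-- Agreement of two trajectories propagates locally: both are constant just after a time, and
crossing is injective and single-valued. Using an equivalence makes one continuous induction yield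
uniqueness in both time directions. -/
lemma IsTraj.eq_iff_eq (hn : IsGood n) {a b : ℝ≥0} (hab : a ≤ b) {γ γ' : ℝ≥0 → Site d}
    (h : IsTraj n a b γ) (h' : IsTraj n a b γ') : γ a = γ' a ↔ γ b = γ' b := by
  refine rel_of_local (R := fun u v => γ u = γ' u ↔ γ v = γ' v) hab Iff.rfl
    (fun u v w _ _ _ _ h1 h2 => h1.trans h2) (fun r h1 h2 => ?_) (fun r h1 h2 => ?_)
  · filter_upwards [h.right r h1 h2, h'.right r h1 h2] with u hu hu'
    rw [hu, hu']
  · obtain ⟨y, hy, hc⟩ := h.left r h1 h2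
    obtain ⟨y', hy', hc'⟩ := h'.left r h1 h2
    filter_upwards [hy, hy'] with u hu hu'
    rw [hu, hu']
    constructor
    · rintro rfl; exact hc.unique hn hc'
    · intro e; rw [e] at hc; exact hc.unique_left hn hc'

lemma IsTraj.eqOn (hn : IsGood n) {a b : ℝ≥0} {γ γ' : ℝ≥0 → Site d}
    (h : IsTraj n a b γ) (h' : IsTraj n a b γ') (e : γ a = γ' a) : EqOn γ γ' (Icc a b) :=
  fun _ hu => ((h.mono le_rfl hu.2).eq_iff_eq hn hu.1 (h'.mono le_rfl hu.2)).1 e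

lemma IsTraj.eqOn' (hn : IsGood n) {a b : ℝ≥0} {γ γ' : ℝ≥0 → Site d}
    (h : IsTraj n a b γ) (h' : IsTraj n a b γ') (e : γ b = γ' b) : EqOn γ γ' (Icc a b) :=
  fun _ hu => ((h.mono hu.1 le_rfl).eq_iff_eq hn hu.2 (h'.mono hu.1 le_rfl)).2 e

/-- The constant trajectory, when no bond incident to the site has an event. -/
lemma isTraj_const (hn : IsGood n) {a b : ℝ≥0} {y : Site d}
    (h : ∀ z, ∀ hz : (lattice d).Adj y z, n (bond hz) b = n (bond hz) a) :
    IsTraj n a b (fun _ => y) := by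
  refine ⟨fun r _ _ => Eventually.of_forall fun _ => rfl, fun r h1 h2 => ⟨y,
    Eventually.of_forall fun _ => rfl, cross_self fun z hz =>
      not_isEvent_of_eq (hn.mono _) (h z hz).symm h1 h2⟩⟩

lemma eventually_isTraj_const (hn : IsGood n) (r : ℝ≥0) (y : Site d) :
    ∀ᶠ u in 𝓝[>] r, IsTraj n r u (fun _ => y) := by
  filter_upwards [eventually_forall_adj (y := y) (p := fun z hz u => n (bond hz) u = n (bond hz) r)
    fun z hz => hn.right _ _] with u hu
  exact isTraj_const hn hu

-- Just before `r` no bond at `y` has an event, so waiting at `y` and crossing at `r` is a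
-- trajectory. Only the bonds at `y` matter; events near `z` before `r` play no role.
open Classical in
lemma eventually_isTraj_cross (hn : IsGood n) {r : ℝ≥0} (hr : 0 < r) {y z : Site d}
    (hyz : Cross n r y z) :
    ∀ᶠ u in 𝓝[<] r, IsTraj n u r (fun v => if v < r then y else z) := by
  have key : ∀ᶠ u in 𝓝[<] r, ∀ w, ∀ hw : (lattice d).Adj y w,
      n (bond hw) u = Function.leftLim (n (bond hw)) r :=
    eventually_forall_adj (p := fun z hz u => n (bond hz) u = Function.leftLim (n (bond hz)) r)
      fun z hz => eventually_left_eq_leftLim (hn.mono _) r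
  filter_upwards [key] with u hu
  have hconst : ∀ v, u ≤ v → v < r → ∀ w, ∀ hw : (lattice d).Adj y w,
      n (bond hw) v = n (bond hw) u := fun v huv hvr w hw =>
    le_antisymm (((hn.mono _).le_leftLim hvr).trans (hu w hw).ge) (hn.mono _ huv)
  refine ⟨fun v h1 h2 => ?_, fun v h1 h2 => ?_⟩
  · filter_upwards [Ioo_mem_nhdsGT h2] with w hw
    simp [hw.2, h2]
  · refine ⟨y, ?_, ?_⟩
    · filter_upwards [self_mem_nhdsWithin] with w (hw : w < v)
      simp [hw.trans_le h2]
    · rcases h2.eq_or_lt with rfl | h2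
      · simpa using hyz
      · simp only [h2, if_true]
        exact cross_self fun w hw => not_isEvent_of_eq (hn.mono _) (hconst v h1.le h2 w hw).symm
          h1 le_rfl

/-- Trajectories exist in a time slab in which the clusters are finite. -/
lemma exists_isTraj_of_finite (hn : IsGood n) {A B : ℝ≥0} (hAB : A ≤ B) {C : Set (Site d)}
    (hC : C.Finite)
    (hclosed : ∀ y ∈ C, ∀ z, ∀ h : (lattice d).Adj y z, z ∉ C → n (bond h) A = n (bond h) B) :
    (∀ x ∈ C, ∃ γ, IsTraj n A B γ ∧ γ A = x ∧ γ B ∈ C) ∧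
      (∀ x ∈ C, ∃ γ, IsTraj n A B γ ∧ γ B = x ∧ γ A ∈ C) := by
  -- Bonds leaving `C` are silent on the slab, so a crossing cannot leave `C`.
  have hcross : ∀ r, A < r → r ≤ B → ∀ y z, Cross n r y z → y ∈ C → z ∈ C := by
    intro r h1 h2 y z hyz hy
    rcases hyz with ⟨rfl, -⟩ | ⟨h, he⟩
    · exact hy
    · by_contra hz
      exact not_isEvent_of_eq (hn.mono _) (hclosed y hy z h hz) h1 h2 he
  refine rel_of_local (R := fun u v => (∀ x ∈ C, ∃ γ, IsTraj n u v γ ∧ γ u = x ∧ γ v ∈ C) ∧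
      (∀ x ∈ C, ∃ γ, IsTraj n u v γ ∧ γ v = x ∧ γ u ∈ C)) hAB
      ⟨fun x hx => ⟨fun _ => x, isTraj_self _ _, rfl, hx⟩,
        fun x hx => ⟨fun _ => x, isTraj_self _ _, rfl, hx⟩⟩ ?_ ?_ ?_
  · rintro u v w - huv hvw - ⟨h1, h1'⟩ ⟨h2, h2'⟩
    have hw : ∀ γ₁ γ₂ : ℝ≥0 → Site d, γ₁ v = γ₂ v →
        (if w ≤ v then γ₁ w else γ₂ w) = γ₂ w := by
      intro γ₁ γ₂ e
      split_ifs with h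
      · rw [le_antisymm h hvw, e]
      · rfl
    refine ⟨fun x hx => ?_, fun x hx => ?_⟩
    · obtain ⟨γ₁, t1, e1, c1⟩ := h1 x hx
      obtain ⟨γ₂, t2, e2, c2⟩ := h2 _ c1
      exact ⟨_, t1.glue t2 e2.symm, by simp [huv, e1], by simpa only [hw _ _ e2.symm] using c2⟩
    · obtain ⟨γ₂, t2, e2, c2⟩ := h2' x hx
      obtain ⟨γ₁, t1, e1, c1⟩ := h1' _ c2
      exact ⟨_, t1.glue t2 e1, by simpa only [hw _ _ e1] using e2, by simpa [huv] using c1⟩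
  · intro r _ _
    -- Finiteness of `C` is used here and in the left step: one neighbourhood of `r` must serve all
    -- sites of `C`.
    have : ∀ᶠ u in 𝓝[>] r, ∀ x ∈ C, IsTraj n r u (fun _ => x) :=
      (eventually_all_finite hC).2 fun x _ => eventually_isTraj_const hn r x
    filter_upwards [this] with u hu
    exact ⟨fun x hx => ⟨_, hu x hx, rfl, hx⟩, fun x hx => ⟨_, hu x hx, rfl, hx⟩⟩
  · intro r h1 h2
    have hr : 0 < r := (zero_le (a := A)).trans_lt h1
    choose σ hσ using exists_cross n r
    classical
    have : ∀ᶠ u in 𝓝[<] r, ∀ x ∈ C, IsTraj n u r (fun v => if v < r then x else σ x) :=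
      (eventually_all_finite hC).2 fun x _ => eventually_isTraj_cross hn hr (hσ x)
    filter_upwards [this, self_mem_nhdsWithin] with u hu (hur : u < r)
    have hσC : ∀ x ∈ C, σ x ∈ C := fun x hx => hcross r h1 h2 x _ (hσ x) hx
    refine ⟨fun x hx => ⟨_, hu x hx, by simp [hur], by simpa using hσC x hx⟩,
      fun x hx => ⟨_, hu (σ x) (hσC x hx), ?_, by simpa [hur] using hσC x hx⟩⟩
    -- Crossing is an involution, so the trajectory that ends at `x` is the one waiting at `σ x`.
    simpa using (hσ (σ x)).unique hn (hσ x).symm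

lemma exists_slab {δ : ℝ≥0} (hδ : 0 < δ) (r : ℝ≥0) : ∃ k : ℕ, k * δ ≤ r ∧ r < (k + 1) * δ := by
  refine ⟨⌊r / δ⌋₊, ?_, ?_⟩
  · exact (le_div_iff₀ hδ).1 (Nat.floor_le zero_le)
  · exact (div_lt_iff₀ hδ).1 (Nat.lt_floor_add_one _)

/-- Left-open slabs serve the left half of the continuous induction, where `r` may be a slab
boundary. -/
lemma exists_slab' {δ : ℝ≥0} (hδ : 0 < δ) {r : ℝ≥0} (hr : 0 < r) :
    ∃ k : ℕ, k * δ < r ∧ r ≤ (k + 1) * δ := by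
  obtain ⟨k, h1, h2⟩ := exists_slab hδ r
  rcases h1.eq_or_lt with h | h
  · rcases k with _ | k
    · simp at h; exact absurd h hr.ne
    · refine ⟨k, ?_, by rw [← h]; push_cast; rfl⟩
      rw [← h]
      exact mul_lt_mul_of_pos_right (by push_cast; exact lt_add_one _) hδ
  · exact ⟨k, h, h2.le⟩

/-- Trajectories exist forwards and backwards, from any site, between any two times. -/
lemma exists_isTraj (hn : IsGood n) {a b : ℝ≥0} (hab : a ≤ b) :
    (∀ x, ∃ γ, IsTraj n a b γ ∧ γ a = x) ∧ (∀ x, ∃ γ, IsTraj n a b γ ∧ γ b = x) := by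
  obtain ⟨δ, hδ, hcl⟩ := hn.clusters
  have slab : ∀ k : ℕ, ∀ u v, k * δ ≤ u → u ≤ v → v ≤ (k + 1) * δ →
      (∀ x, ∃ γ, IsTraj n u v γ ∧ γ u = x) ∧ (∀ x, ∃ γ, IsTraj n u v γ ∧ γ v = x) := by
    intro k u v hu huv hv
    refine ⟨fun x => ?_, fun x => ?_⟩ <;> obtain ⟨C, hC, hx, hcl'⟩ := hcl k x
    all_goals
      -- By monotonicity, no increment over the whole slab means no increment over a subinterval.
      have hcl2 : ∀ y ∈ C, ∀ z, ∀ h : (lattice d).Adj y z, z ∉ C →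
          n (bond h) u = n (bond h) v := fun y hy z h hz =>
        le_antisymm (hn.mono _ huv) ((hn.mono _ hv).trans ((hcl' y hy z h hz).ge.trans
          (hn.mono _ hu)))
      have := exists_isTraj_of_finite hn huv hC hcl2
    · obtain ⟨γ, h1, h2, -⟩ := this.1 x hx
      exact ⟨γ, h1, h2⟩
    · obtain ⟨γ, h1, h2, -⟩ := this.2 x hx
      exact ⟨γ, h1, h2⟩
  refine rel_of_local (R := fun u v => (∀ x, ∃ γ, IsTraj n u v γ ∧ γ u = x) ∧
    (∀ x, ∃ γ, IsTraj n u v γ ∧ γ v = x)) hab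
      ⟨fun x => ⟨fun _ => x, isTraj_self _ _, rfl⟩, fun x => ⟨fun _ => x, isTraj_self _ _, rfl⟩⟩
      ?_ ?_ ?_
  · rintro u v w - huv hvw - ⟨h1, h1'⟩ ⟨h2, h2'⟩
    refine ⟨fun x => ?_, fun x => ?_⟩
    · obtain ⟨γ₁, t1, e1⟩ := h1 x
      obtain ⟨γ₂, t2, e2⟩ := h2 (γ₁ v)
      exact ⟨_, t1.glue t2 e2.symm, by simp [huv, e1]⟩
    · obtain ⟨γ₂, t2, e2⟩ := h2' x
      obtain ⟨γ₁, t1, e1⟩ := h1' (γ₂ v)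
      refine ⟨_, t1.glue t2 e1, ?_⟩
      split_ifs with h
      · rw [← e2, le_antisymm h hvw, e1]
      · exact e2
  · intro r _ _
    obtain ⟨k, h1, h2⟩ := exists_slab hδ r
    filter_upwards [Ioo_mem_nhdsGT h2] with u hu
    exact slab k r u h1 hu.1.le hu.2.le
  · intro r h _
    obtain ⟨k, h1, h2⟩ := exists_slab' hδ ((zero_le (a := a)).trans_lt h)
    filter_upwards [Ioo_mem_nhdsLT h1] with u hu
    exact slab k u r hu.1.le hu.2.le h2

/-! ### Forward and backward walks -/

lemma IsForwardPath.isTraj {s x γ} (h : IsForwardPath n s x γ) (t : ℝ≥0) : IsTraj n s t γ :=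
  ⟨fun r h1 _ => h.right r h1, fun r h1 _ => h.jump r h1⟩

/-- Trajectories on `[s, t]` for different `t` agree by uniqueness, so the diagonal `u ↦ Γ u u` is a
trajectory on all of `[s, ∞)`. -/
lemma exists_isForwardPath (hn : IsGood n) (s : ℝ≥0) (x : Site d) :
    ∃ γ, IsForwardPath n s x γ := by
  have : ∀ t, ∃ γ, s ≤ t → IsTraj n s t γ ∧ γ s = x := fun t => by
    by_cases h : s ≤ t
    · obtain ⟨γ, h'⟩ := (exists_isTraj hn h).1 x
      exact ⟨γ, fun _ => h'⟩
    · exact ⟨fun _ => x, fun h' => absurd h' h⟩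
  choose Γ hΓ using this
  have agree : ∀ t, s ≤ t → EqOn (fun u => Γ u u) (Γ t) (Icc s t) := fun t ht u hu =>
    (hΓ u hu.1).1.eqOn hn ((hΓ t ht).1.mono le_rfl hu.2)
      ((hΓ u hu.1).2.trans (hΓ t ht).2.symm) ⟨hu.1, le_rfl⟩
  have tr : ∀ t, s ≤ t → IsTraj n s t (fun u => Γ u u) := fun t ht => (hΓ t ht).1.congr (agree t ht)
  refine ⟨fun u => Γ u u, (hΓ s le_rfl).2, fun r hr => ?_, fun r hr => ?_⟩
  · exact (tr (r + 1) (hr.trans le_self_add)).right r hr (lt_add_one r)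
  · exact (tr r hr.le).left r hr le_rfl

lemma forwardWalk_eq (hn : IsGood n) {s t : ℝ≥0} (hst : s ≤ t) {γ : ℝ≥0 → Site d}
    (h : IsTraj n s t γ) : forwardWalk n s t (γ s) = γ t := by
  have hex := exists_isForwardPath hn s (γ s)
  rw [forwardWalk, dif_pos hex]
  exact (hex.choose_spec.isTraj t).eqOn hn h hex.choose_spec.start ⟨hst, le_rfl⟩

lemma exists_forwardWalk_eq (hn : IsGood n) {s t : ℝ≥0} (hst : s ≤ t) (x : Site d) :
    ∃ γ, IsTraj n s t γ ∧ γ s = x ∧ γ t = forwardWalk n s t x := by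
  obtain ⟨γ, h, rfl⟩ := (exists_isTraj hn hst).1 x
  exact ⟨γ, h, rfl, (forwardWalk_eq hn hst h).symm⟩

/-- Uniqueness backwards in time makes the choice in the definition harmless: the walk can be read
off any trajectory. -/
lemma backwardWalk_eq (hn : IsGood n) {s t : ℝ≥0} (hst : s ≤ t) {γ : ℝ≥0 → Site d}
    (h : IsTraj n s t γ) : backwardWalk n s t (γ t) = γ s := by
  have hex : ∃ x, forwardWalk n s t x = γ t := ⟨γ s, forwardWalk_eq hn hst h⟩
  rw [backwardWalk, dif_pos hex]
  obtain ⟨γ', h', e1, e2⟩ := exists_forwardWalk_eq hn hst hex.choose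
  rw [hex.choose_spec] at e2
  rw [← e1]
  exact h'.eqOn' hn h e2 ⟨le_rfl, hst⟩

lemma IsGood.walksWellDefined (hn : IsGood n) : WalksWellDefined n := by
  refine ⟨fun s x => ?_, fun s t hst => ⟨fun x x' e => ?_, fun y => ?_⟩⟩
  · obtain ⟨γ, h⟩ := exists_isForwardPath hn s x
    refine ⟨γ, h, fun γ' h' u hu => ?_⟩
    exact (h'.isTraj u).eqOn hn (h.isTraj u) (h'.start.trans h.start.symm) ⟨hu, le_rfl⟩
  · obtain ⟨γ, h, rfl, e1⟩ := exists_forwardWalk_eq hn hst x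
    obtain ⟨γ', h', rfl, e2⟩ := exists_forwardWalk_eq hn hst x'
    exact h.eqOn' hn h' (e1.trans (e.trans e2.symm)) ⟨le_rfl, hst⟩
  · obtain ⟨γ, h, rfl⟩ := (exists_isTraj hn hst).2 y
    exact ⟨γ s, forwardWalk_eq hn hst h⟩

lemma backwardWalk_self (hn : IsGood n) (t : ℝ≥0) (x : Site d) : backwardWalk n t t x = x :=
  backwardWalk_eq hn le_rfl (isTraj_self t fun _ => x)

/-- As a function of its final time, the backward walk is a trajectory. -/
lemma isTraj_backwardWalk (hn : IsGood n) (t : ℝ≥0) (x : Site d) :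
    IsTraj n 0 t (fun u => backwardWalk n u t x) := by
  obtain ⟨γ, h, rfl⟩ := (exists_isTraj hn (zero_le (a := t))).2 x
  exact h.congr fun u hu => backwardWalk_eq hn hu.2 (h.mono hu.1 le_rfl)

lemma backwardWalk_comp (hn : IsGood n) {s r t : ℝ≥0} (hsr : s ≤ r) (hrt : r ≤ t) (x : Site d) :
    backwardWalk n s r (backwardWalk n r t x) = backwardWalk n s t x :=
  backwardWalk_eq hn hsr ((isTraj_backwardWalk hn t x).mono zero_le hrt)

lemma backwardWalk_of_eq (hn : IsGood n) {a b : ℝ≥0} (hab : a ≤ b) {y : Site d}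
    (h : ∀ z, ∀ hz : (lattice d).Adj y z, n (bond hz) b = n (bond hz) a) :
    backwardWalk n a b y = y :=
  backwardWalk_eq hn hab (isTraj_const hn h)

lemma eventually_backwardWalk_right (hn : IsGood n) {s r : ℝ≥0} (hsr : s ≤ r) (y : Site d) :
    ∀ᶠ u in 𝓝[>] r, backwardWalk n s u y = backwardWalk n s r y := by
  filter_upwards [eventually_isTraj_const hn r y, self_mem_nhdsWithin] with u hu (hru : r < u)
  rw [← backwardWalk_comp hn hsr hru.le, backwardWalk_eq hn hru.le hu]

/-- Traced back from time `r`, the walk at `z` sits at `y` just before `r`; from there on the two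
backward walks coincide. -/
lemma eventually_backwardWalk_left (hn : IsGood n) {s r : ℝ≥0} (hsr : s < r) {y z : Site d}
    (hyz : Cross n r y z) :
    ∀ᶠ u in 𝓝[<] r, backwardWalk n s u y = backwardWalk n s r z := by
  classical
  filter_upwards [eventually_isTraj_cross hn (zero_le.trans_lt hsr) hyz, Ioo_mem_nhdsLT hsr]
    with u hu hur
  have := backwardWalk_eq hn hur.2.le hu
  simp only [lt_irrefl, if_false, hur.2, if_true] at this
  rw [← backwardWalk_comp hn hur.1.le hur.2.le z, this]

end Stirring

namespace Stirring

/-! ### Intensity measures and the Poisson law -/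

lemma timeVolume_Ioc (a b : ℝ≥0) : timeVolume (Ioc a b) = ((b - a : ℝ≥0) : ℝ≥0∞) := by
  have hemb : MeasurableEmbedding ((↑) : ℝ≥0 → ℝ) :=
    MeasurableEmbedding.subtype_coe measurableSet_Ici
  rw [timeVolume, hemb.comap_apply]
  have : ((↑) : ℝ≥0 → ℝ) '' Ioc a b = Ioc (a : ℝ) b := by
    ext x
    constructor
    · rintro ⟨y, hy, rfl⟩
      exact ⟨NNReal.coe_lt_coe.2 hy.1, NNReal.coe_le_coe.2 hy.2⟩
    · intro hx
      exact ⟨⟨x, a.2.trans hx.1.le⟩, ⟨hx.1, hx.2⟩, rfl⟩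
  rw [this, Real.volume_Ioc, ENNReal.ofReal]
  congr 1

lemma intensityMeasure_le {l : ℝ≥0 → ℝ≥0} {α : ℝ≥0} (h : ∀ t, l t ≤ α) :
    intensityMeasure l ≤ α • timeVolume := by
  have : intensityMeasure l ≤ timeVolume.withDensity fun _ => (α : ℝ≥0∞) :=
    withDensity_mono (ae_of_all _ fun t => ENNReal.coe_le_coe.2 (h t))
  rwa [withDensity_const] at this

lemma intensityMeasure_Ioc_le {l : ℝ≥0 → ℝ≥0} {α : ℝ≥0} (h : ∀ t, l t ≤ α) (a b : ℝ≥0) :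
    intensityMeasure l (Ioc a b) ≤ ((α * (b - a) : ℝ≥0) : ℝ≥0∞) := by
  refine (intensityMeasure_le h _).trans ?_
  rw [Measure.smul_apply, timeVolume_Ioc, ENNReal.coe_mul]
  rfl

lemma intensityMeasure_Ioc_lt_top {l : ℝ≥0 → ℝ≥0} {α : ℝ≥0} (h : ∀ t, l t ≤ α) (a b : ℝ≥0) :
    intensityMeasure l (Ioc a b) < ∞ :=
  (intensityMeasure_Ioc_le h a b).trans_lt ENNReal.coe_lt_top

lemma intensityMeasure_Ioc_toNNReal_le {l : ℝ≥0 → ℝ≥0} {α : ℝ≥0} (h : ∀ t, l t ≤ α)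
    (a b : ℝ≥0) : (intensityMeasure l (Ioc a b)).toNNReal ≤ α * (b - a) := by
  simpa using ENNReal.toNNReal_mono ENNReal.coe_ne_top (intensityMeasure_Ioc_le h a b)

lemma poissonMeasure_ne_zero_le (r : ℝ≥0) : poissonMeasure r {k | k ≠ 0} ≤ r := by
  have h : (poissonMeasure r).real {k | k ≠ 0} ≤ r := by
    have : {k : ℕ | k ≠ 0} = {0}ᶜ := rfl
    rw [this, probReal_compl_eq_one_sub (measurableSet_singleton _),
      poissonMeasure_real_singleton]
    simp only [pow_zero, Nat.factorial_zero, Nat.cast_one]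
    linarith [Real.add_one_le_exp (-(r : ℝ))]
  rw [← ENNReal.ofReal_coe_nnreal, ← ofReal_measureReal]
  exact ENNReal.ofReal_le_ofReal h

lemma poissonMeasure_two_le_le (r : ℝ≥0) :
    poissonMeasure r {k | 2 ≤ k} ≤ ((r ^ 2 : ℝ≥0) : ℝ≥0∞) := by
  have h : (poissonMeasure r).real {k | 2 ≤ k} ≤ ((r ^ 2 : ℝ≥0) : ℝ) := by
    have : {k : ℕ | 2 ≤ k} = ({0} ∪ {1})ᶜ := by
      ext k; simp; omega
    rw [this, probReal_compl_eq_one_sub (by measurability),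
      measureReal_union (by simp) (measurableSet_singleton _),
      poissonMeasure_real_singleton, poissonMeasure_real_singleton]
    simp only [pow_zero, Nat.factorial_zero, Nat.cast_one, pow_one, Nat.factorial_one, mul_one,
      div_one, NNReal.coe_pow]
    -- From `exp (-r) ≥ 1 - r`: 1 - exp(-r)(1 + r) ≤ 1 - (1 - r)(1 + r) = r².
    nlinarith [Real.add_one_le_exp (-(r : ℝ)), r.2, show (0 : ℝ) ≤ r from r.2]
  rw [← ENNReal.ofReal_coe_nnreal, ← ofReal_measureReal]
  exact ENNReal.ofReal_le_ofReal h

lemma poissonMeasure_singleton_zero_pos (r : ℝ≥0) : 0 < poissonMeasure r {0} := by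
  rw [poissonMeasure_singleton]
  simp [Real.exp_pos]

lemma hasSum_poisson_mean (r : ℝ≥0) :
    HasSum (fun k : ℕ => Real.exp (-r) * r ^ k / (k.factorial) * (k : ℝ)) r := by
  rw [← hasSum_nat_add_iff' 1]
  have h := (hasSum_one_poissonMeasure r).mul_left (r : ℝ)
  convert! h using 1
  · ext k
    rw [Nat.factorial_succ]
    push_cast
    field_simp
    ring
  · simp

lemma integrable_natCast_poissonMeasure (r : ℝ≥0) :
    Integrable (fun k : ℕ => (k : ℝ)) (poissonMeasure r) := by
  rw [integrable_poissonMeasure_iff]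
  simpa using (hasSum_poisson_mean r).summable

lemma integral_natCast_poissonMeasure (r : ℝ≥0) :
    ∫ k : ℕ, (k : ℝ) ∂poissonMeasure r = r := by
  rw [integral_poissonMeasure]
  exact (hasSum_poisson_mean r).tsum_eq

section Increments

variable {Ω : Type*} [MeasurableSpace Ω] {P : Measure Ω} {l : ℝ≥0 → ℝ≥0} {N : ℝ≥0 → Ω → ℕ}

lemma IsPoissonProcess.measurable_sub (hN : IsPoissonProcess P l N) (s t : ℝ≥0) :
    Measurable (fun ω => N t ω - N s ω) := (hN.measurable t).sub (hN.measurable s)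

lemma IsPoissonProcess.integrable_sub (hN : IsPoissonProcess P l N) {s t : ℝ≥0} (hst : s ≤ t) :
    Integrable (fun ω => ((N t ω - N s ω : ℕ) : ℝ)) P := by
  have h := hN.law s t hst
  have := integrable_natCast_poissonMeasure (intensityMeasure l (Ioc s t)).toNNReal
  rw [← h.map_eq] at this
  exact this.comp_aemeasurable h.aemeasurable

lemma IsPoissonProcess.integral_sub (hN : IsPoissonProcess P l N) {s t : ℝ≥0} (hst : s ≤ t) :
    ∫ ω, ((N t ω - N s ω : ℕ) : ℝ) ∂P = (intensityMeasure l).real (Ioc s t) := by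
  have h := hN.law s t hst
  have := h.integral_comp (f := fun k : ℕ => (k : ℝ)) (by fun_prop)
  rw [integral_natCast_poissonMeasure] at this
  exact this

lemma IsPoissonProcess.measure_sub_ne_zero_le (hN : IsPoissonProcess P l N) {α : ℝ≥0}
    (hl : ∀ t, l t ≤ α) {s t : ℝ≥0} (hst : s ≤ t) :
    P {ω | N t ω - N s ω ≠ 0} ≤ ((α * (t - s) : ℝ≥0) : ℝ≥0∞) := by
  rw [(hN.law s t hst).measure_eq (p := fun k => k ≠ 0) (by measurability)]
  exact (poissonMeasure_ne_zero_le _).trans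
    (ENNReal.coe_le_coe.2 (intensityMeasure_Ioc_toNNReal_le hl s t))

lemma IsPoissonProcess.measure_two_le_sub_le (hN : IsPoissonProcess P l N) {α : ℝ≥0}
    (hl : ∀ t, l t ≤ α) {s t : ℝ≥0} (hst : s ≤ t) :
    P {ω | 2 ≤ N t ω - N s ω} ≤ (((α * (t - s)) ^ 2 : ℝ≥0) : ℝ≥0∞) := by
  rw [(hN.law s t hst).measure_eq (p := fun k => 2 ≤ k) (by measurability)]
  exact (poissonMeasure_two_le_le _).trans
    (ENNReal.coe_le_coe.2 (pow_le_pow_left₀ zero_le (intensityMeasure_Ioc_toNNReal_le hl s t) 2))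

lemma IsPoissonProcess.measure_sub_eq_zero_pos (hN : IsPoissonProcess P l N) {s t : ℝ≥0}
    (hst : s ≤ t) : 0 < P {ω | N t ω - N s ω = 0} := by
  rw [(hN.law s t hst).measure_eq (p := fun k => k = 0) (by measurability)]
  exact poissonMeasure_singleton_zero_pos _

/-- If the probability that `A a b` occurs is at most of order `(b - a) ^ 2`, then almost surely
there is no time `r > 0` such that `A a b` occurs for all intervals `(a, b]` containing `r`. -/
lemma ae_forall_time_of_sq {A : ℝ≥0 → ℝ≥0 → Set Ω} {K : ℝ≥0}
    (hA : ∀ a δ, P (A a (a + δ)) ≤ ((K * δ ^ 2 : ℝ≥0) : ℝ≥0∞)) :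
    ∀ᵐ ω ∂P, ∀ r, 0 < r → ¬ ∀ a b, a < r → r ≤ b → ω ∈ A a b := by
  have key : ∀ T : ℕ, ∀ᵐ ω ∂P, ∀ r : ℝ≥0, 0 < r → r ≤ T → ¬ ∀ a b, a < r → r ≤ b → ω ∈ A a b := by
    intro T
    rw [ae_iff]
    set B := {ω | ¬ ∀ r : ℝ≥0, 0 < r → r ≤ T → ¬ ∀ a b, a < r → r ≤ b → ω ∈ A a b}
    have hB : ∀ m : ℕ, P B ≤ ((K * T ^ 2 * (1 / (m + 1)) : ℝ≥0) : ℝ≥0∞) := by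
      intro m
      -- Union bound over the `m + 1` cells of mesh `δ`: (m + 1) K δ² = K T² / (m + 1), which tends
      -- to zero.
      set δ : ℝ≥0 := T / (m + 1)
      have hsub : B ⊆ ⋃ k ∈ Finset.range (m + 1), A (k * δ) (k * δ + δ) := by
        intro ω hω
        simp only [B, mem_ofPred_eq] at hω
        push Not at hω
        obtain ⟨r, hr0, hrT, hr⟩ := hω
        have hδ : 0 < δ := div_pos (hr0.trans_le hrT) (by positivity)
        obtain ⟨k, h1, h2⟩ := exists_slab' hδ hr0
        refine mem_biUnion (x := k) ?_ (hr _ _ h1 (by rwa [add_mul, one_mul] at h2))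
        simp only [Finset.coe_range, mem_Iio]
        have : k * δ < ((m + 1 : ℕ) : ℝ≥0) * δ := h1.trans_le (hrT.trans (by
          simp only [δ]; push_cast; rw [mul_div_cancel₀]; positivity))
        exact_mod_cast lt_of_mul_lt_mul_right this zero_le
      calc P B ≤ ∑ k ∈ Finset.range (m + 1), P (A (k * δ) (k * δ + δ)) :=
            (measure_mono hsub).trans (measure_biUnion_finset_le _ _)
        _ ≤ ∑ k ∈ Finset.range (m + 1), ((K * δ ^ 2 : ℝ≥0) : ℝ≥0∞) :=
            Finset.sum_le_sum fun k _ => hA _ _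
        _ = ((K * T ^ 2 * (1 / (m + 1)) : ℝ≥0) : ℝ≥0∞) := by
            rw [Finset.sum_const, Finset.card_range, nsmul_eq_mul]
            norm_cast
            simp only [δ]
            push_cast
            field_simp
    have hlim : Tendsto (fun m : ℕ => ((K * T ^ 2 * (1 / (m + 1)) : ℝ≥0) : ℝ≥0∞)) atTop (𝓝 0) := by
      rw [← ENNReal.coe_zero, ENNReal.tendsto_coe]
      simpa using (tendsto_one_div_add_atTop_nhds_zero_nat (𝕜 := ℝ≥0)).const_mul (K * (T : ℝ≥0) ^ 2)
    exact le_antisymm (ge_of_tendsto' hlim hB) zero_le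
  filter_upwards [ae_all_iff.2 key] with ω hω r hr
  obtain ⟨T, hT⟩ := exists_nat_ge r
  exact hω T r hr hT

/-- A jump of size at least two at `r` gives an increment at least two over every `(a, b]`
containing `r`, an event of probability at most (α(b - a))². -/
lemma IsPoissonProcess.ae_simple (hN : IsPoissonProcess P l N) {α : ℝ≥0}
    (hl : ∀ t, l t ≤ α) :
    ∀ᵐ ω ∂P, ∀ r, N r ω ≤ Function.leftLim (fun t => N t ω) r + 1 := by
  have := ae_forall_time_of_sq (P := P) (A := fun a b => {ω | 2 ≤ N b ω - N a ω}) (K := α ^ 2)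
    fun a δ => (hN.measure_two_le_sub_le hl le_self_add).trans (by
      rw [add_tsub_cancel_left, mul_pow])
  filter_upwards [this, hN.path] with ω hω hp r
  rcases eq_zero_or_pos (a := r) with rfl | hr
  · rw [leftLim_eq_of_isBot (a := (0 : ℝ≥0)) isBot_bot]; exact Nat.le_succ _
  · by_contra hlt
    refine hω r hr fun a b ha hb => ?_
    have h1 := hp.2.1.le_leftLim ha
    have h2 := hp.2.1 hb
    show 2 ≤ N b ω - N a ω
    simp only at h1 h2
    omega

end Increments

/-! ### Subcritical percolation -/

open Classical in
/-- The lists of bonds crossed by the lattice walks of length `L` started from `x`. -/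
noncomputable def bondLists {d : ℕ} : ℕ → Site d → Finset (List (Bond d))
  | 0, _ => {[]}
  | L + 1, x => Finset.univ.biUnion fun z : (lattice d).neighborSet x =>
      (bondLists L z.1).image (List.cons (bond z.2))

/-- The neighbours lie in the cube of radius one around `x`. The crude constant suffices, as only
some geometric growth rate is needed. -/
lemma card_neighborSet_le {d : ℕ} (x : Site d) :
    Fintype.card ((lattice d).neighborSet x) ≤ 3 ^ d := by
  have h1 : (lattice d).neighborSet x ⊆ (Finset.Icc (x - 1) (x + 1) : Finset (Site d)) := by
    intro y hy
    have hy' : ∑ i, |x i - y i| = 1 := hy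
    have key : ∀ i, |x i - y i| ≤ 1 := fun i =>
      hy' ▸ Finset.single_le_sum (f := fun i => |x i - y i|) (fun j _ => abs_nonneg _)
        (Finset.mem_univ i)
    rw [Finset.coe_Icc]
    refine ⟨fun i => ?_, fun i => ?_⟩ <;> have := abs_le.1 (key i) <;> simp <;> omega
  have h2 : Fintype.card ((lattice d).neighborSet x) ≤ (Finset.Icc (x - 1) (x + 1)).card := by
    rw [← Set.toFinset_card]
    exact Finset.card_le_card fun y hy => by simpa using h1 (Set.mem_toFinset.1 hy)
  refine h2.trans ?_
  rw [Pi.card_Icc]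
  have : ∀ i, (Finset.Icc ((x - 1) i) ((x + 1) i)).card = 3 := fun i => by
    rw [Int.card_Icc]; simp; omega
  rw [Finset.prod_congr rfl fun i _ => this i]
  simp

lemma card_bondLists_le {d : ℕ} (L : ℕ) (x : Site d) : (bondLists L x).card ≤ (3 ^ d) ^ L := by
  induction L generalizing x with
  | zero => simp [bondLists]
  | succ L ih =>
    rw [bondLists, pow_succ, mul_comm]
    refine Finset.card_biUnion_le.trans ((Finset.sum_le_sum fun z _ =>
      Finset.card_image_le.trans (ih _)).trans ?_)
    rw [Finset.sum_const, smul_eq_mul]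
    exact Nat.mul_le_mul_right _ (card_neighborSet_le x)

lemma length_of_mem_bondLists {d : ℕ} {L : ℕ} {x : Site d} {b : List (Bond d)}
    (h : b ∈ bondLists L x) : b.length = L := by
  induction L generalizing x b with
  | zero => simp [bondLists] at h; simp [h]
  | succ L ih =>
    simp only [bondLists, Finset.mem_biUnion, Finset.mem_univ, true_and, Finset.mem_image] at h
    obtain ⟨z, c, hc, rfl⟩ := h
    simp [ih hc]

/-- The graph of the bonds of a set `U`. -/
def openGraph {d : ℕ} (U : Set (Bond d)) : SimpleGraph (Site d) where
  Adj y z := ∃ h : (lattice d).Adj y z, bond h ∈ U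
  symm := ⟨fun _ _ ⟨h, hU⟩ => ⟨h.symm, by rwa [bond_symm]⟩⟩
  loopless := ⟨fun _ ⟨h, _⟩ => h.ne rfl⟩

lemma exists_mem_bondLists {d : ℕ} {U : Set (Bond d)} {x y : Site d} (p : (openGraph U).Walk x y) :
    ∃ l ∈ bondLists p.length x, l.map Subtype.val = p.edges ∧ ∀ b ∈ l, b ∈ U := by
  induction p with
  | nil => exact ⟨[], by simp [bondLists]⟩
  | @cons u v w h p ih =>
    obtain ⟨l, hl, he, hU⟩ := ih
    obtain ⟨h', hb⟩ := id h
    refine ⟨bond h' :: l, ?_, ?_, ?_⟩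
    · simp only [SimpleGraph.Walk.length_cons, bondLists, Finset.mem_biUnion, Finset.mem_univ,
        true_and, Finset.mem_image]
      exact ⟨⟨v, h'⟩, l, hl, rfl⟩
    · simp [he, bond]
    · intro b hb'
      rcases List.mem_cons.1 hb' with rfl | hb'
      · exact hb
      · exact hU b hb'

lemma finite_setOf_walk {d : ℕ} {U : Set (Bond d)} (L : ℕ) (x : Site d) :
    {y | ∃ p : (openGraph U).Walk x y, p.length = L}.Finite := by
  induction L generalizing x with
  | zero =>
    refine (finite_singleton x).subset ?_
    rintro y ⟨p, hp⟩
    exact (SimpleGraph.Walk.eq_of_length_eq_zero hp).symm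
  | succ L ih =>
    refine ((finite_neighborSet x).biUnion fun z _ => ih z).subset ?_
    rintro y ⟨p, hp⟩
    cases p with
    | nil => simp at hp
    | @cons _ v _ h p =>
      exact mem_biUnion (x := v) h.1 ⟨p, by simpa using hp⟩

/-- An open path of length at least `L` has an initial segment of length exactly `L`, whose bonds
are distinct and open. So all reachable sites are within fewer than `L` open steps, and local
finiteness concludes. -/
lemma finite_reachable {d : ℕ} {U : Set (Bond d)} {L : ℕ} {x : Site d}
    (h : ∀ l ∈ bondLists L x, l.Nodup → ¬ ∀ b ∈ l, b ∈ U) :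
    {y | (openGraph U).Reachable x y}.Finite := by
  have hpath : ∀ y, ∀ p : (openGraph U).Walk x y, p.IsPath → p.length ≠ L := by
    rintro y p hp rfl
    obtain ⟨l, hl, he, hU⟩ := exists_mem_bondLists p
    exact h l hl (List.Nodup.of_map Subtype.val (he ▸ hp.isTrail.edges_nodup)) hU
  refine ((finite_Iio L).biUnion fun k _ => finite_setOf_walk (U := U) k x).subset ?_
  rintro y ⟨p⟩
  classical
  set q := p.toPath.1
  have hq : q.IsPath := p.toPath.2
  refine mem_biUnion (x := q.length) ?_ ⟨q, rfl⟩
  by_contra hL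
  simp only [mem_Iio, not_lt] at hL
  exact hpath _ (q.take L) (hq.take L) (by rw [SimpleGraph.Walk.take_length]; omega)

instance {d : ℕ} : Countable (Bond d) := by
  have : Countable (Sym2 (Site d)) := by unfold Sym2; infer_instance
  infer_instance

/-- In subcritical percolation, the open clusters are almost surely finite. -/
lemma ae_finite_cluster {d : ℕ} {Ω : Type*} [MeasurableSpace Ω] {P : Measure Ω}
    {O : Bond d → Set Ω} (hind : ∀ s : Finset (Bond d), P (⋂ b ∈ s, O b) = ∏ b ∈ s, P (O b))
    {q : ℝ≥0} (hq : ∀ b, P (O b) ≤ q) (hq2 : 3 ^ d * q ≤ 1 / 2) (x : Site d) :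
    ∀ᵐ ω ∂P, ∃ C : Set (Site d), C.Finite ∧ x ∈ C ∧
      ∀ y ∈ C, ∀ z, ∀ h : (lattice d).Adj y z, z ∉ C → ω ∉ O (bond h) := by
  classical
  have key : ∀ᵐ ω ∂P, ∃ L, ∀ l ∈ bondLists L x, l.Nodup → ¬ ∀ b ∈ l, ω ∈ O b := by
    rw [ae_iff]
    set B := {ω | ¬ ∃ L, ∀ l ∈ bondLists L x, l.Nodup → ¬ ∀ b ∈ l, ω ∈ O b}
    -- First-moment bound: at most (3^d)^L lists, and each list without repetition is open with
    -- probability at most q^L by independence of distinct bonds.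
    have hB : ∀ L : ℕ, P B ≤ (((1 / 2) ^ L : ℝ≥0) : ℝ≥0∞) := by
      intro L
      have hsub : B ⊆ ⋃ l ∈ (bondLists L x).filter List.Nodup, ⋂ b ∈ l.toFinset, O b := by
        intro ω hω
        simp only [B, mem_ofPred_eq] at hω
        push Not at hω
        obtain ⟨l, h1, h2, h3⟩ := hω L
        refine mem_biUnion (x := l) ?_ ?_
        · simp [h1, h2]
        · simpa using h3
      calc P B ≤ ∑ l ∈ (bondLists L x).filter List.Nodup, P (⋂ b ∈ l.toFinset, O b) :=
            (measure_mono hsub).trans (measure_biUnion_finset_le _ _)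
        _ ≤ ∑ l ∈ (bondLists L x).filter List.Nodup, ((q ^ L : ℝ≥0) : ℝ≥0∞) := by
            refine Finset.sum_le_sum fun l hl => ?_
            rw [Finset.mem_filter] at hl
            rw [hind]
            refine (Finset.prod_le_pow_card _ _ _ fun b _ => hq b).trans ?_
            rw [List.toFinset_card_of_nodup hl.2, length_of_mem_bondLists hl.1, ENNReal.coe_pow]
        _ ≤ (((1 / 2) ^ L : ℝ≥0) : ℝ≥0∞) := by
            rw [Finset.sum_const, nsmul_eq_mul]
            have hc : (((bondLists L x).filter List.Nodup).card : ℝ≥0) ≤ (3 ^ d) ^ L := by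
              exact_mod_cast (Finset.card_filter_le _ _).trans (card_bondLists_le L x)
            have : (((bondLists L x).filter List.Nodup).card : ℝ≥0) * q ^ L ≤ (1 / 2) ^ L :=
              (mul_le_mul_left hc _).trans (by
                rw [← mul_pow]; exact pow_le_pow_left₀ zero_le hq2 L)
            exact_mod_cast this
    have hlim : Tendsto (fun L : ℕ => (((1 / 2) ^ L : ℝ≥0) : ℝ≥0∞)) atTop (𝓝 0) := by
      rw [← ENNReal.coe_zero, ENNReal.tendsto_coe]
      exact tendsto_pow_atTop_nhds_zero_of_lt_one zero_le (by
        rw [← NNReal.coe_lt_coe]; norm_num)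
    exact le_antisymm (ge_of_tendsto' hlim hB) zero_le
  filter_upwards [key] with ω ⟨L, hL⟩
  refine ⟨{y | (openGraph {b | ω ∈ O b}).Reachable x y}, finite_reachable (L := L) hL,
    SimpleGraph.Reachable.refl x, fun y hy z h hz hO => hz ?_⟩
  have : (openGraph {b | ω ∈ O b}).Adj y z := ⟨h, hO⟩
  exact SimpleGraph.Reachable.trans hy this.reachable

/-! ### Almost every realization is good -/

lemma measurableSet_increment_ne_zero (u v : ℝ≥0) :
    MeasurableSet {f : ℝ≥0 → ℕ | f v - f u ≠ 0} := by
  have h : Measurable fun f : ℝ≥0 → ℕ => f v - f u := by fun_prop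
  exact h (measurableSet_singleton 0).compl

lemma IsPoissonFamily.ae_isGood {d : ℕ} {Ω : Type*} [MeasurableSpace Ω] {P : Measure Ω}
    {lam : Bond d → ℝ≥0 → ℝ≥0} {α : ℝ≥0} (hbound : ∀ b t, lam b t ≤ α)
    {N : Bond d → ℝ≥0 → Ω → ℕ} (hN : IsPoissonFamily P lam N) :
    ∀ᵐ ω ∂P, IsGood (realization N ω) := by
  have hpath := ae_all_iff.2 fun b => (hN.poisson b).path
  have hsimple := ae_all_iff.2 fun b => (hN.poisson b).ae_simple (hbound b)
  -- Two distinct bonds are independent, so both have an event in a cell of length δ with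
  -- probability at most α²δ²: again second order.
  have hdist : ∀ᵐ ω ∂P, ∀ b b' : Bond d, b ≠ b' → ∀ r, 0 < r →
      ¬ ∀ u v, u < r → r ≤ v → N b v ω - N b u ω ≠ 0 ∧ N b' v ω - N b' u ω ≠ 0 := by
    refine ae_all_iff.2 fun b => ae_all_iff.2 fun b' => ?_
    by_cases hbb : b = b'
    · exact ae_of_all _ fun ω h => absurd hbb h
    have := ae_forall_time_of_sq (P := P) (K := α ^ 2)
      (A := fun u v => {ω | N b v ω - N b u ω ≠ 0} ∩ {ω | N b' v ω - N b' u ω ≠ 0})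
      fun a δ => by
        have hm := measurableSet_increment_ne_zero a (a + δ)
        rw [show {ω | N b (a + δ) ω - N b a ω ≠ 0} ∩ {ω | N b' (a + δ) ω - N b' a ω ≠ 0} =
          (fun ω t => N b t ω) ⁻¹' {f | f (a + δ) - f a ≠ 0} ∩
          (fun ω t => N b' t ω) ⁻¹' {f | f (a + δ) - f a ≠ 0} from rfl,
          (hN.indep.indepFun hbb).measure_inter_preimage_eq_mul _ _ hm hm]
        refine (mul_le_mul' ((hN.poisson b).measure_sub_ne_zero_le (hbound b) le_self_add)
          ((hN.poisson b').measure_sub_ne_zero_le (hbound b') le_self_add)).trans ?_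
        rw [add_tsub_cancel_left, ← ENNReal.coe_mul, mul_mul_mul_comm, ← sq, ← sq]
    filter_upwards [this] with ω hω _
    exact hω
  -- A bond is open in a slab with probability at most αδ, and this choice gives 3^d αδ ≤ 1/2. The
  -- `α + 1` avoids dividing by zero when `α = 0`.
  set δ : ℝ≥0 := 1 / (2 * 3 ^ d * (α + 1))
  have hδ : 0 < δ := by positivity
  have hclusters : ∀ᵐ ω ∂P, ∀ (k : ℕ) (x : Site d), ∃ C : Set (Site d), C.Finite ∧ x ∈ C ∧
      ∀ y ∈ C, ∀ z, ∀ h : (lattice d).Adj y z, z ∉ C →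
        ω ∉ {ω | N (bond h) ((k + 1) * δ) ω - N (bond h) (k * δ) ω ≠ 0} := by
    refine ae_all_iff.2 fun k => ae_all_iff.2 fun x => ?_
    refine ae_finite_cluster
      (O := fun b => {ω | N b ((k + 1) * δ) ω - N b (k * δ) ω ≠ 0}) (q := α * δ) ?_ ?_ ?_ x
    · intro s
      exact hN.indep.measure_inter_preimage_eq_mul s
        (sets := fun _ => {f : ℝ≥0 → ℕ | f ((k + 1) * δ) - f (k * δ) ≠ 0})
        fun b _ => measurableSet_increment_ne_zero _ _
    · intro b
      refine ((hN.poisson b).measure_sub_ne_zero_le (hbound b) ?_).trans (le_of_eq ?_)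
      · rw [add_mul]; exact le_self_add
      · rw [add_mul, one_mul, add_tsub_cancel_left]
    · rw [← NNReal.coe_le_coe]
      simp only [δ]
      push_cast
      have : (0 : ℝ) ≤ α := α.2
      rw [← sub_nonneg]
      have : (1 : ℝ) / 2 - 3 ^ d * (α * (1 / (2 * 3 ^ d * (α + 1)))) = 1 / (2 * (α + 1)) := by
        field_simp; ring
      rw [this]; positivity
  filter_upwards [hpath, hsimple, hdist, hclusters] with ω h1 h2 h3 h4
  have hmono : ∀ b, Monotone (realization N ω b) := fun b => (h1 b).2.1
  refine ⟨hmono, fun b t => ?_, h2, fun b b' r hb hb' => ?_, δ, hδ, fun k x => ?_⟩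
  · have := (h1 b).2.2 t
    rw [ContinuousWithinAt, nhds_discrete, tendsto_pure] at this
    exact this.filter_mono (nhdsWithin_mono _ Ioi_subset_Ici_self)
  · by_contra hbb
    refine h3 b b' hbb r (pos_of_isEvent hb) fun u v hu hv => ?_
    have aux : ∀ c, IsEvent (realization N ω c) r → N c v ω - N c u ω ≠ 0 := by
      intro c hc h0
      have h5 : N c u ω ≤ N c v ω := hmono c (hu.le.trans hv)
      exact not_isEvent_of_eq (hmono c) (show N c u ω = N c v ω by omega) hu hv hc
    exact ⟨aux b hb, aux b' hb'⟩
  · obtain ⟨C, hC, hx, h⟩ := h4 k x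
    refine ⟨C, hC, hx, fun y hy z hz hzC => ?_⟩
    have := h y hy z hz hzC
    simp only [not_not] at this
    refine le_antisymm (hmono _ (mul_le_mul_left (by simp) _)) ?_
    simp only [realization]
    omega

end Stirring

namespace Stirring

/-! ### Discretization of the backward walk -/

section Discretization

variable {d : ℕ} {n : Bond d → ℝ≥0 → ℕ}

/-- One step, from time `b` back to time `a`, of the discretized backward walk. -/
def BackStep (n : Bond d → ℝ≥0 → ℕ) (a b : ℝ≥0) (z y : Site d) : Prop :=
  (y = z ∧ ∀ w, ∀ h : (lattice d).Adj z w, n (bond h) b - n (bond h) a = 0) ∨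
    ∃ h : (lattice d).Adj z y, n (bond h) b - n (bond h) a ≠ 0 ∧
      ∀ w, ∀ h' : (lattice d).Adj z w, w ≠ y → n (bond h') b - n (bond h') a = 0

lemma BackStep.unique {a b : ℝ≥0} {z y y' : Site d} (h : BackStep n a b z y)
    (h' : BackStep n a b z y') : y = y' := by
  rcases h with ⟨rfl, h⟩ | ⟨h, h1, h2⟩ <;> rcases h' with ⟨rfl, h'⟩ | ⟨h', h1', h2'⟩
  · rfl
  · exact absurd (h _ h') h1'
  · exact absurd (h' _ h) h1
  · by_contra hne
    exact h1 (h2' y h hne)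

/-- The discretized backward walk along the time grid `τ`, started from `x` at time `τ k`, is at `y`
at time `τ 0`. -/
def BackChain (n : Bond d → ℝ≥0 → ℕ) (τ : ℕ → ℝ≥0) : ℕ → Site d → Site d → Prop
  | 0, x, y => y = x
  | k + 1, x, y => ∃ w, BackStep n (τ k) (τ (k + 1)) x w ∧ BackChain n τ k w y

lemma BackChain.unique {τ : ℕ → ℝ≥0} {k : ℕ} {x y y' : Site d} (h : BackChain n τ k x y)
    (h' : BackChain n τ k x y') : y = y' := by
  induction k generalizing x with
  | zero => exact h.trans h'.symm
  | succ k ih =>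
    obtain ⟨w, h1, h2⟩ := h
    obtain ⟨w', h1', h2'⟩ := h'
    obtain rfl := h1.unique h1'
    exact ih h2 h2'

lemma backChain_of_forall {τ : ℕ → ℝ≥0} {γ : ℝ≥0 → Site d} {k : ℕ}
    (h : ∀ j < k, BackStep n (τ j) (τ (j + 1)) (γ (τ (j + 1))) (γ (τ j))) :
    BackChain n τ k (γ (τ k)) (γ (τ 0)) := by
  induction k with
  | zero => rfl
  | succ k ih => exact ⟨_, h k k.lt_succ_self, ih fun j hj => h j (hj.trans k.lt_succ_self)⟩

/-- The regular grid with `m + 1` cells of the time interval `[u, t]`. -/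
noncomputable def grid (u t : ℝ≥0) (m k : ℕ) : ℝ≥0 := u + k * ((t - u) / (m + 1))

lemma grid_zero (u t : ℝ≥0) (m : ℕ) : grid u t m 0 = u := by simp [grid]

lemma grid_last {u t : ℝ≥0} (h : u ≤ t) (m : ℕ) : grid u t m (m + 1) = t := by
  rw [grid]
  push_cast
  rw [mul_div_cancel₀ _ (by positivity), add_tsub_cancel_of_le h]

lemma grid_mono (u t : ℝ≥0) (m : ℕ) : Monotone (grid u t m) := fun j k h => by
  unfold grid
  gcongr

lemma grid_mem {u t : ℝ≥0} (h : u ≤ t) {m k : ℕ} (hk : k ≤ m + 1) :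
    grid u t m k ∈ Icc u t :=
  ⟨le_self_add, (grid_mono u t m hk).trans (grid_last h m).le⟩

lemma grid_succ (u t : ℝ≥0) (m k : ℕ) : grid u t m (k + 1) = grid u t m k + (t - u) / (m + 1) := by
  simp only [grid]; push_cast; ring

lemma IsGood.increment_ne_zero (hn : IsGood n) {b : Bond d} {u r v : ℝ≥0} (hv : n b v = n b r)
    (hu : n b u = Function.leftLim (n b) r) (he : IsEvent (n b) r) : n b v - n b u ≠ 0 := by
  have h1 := (isEvent_iff (hn.mono b) r).1 he
  have h2 := (hn.mono b).leftLim_le (le_refl r)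
  omega

lemma IsGood.increment_eq_zero (hn : IsGood n) {b : Bond d} {u r v : ℝ≥0} (hv : n b v = n b r)
    (hu : n b u = Function.leftLim (n b) r) (he : ¬ IsEvent (n b) r) : n b v - n b u = 0 := by
  have h1 := (isEvent_iff (hn.mono b) r).not.1 he
  simp only [not_not, ne_eq] at h1
  omega

/-- Near `r`, the bonds at the sites concerned can ring only at `r` itself. A small cell either
misses `r`, and nothing moves, or straddles it and sees exactly the crossing at `r`. Stating this on
a full neighbourhood of each `r` prepares a compactness argument. -/
lemma IsTraj.eventually_backStep (hn : IsGood n) {u t : ℝ≥0} {γ : ℝ≥0 → Site d}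
    (h : IsTraj n u t γ) {r : ℝ≥0} (hr : r ∈ Icc u t) :
    ∃ V ∈ 𝓝 r, ∀ a ∈ V, ∀ b ∈ V, u ≤ a → a ≤ b → b ≤ t → BackStep n a b (γ b) (γ a) := by
  have hright : ∀ᶠ v in 𝓝[≥] r, v ≤ t → γ v = γ r ∧
      ∀ w, ∀ hw : (lattice d).Adj (γ r) w, n (bond hw) v = n (bond hw) r := by
    rw [← Ioi_insert, nhdsWithin_insert, eventually_sup, eventually_pure]
    refine ⟨fun _ => ⟨rfl, fun _ _ => rfl⟩, ?_⟩
    rcases hr.2.eq_or_lt with h' | h'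
    · filter_upwards [self_mem_nhdsWithin] with v (hv : r < v) hvt
      exact absurd (h' ▸ hvt) (not_le.2 hv)
    · filter_upwards [h.right r hr.1 h', eventually_forall_adj (y := γ r)
        (p := fun w hw v => n (bond hw) v = n (bond hw) r) fun w hw => hn.right _ _] with v h1 h2 _
      exact ⟨h1, h2⟩
  rcases hr.1.eq_or_lt with h' | h'
  · refine ⟨{v | r ≤ v → v ≤ t → γ v = γ r ∧ ∀ w, ∀ hw : (lattice d).Adj (γ r) w,
      n (bond hw) v = n (bond hw) r}, eventually_nhdsWithin_iff.1 hright, ?_⟩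
    intro a ha b hb hua hab hbt
    obtain ⟨ea, na⟩ := ha (h' ▸ hua) (hab.trans hbt)
    obtain ⟨eb, nb⟩ := hb (h' ▸ hua.trans hab) hbt
    rw [ea, eb]
    exact Or.inl ⟨rfl, fun w hw => by rw [na, nb, Nat.sub_self]⟩
  · obtain ⟨y, hy, hc⟩ := h.left r h' hr.2
    -- The bonds at `y` handle cells lying before `r`; those at `γ r` handle cells straddling `r`,
    -- since a backward step inspects the bonds at its later position.
    have hleft : ∀ᶠ v in 𝓝[<] r, γ v = y ∧
        (∀ w, ∀ hw : (lattice d).Adj y w, n (bond hw) v = Function.leftLim (n (bond hw)) r) ∧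
        (∀ w, ∀ hw : (lattice d).Adj (γ r) w,
          n (bond hw) v = Function.leftLim (n (bond hw)) r) :=
      hy.and ((eventually_forall_adj
        (p := fun w hw v => n (bond hw) v = Function.leftLim (n (bond hw)) r)
        fun w hw => eventually_left_eq_leftLim (hn.mono _) r).and (eventually_forall_adj
        (p := fun w hw v => n (bond hw) v = Function.leftLim (n (bond hw)) r)
        fun w hw => eventually_left_eq_leftLim (hn.mono _) r))
    refine ⟨_, (eventually_nhdsWithin_iff.1 hright).and (eventually_nhdsWithin_iff.1 hleft), ?_⟩
    rintro a ⟨ha1, ha2⟩ b ⟨hb1, hb2⟩ hua hab hbt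
    rcases lt_or_ge b r with hbr | hbr
    · obtain ⟨ea, na, -⟩ := ha2 (hab.trans_lt hbr)
      obtain ⟨eb, nb, -⟩ := hb2 hbr
      rw [ea, eb]
      exact Or.inl ⟨rfl, fun w hw => by rw [na, nb, Nat.sub_self]⟩
    · obtain ⟨eb, nb⟩ := hb1 hbr hbt
      rcases le_or_gt r a with har | har
      · obtain ⟨ea, na⟩ := ha1 har (hab.trans hbt)
        rw [ea, eb]
        exact Or.inl ⟨rfl, fun w hw => by rw [na, nb, Nat.sub_self]⟩
      · obtain ⟨ea, -, na⟩ := ha2 har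
        rw [ea, eb]
        rcases hc.symm with ⟨e, hne⟩ | ⟨hadj, he⟩
        · exact Or.inl ⟨e, fun w hw => hn.increment_eq_zero (nb w hw) (na w hw) (hne w hw)⟩
        · refine Or.inr ⟨hadj, hn.increment_ne_zero (nb _ _) (na _ _) he, fun w hw hwy => ?_⟩
          refine hn.increment_eq_zero (nb w hw) (na w hw) fun he' => hwy ?_
          exact eq_of_bond_eq (hn.distinct _ _ r he' he)

/-- Once the mesh is below a Lebesgue number of the cover of `[u, t]` by the neighbourhoods of
`IsTraj.eventually_backStep`, every cell lies in one of them. -/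
lemma eventually_backChain (hn : IsGood n) {u t : ℝ≥0} (hut : u ≤ t) (x : Site d) :
    ∀ᶠ m : ℕ in atTop, BackChain n (grid u t m) (m + 1) x (backwardWalk n u t x) := by
  set γ : ℝ≥0 → Site d := fun v => backwardWalk n v t x with hγ
  have htraj : IsTraj n u t γ := (isTraj_backwardWalk hn t x).mono zero_le le_rfl
  have hloc : ∀ r, ∃ V, r ∈ Icc u t → V ∈ 𝓝 r ∧
      ∀ a ∈ V, ∀ b ∈ V, u ≤ a → a ≤ b → b ≤ t → BackStep n a b (γ b) (γ a) := fun r => by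
    by_cases hr : r ∈ Icc u t
    · obtain ⟨V, h1, h2⟩ := htraj.eventually_backStep hn hr
      exact ⟨V, fun _ => ⟨h1, h2⟩⟩
    · exact ⟨∅, fun h => absurd h hr⟩
  choose V hV using hloc
  obtain ⟨W, hW, hWV⟩ := lebesgue_number_lemma_nhdsWithin' (K := Icc u t) (U := fun r _ => V r)
    isCompact_Icc fun r hr => mem_nhdsWithin_of_mem_nhds (hV r hr).1
  obtain ⟨ε, hε, hεW⟩ := Metric.mem_uniformity_dist.1 hW
  have hlim : Tendsto (fun m : ℕ => ((t - u : ℝ≥0) : ℝ) / ((m : ℝ) + 1)) atTop (𝓝 0) := by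
    simpa [div_eq_mul_inv] using
      (tendsto_one_div_add_atTop_nhds_zero_nat (𝕜 := ℝ)).const_mul ((t - u : ℝ≥0) : ℝ)
  filter_upwards [hlim.eventually_lt_const hε] with m hm
  have := backChain_of_forall (n := n) (τ := grid u t m) (γ := γ) (k := m + 1) fun j hj => by
    have h1 := grid_mem hut (m := m) hj.le
    have h2 := grid_mem hut (m := m) (k := j + 1) hj
    have h3 := grid_mono u t m j.le_succ
    obtain ⟨r, hr⟩ := hWV _ h1
    refine (hV r r.2).2 _ (hr ⟨?_, h1⟩) _ (hr ⟨?_, h2⟩) h1.1 h3 h2.2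
    · exact hεW (by simpa using hε)
    · refine hεW ?_
      rw [dist_comm, NNReal.dist_eq, grid_succ]
      push_cast
      rw [add_sub_cancel_left, abs_of_nonneg (by positivity)]
      exact hm
  rw [grid_zero, grid_last hut] at this
  simpa [hγ, backwardWalk_self hn] using this

/-- This expresses a walk defined by choice through countably many increments over `[u, t]`, which
is what gives measurability and independence. The converse uses that a discretized walk has at most
one value. -/
lemma backwardWalk_eq_iff_eventually (hn : IsGood n) {u t : ℝ≥0} (hut : u ≤ t) (x y : Site d) :
    backwardWalk n u t x = y ↔
      ∀ᶠ m : ℕ in atTop, BackChain n (grid u t m) (m + 1) x y := by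
  constructor
  · rintro rfl
    exact eventually_backChain hn hut x
  · intro h
    obtain ⟨m, h1, h2⟩ := (h.and (eventually_backChain hn hut x)).exists
    exact h2.unique h1

end Discretization

/-- The event that the discretized backward walks from time `t` back to time `u`, started from `x`,
are eventually at `y`. -/
def chainEvent {d : ℕ} {Ω : Type*} (N : Bond d → ℝ≥0 → Ω → ℕ) (u t : ℝ≥0) (x y : Site d) : Set Ω :=
  {ω | ∀ᶠ m : ℕ in atTop, BackChain (realization N ω) (grid u t m) (m + 1) x y}

lemma measurableSet_backStep {d : ℕ} {Ω : Type*} {m₀ : MeasurableSpace Ω}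
    {N : Bond d → ℝ≥0 → Ω → ℕ} {a b : ℝ≥0} (h : ∀ c, Measurable fun ω => N c b ω - N c a ω)
    (z y : Site d) : MeasurableSet {ω | BackStep (realization N ω) a b z y} := by
  have h0 : ∀ c, MeasurableSet {ω | N c b ω - N c a ω = 0} := fun c =>
    h c (measurableSet_singleton 0)
  have hall : ∀ p : (lattice d).neighborSet z → Prop,
      MeasurableSet {ω | ∀ w, p w → N (bond w.2) b ω - N (bond w.2) a ω = 0} := fun p => by
    rw [show {ω | ∀ w, p w → N (bond w.2) b ω - N (bond w.2) a ω = 0} =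
      ⋂ w, {ω | p w → N (bond w.2) b ω - N (bond w.2) a ω = 0} by ext; simp]
    refine MeasurableSet.iInter fun w => ?_
    by_cases hp : p w
    · simpa [hp] using h0 _
    · simp [hp]
  have e : {ω | BackStep (realization N ω) a b z y} =
      ({ω | y = z ∧ ∀ w : (lattice d).neighborSet z, True →
        N (bond w.2) b ω - N (bond w.2) a ω = 0}) ∪
      {ω | ∃ h : (lattice d).Adj z y, N (bond h) b ω - N (bond h) a ω ≠ 0 ∧
        ∀ w : (lattice d).neighborSet z, w.1 ≠ y →
          N (bond w.2) b ω - N (bond w.2) a ω = 0} := by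
    ext ω
    refine or_congr (and_congr Iff.rfl ?_) (exists_congr fun h => and_congr Iff.rfl ?_)
    · exact ⟨fun H w _ => H w.1 w.2, fun H w hw => H ⟨w, hw⟩ trivial⟩
    · exact ⟨fun H w hw => H w.1 w.2 hw, fun H w hw hwy => H ⟨w, hw⟩ hwy⟩
  rw [e]
  refine MeasurableSet.union ?_ ?_
  · exact (MeasurableSet.const _).inter (hall _)
  · by_cases hadj : (lattice d).Adj z y
    · simp only [hadj, exists_true_left]
      exact (h0 _).compl.inter (hall fun w => w.1 ≠ y)
    · simp [hadj]

/-- The σ-algebra is left free and only increments inside `[u, t]` are assumed measurable, so that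
it can be taken to be that of the past or of the future of a given time. -/
lemma measurableSet_chainEvent {d : ℕ} {Ω : Type*} {m₀ : MeasurableSpace Ω}
    {N : Bond d → ℝ≥0 → Ω → ℕ} {u t : ℝ≥0} (hut : u ≤ t)
    (h : ∀ c a b, u ≤ a → a ≤ b → b ≤ t → Measurable fun ω => N c b ω - N c a ω)
    (x y : Site d) : MeasurableSet (chainEvent N u t x y) := by
  have key : ∀ m k, k ≤ m + 1 → ∀ x,
      MeasurableSet {ω | BackChain (realization N ω) (grid u t m) k x y} := by
    intro m k
    induction k with
    | zero => intro _ x; exact MeasurableSet.const _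
    | succ k ih =>
      intro hk x
      have e : {ω | BackChain (realization N ω) (grid u t m) (k + 1) x y} =
          ⋃ w, {ω | BackStep (realization N ω) (grid u t m k) (grid u t m (k + 1)) x w} ∩
            {ω | BackChain (realization N ω) (grid u t m) k w y} := by
        ext ω; simp [BackChain]
      rw [e]
      exact MeasurableSet.iUnion fun w => (measurableSet_backStep (fun c => h c _ _
        (grid_mem hut (by omega)).1 (grid_mono u t m k.le_succ) (grid_mem hut hk).2) x w).inter
        (ih (by omega) w)
  have e : chainEvent N u t x y = ⋃ M : ℕ, ⋂ m : ℕ, ⋂ _ : M ≤ m,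
      {ω | BackChain (realization N ω) (grid u t m) (m + 1) x y} := by
    ext ω; simp [chainEvent, eventually_atTop]
  rw [e]
  exact MeasurableSet.iUnion fun M => MeasurableSet.iInter fun m => MeasurableSet.iInter fun _ =>
    key m (m + 1) le_rfl x

/-! ### Independence of past and future -/

lemma exists_monotone_enum {α : Type*} [LinearOrder α] (F : Finset α) (hF : F.Nonempty) :
    ∃ t : ℕ → α, Monotone t ∧ ∀ v ∈ F, ∃ k, t k = v := by
  have hc : 0 < F.card := hF.card_pos
  refine ⟨fun k => F.orderEmbOfFin rfl ⟨min k (F.card - 1), by omega⟩, fun i j h => ?_,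
    fun v hv => ?_⟩
  · exact (F.orderEmbOfFin rfl).monotone (by simp only [Fin.mk_le_mk]; omega)
  · have : v ∈ Set.range (F.orderEmbOfFin rfl) := by simpa using hv
    obtain ⟨k, rfl⟩ := this
    exact ⟨k, congrArg _ (Fin.ext (by simp only; omega))⟩

lemma iIndepFun_bool {Ω : Type*} {β : Bool → Type*} [MeasurableSpace Ω]
    [∀ i, MeasurableSpace (β i)] {P : Measure Ω} [IsProbabilityMeasure P] {f : ∀ i, Ω → β i}
    (h : IndepFun (f false) (f true) P) : iIndepFun f P := by
  rw [iIndepFun_iff_measure_inter_preimage_eq_mul]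
  intro S sets hS
  obtain rfl | rfl | rfl | rfl : S = ∅ ∨ S = {false} ∨ S = {true} ∨ S = {false, true} := by
    clear hS; revert S; decide
  · simp
  · simp
  · simp
  · rw [Finset.prod_pair (by decide), Finset.set_biInter_insert, Finset.set_biInter_singleton]
    exact h.measure_inter_preimage_eq_mul _ _ (hS false (by simp)) (hS true (by simp))

section Independence

variable {Ω : Type*} [MeasurableSpace Ω] {P : Measure Ω}

lemma sum_Ico_increments {f : ℕ → ℕ} (hf : Monotone f) (j k : ℕ) :
    ∑ i ∈ Finset.Ico j k, (f (i + 1) - f i) = f k - f j := by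
  rcases le_total j k with h | h
  · induction k, h using Nat.le_induction with
    | base => simp
    | succ k hk ih =>
      rw [Finset.sum_Ico_succ_top hk, ih]
      have := hf hk
      have := hf k.le_succ
      simp only [Nat.succ_eq_add_one] at this
      omega
  · rw [Finset.Ico_eq_empty_of_le h, Finset.sum_empty, Nat.sub_eq_zero_of_le (hf h)]

/-- It suffices to treat finitely many increments. Their endpoints and `s` are listed in one
monotone sequence `t` with `t K = s`: past increments are sums of steps of index below `K`, future
ones of steps of index at least `K`, and these are disjoint blocks of independent variables.
Clamping with `min` and `max` lets both processes be indexed by all pairs of times. -/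
lemma IsPoissonProcess.indepFun_past_future {l : ℝ≥0 → ℝ≥0} {N : ℝ≥0 → Ω → ℕ}
    [IsProbabilityMeasure P] (hN : IsPoissonProcess P l N) (s : ℝ≥0) :
    IndepFun (fun ω (p : ℝ≥0 × ℝ≥0) => N (min p.2 s) ω - N (min p.1 s) ω)
      (fun ω (p : ℝ≥0 × ℝ≥0) => N (max p.2 s) ω - N (max p.1 s) ω) P := by
  classical
  refine IndepFun.process_indepFun_process
    (X := fun (p : ℝ≥0 × ℝ≥0) ω => N (min p.2 s) ω - N (min p.1 s) ω)
    (Y := fun (p : ℝ≥0 × ℝ≥0) ω => N (max p.2 s) ω - N (max p.1 s) ω)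
    (fun p => hN.measurable_sub _ _) (fun p => hN.measurable_sub _ _) fun I J => ?_
  set F : Finset ℝ≥0 := insert s ((I.image fun p => min p.1 s) ∪ (I.image fun p => min p.2 s) ∪
    (J.image fun p => max p.1 s) ∪ (J.image fun p => max p.2 s))
  obtain ⟨t, ht, hF⟩ := exists_monotone_enum F ⟨s, Finset.mem_insert_self _ _⟩
  obtain ⟨K, hK⟩ := hF s (Finset.mem_insert_self _ _)
  have hpast : ∀ v ∈ F, v ≤ s → ∃ k ≤ K, t k = v := by
    intro v hv hvs
    obtain ⟨k, hk⟩ := hF v hv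
    rcases le_total k K with h | h
    · exact ⟨k, h, hk⟩
    · exact ⟨K, le_rfl, le_antisymm ((ht h).trans hk.le) (hK ▸ hvs)⟩
  have hfut : ∀ v ∈ F, s ≤ v → ∃ k ≥ K, t k = v := by
    intro v hv hvs
    obtain ⟨k, hk⟩ := hF v hv
    rcases le_total K k with h | h
    · exact ⟨k, h, hk⟩
    · exact ⟨K, le_rfl, le_antisymm (hK ▸ hvs) (hk ▸ ht h)⟩
  have h1 : ∀ p : I, ∃ j k, j ≤ K ∧ k ≤ K ∧ t j = min p.1.1 s ∧ t k = min p.1.2 s := by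
    intro p
    obtain ⟨j, hj, ej⟩ := hpast (min p.1.1 s) (by
      simp only [F, Finset.mem_insert, Finset.mem_union, Finset.mem_image]
      exact Or.inr (Or.inl (Or.inl (Or.inl ⟨p.1, p.2, rfl⟩)))) (min_le_right _ _)
    obtain ⟨k, hk, ek⟩ := hpast (min p.1.2 s) (by
      simp only [F, Finset.mem_insert, Finset.mem_union, Finset.mem_image]
      exact Or.inr (Or.inl (Or.inl (Or.inr ⟨p.1, p.2, rfl⟩)))) (min_le_right _ _)
    exact ⟨j, k, hj, hk, ej, ek⟩
  have h2 : ∀ p : J, ∃ j k, K ≤ j ∧ K ≤ k ∧ t j = max p.1.1 s ∧ t k = max p.1.2 s := by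
    intro p
    obtain ⟨j, hj, ej⟩ := hfut (max p.1.1 s) (by
      simp only [F, Finset.mem_insert, Finset.mem_union, Finset.mem_image]
      exact Or.inr (Or.inl (Or.inr ⟨p.1, p.2, rfl⟩))) (le_max_right _ _)
    obtain ⟨k, hk, ek⟩ := hfut (max p.1.2 s) (by
      simp only [F, Finset.mem_insert, Finset.mem_union, Finset.mem_image]
      exact Or.inr (Or.inr ⟨p.1, p.2, rfl⟩)) (le_max_right _ _)
    exact ⟨j, k, hj, hk, ej, ek⟩
  choose j k hj hk ej ek using h1
  choose j' k' hj' hk' ej' ek' using h2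
  set M : ℕ := Finset.univ.sup k'
  have hind := (hN.indep.nat ht).indepFun_finset (Finset.range K) (Finset.Ico K M)
    (Finset.disjoint_left.2 fun i h1 h2 => by simp at h1 h2; omega)
    (fun i => hN.measurable_sub _ _)
  have hcomp := hind.comp (φ := fun (x : Finset.range K → ℕ) (p : I) =>
      ∑ i, if j p ≤ i.1 ∧ i.1 < k p then x i else 0)
    (ψ := fun (x : Finset.Ico K M → ℕ) (p : J) =>
      ∑ i, if j' p ≤ i.1 ∧ i.1 < k' p then x i else 0)
    (measurable_pi_lambda _ fun p => Finset.measurable_sum _ fun i _ => by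
      split_ifs
      · exact measurable_pi_apply _
      · exact measurable_const)
    (measurable_pi_lambda _ fun p => Finset.measurable_sum _ fun i _ => by
      split_ifs
      · exact measurable_pi_apply _
      · exact measurable_const)
  have hsum : ∀ (S : Finset ℕ) (a b : ℕ) (g : ℕ → ℕ), Finset.Ico a b ⊆ S →
      ∑ i : S, (if a ≤ i.1 ∧ i.1 < b then g i.1 else 0) = ∑ i ∈ Finset.Ico a b, g i := by
    intro S a b g hS
    rw [Finset.sum_coe_sort S (fun i => if a ≤ i ∧ i < b then g i else 0), ← Finset.sum_filter]
    refine Finset.sum_congr ?_ fun _ _ => rfl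
    ext i
    simp only [Finset.mem_filter, Finset.mem_Ico]
    exact ⟨fun h => h.2, fun h => ⟨hS (Finset.mem_Ico.2 h), h⟩⟩
  refine hcomp.congr ?_ ?_
  · filter_upwards [hN.path] with ω hω
    ext p
    simp only [Function.comp_apply]
    rw [hsum _ _ _ (fun i => N (t (i + 1)) ω - N (t i) ω) (fun i hi => by
      have := hk p; simp at hi ⊢; omega), sum_Ico_increments (f := fun i => N (t i) ω) (hω.2.1.comp ht), ej, ek]
  · filter_upwards [hN.path] with ω hω
    ext p
    simp only [Function.comp_apply]
    have hM : k' p ≤ M := Finset.le_sup (f := k') (Finset.mem_univ p)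
    rw [hsum _ _ _ (fun i => N (t (i + 1)) ω - N (t i) ω) (fun i hi => by
      have := hj' p; simp at hi ⊢; omega), sum_Ico_increments (f := fun i => N (t i) ω) (hω.2.1.comp ht), ej', ek']

/-- The increments of a Poisson family before time `s` are independent of those after time `s`. -/
lemma IsPoissonFamily.indep_past_future {d : ℕ} {lam : Bond d → ℝ≥0 → ℝ≥0}
    {N : Bond d → ℝ≥0 → Ω → ℕ} [IsProbabilityMeasure P] (hN : IsPoissonFamily P lam N) (s : ℝ≥0) :
    ∃ m₁ m₂ : MeasurableSpace Ω, Indep m₁ m₂ P ∧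
      (∀ b u v, u ≤ s → v ≤ s → Measurable[m₁] fun ω => N b v ω - N b u ω) ∧
      (∀ b u v, s ≤ u → s ≤ v → Measurable[m₂] fun ω => N b v ω - N b u ω) := by
  -- Past and future of each bond form a family indexed by bond and Boolean. Joint independence of
  -- that family allows regrouping by the Boolean alone.
  set Z : Bond d → Bool → Ω → (ℝ≥0 × ℝ≥0 → ℕ) := fun b i ω p =>
    if i then N b (max p.2 s) ω - N b (max p.1 s) ω
    else N b (min p.2 s) ω - N b (min p.1 s) ω with hZ
  have mZ : ∀ b i, Measurable (Z b i) := fun b i => measurable_pi_lambda _ fun p => by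
    cases i
    · exact (hN.poisson b).measurable_sub _ _
    · exact (hN.poisson b).measurable_sub _ _
  have hind : iIndepFun (fun (q : Bond d × Bool) ω => Z q.1 q.2 ω) P := by
    refine iIndepFun_uncurry' mZ ?_ fun b => ?_
    · refine hN.indep.comp (fun b (f : ℝ≥0 → ℕ) (i : Bool) (p : ℝ≥0 × ℝ≥0) =>
        if i then f (max p.2 s) - f (max p.1 s) else f (min p.2 s) - f (min p.1 s)) fun b => ?_
      refine measurable_pi_lambda _ fun i => measurable_pi_lambda _ fun p => ?_
      cases i
      · simp only [Bool.false_eq_true, if_false]; fun_prop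
      · simp only [if_true]; fun_prop
    · refine iIndepFun_bool ?_
      simpa [hZ] using (hN.poisson b).indepFun_past_future s
  have hdisj : Disjoint {q : Bond d × Bool | q.2 = false} {q | q.2 = true} := by
    rw [Set.disjoint_left]
    rintro q h1 h2
    simp only [mem_ofPred_eq] at h1 h2
    simp [h1] at h2
  refine ⟨_, _, indep_iSup_of_disjoint (fun q => (mZ q.1 q.2).comap_le) hind.iIndep hdisj, ?_, ?_⟩
  · intro b u v hu hv
    have h1 : Measurable[MeasurableSpace.comap (Z b false) MeasurableSpace.pi]
        ((fun f : ℝ≥0 × ℝ≥0 → ℕ => f (u, v)) ∘ Z b false) :=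
      (measurable_pi_apply (u, v)).comp (comap_measurable (Z b false))
    have h2 : (fun f : ℝ≥0 × ℝ≥0 → ℕ => f (u, v)) ∘ Z b false = fun ω => N b v ω - N b u ω := by
      ext ω; simp [hZ, hu, hv]
    rw [← h2]
    exact h1.mono (le_iSup₂ (f := fun (q : Bond d × Bool) (_ : q ∈ {q : Bond d × Bool | q.2 = false})
      => MeasurableSpace.comap (fun ω => Z q.1 q.2 ω) inferInstance) (b, false) rfl) le_rfl
  · intro b u v hu hv
    have h1 : Measurable[MeasurableSpace.comap (Z b true) MeasurableSpace.pi]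
        ((fun f : ℝ≥0 × ℝ≥0 → ℕ => f (u, v)) ∘ Z b true) :=
      (measurable_pi_apply (u, v)).comp (comap_measurable (Z b true))
    have h2 : (fun f : ℝ≥0 × ℝ≥0 → ℕ => f (u, v)) ∘ Z b true = fun ω => N b v ω - N b u ω := by
      ext ω; simp [hZ, hu, hv]
    rw [← h2]
    exact h1.mono (le_iSup₂ (f := fun (q : Bond d × Bool) (_ : q ∈ {q : Bond d × Bool | q.2 = true})
      => MeasurableSpace.comap (fun ω => Z q.1 q.2 ω) inferInstance) (b, true) rfl) le_rfl

end Independence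

end Stirring

namespace Stirring

/-! ### Measurability of right-continuous functions and of left limits -/

/-- The points (⌊r(m+1)⌋ + 1)/(m+1) approach `r` strictly from the right and take countably many
values, so `f` is a pointwise limit of measurable step functions. -/
lemma measurable_of_rightContinuous {f : ℝ≥0 → ℝ} (hf : ∀ r, Tendsto f (𝓝[>] r) (𝓝 (f r))) :
    Measurable f := by
  refine measurable_of_tendsto_metrizable (g := f)
    (f := fun (m : ℕ) (r : ℝ≥0) => f ((⌊r * (m + 1)⌋₊ + 1) / (m + 1))) (fun m => ?_) ?_
  · have h1 : Measurable fun r : ℝ≥0 => ⌊r * (m + 1)⌋₊ :=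
      Nat.measurable_floor.comp (measurable_id.mul_const _)
    exact (measurable_from_nat (f := fun k : ℕ => f ((k + 1) / (m + 1)))).comp h1
  · rw [tendsto_pi_nhds]
    intro r
    refine (hf r).comp (tendsto_nhdsWithin_iff.2 ⟨?_, Eventually.of_forall fun m => ?_⟩)
    · have hlim : Tendsto (fun m : ℕ => r + 1 / ((m : ℝ≥0) + 1)) atTop (𝓝 (r + 0)) :=
        tendsto_const_nhds.add tendsto_one_div_add_atTop_nhds_zero_nat
      rw [add_zero] at hlim
      refine tendsto_of_tendsto_of_tendsto_of_le_of_le tendsto_const_nhds hlim (fun m => ?_)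
        fun m => ?_
      · rw [le_div_iff₀ (by positivity)]
        exact (Nat.lt_floor_add_one _).le
      · rw [div_le_iff₀ (by positivity), add_mul, one_div, inv_mul_cancel₀ (by positivity)]
        exact add_le_add_left (Nat.floor_le zero_le) 1
    · rw [mem_Ioi, lt_div_iff₀ (by positivity)]
      exact Nat.lt_floor_add_one _

/-- Here the points (⌈r(m+1)⌉ - 1)/(m+1) approach `r` strictly from the left. At zero the truncated
subtraction gives 0, in accordance with the default value of `leftLim`. -/
lemma measurable_leftLim {f : ℝ≥0 → ℝ} (hf : ∀ r, ∃ c, Tendsto f (𝓝[<] r) (𝓝 c)) :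
    Measurable (Function.leftLim f) := by
  refine measurable_of_tendsto_metrizable (g := Function.leftLim f)
    (f := fun (m : ℕ) (r : ℝ≥0) => f (((⌈r * (m + 1)⌉₊ - 1 : ℕ) : ℝ≥0) / (m + 1))) (fun m => ?_) ?_
  · have h1 : Measurable fun r : ℝ≥0 => ⌈r * (m + 1)⌉₊ :=
      Nat.measurable_ceil.comp (measurable_id.mul_const _)
    exact (measurable_from_nat (f := fun k : ℕ => f (((k - 1 : ℕ) : ℝ≥0) / (m + 1)))).comp h1
  · rw [tendsto_pi_nhds]
    intro r
    rcases eq_zero_or_pos (a := r) with rfl | hr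
    · rw [leftLim_eq_of_isBot (a := (0 : ℝ≥0)) isBot_bot]
      simp
    have hc : ∀ m : ℕ, 0 < ⌈r * (m + 1)⌉₊ := fun m => Nat.ceil_pos.2 (by positivity)
    refine (tendsto_leftLim_of_tendsto (hf r)).comp
      (tendsto_nhdsWithin_iff.2 ⟨?_, Eventually.of_forall fun m => ?_⟩)
    · have hlim : Tendsto (fun m : ℕ => r - 1 / ((m : ℝ≥0) + 1)) atTop (𝓝 (r - 0)) :=
        tendsto_const_nhds.sub tendsto_one_div_add_atTop_nhds_zero_nat
      rw [tsub_zero] at hlim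
      refine tendsto_of_tendsto_of_tendsto_of_le_of_le hlim tendsto_const_nhds (fun m => ?_)
        fun m => ?_
      · rw [tsub_le_iff_right, ← add_div, le_div_iff₀ (by positivity)]
        refine (Nat.le_ceil _).trans ?_
        have := hc m
        exact_mod_cast (by omega : ⌈r * (m + 1)⌉₊ ≤ (⌈r * (m + 1)⌉₊ - 1) + 1)
      · rw [div_le_iff₀ (by positivity)]
        exact (Nat.lt_ceil.1 (by have := hc m; omega)).le
    · rw [mem_Iio, div_lt_iff₀ (by positivity)]
      exact Nat.lt_ceil.1 (by have := hc m; omega)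

/-! ### Riemann sums -/

lemma grid_ceil {r : ℝ≥0} (hr : 0 < r) {m k : ℕ} {u : ℝ≥0}
    (hu : u ∈ Ioc (grid 0 r m k) (grid 0 r m (k + 1))) : ⌈u / (r / (m + 1))⌉₊ = k + 1 := by
  have hpos : 0 < r / ((m : ℝ≥0) + 1) := by positivity
  simp only [grid, tsub_zero, zero_add] at hu
  rw [Nat.ceil_eq_iff (by simp)]
  refine ⟨?_, ?_⟩
  · rw [lt_div_iff₀ hpos]; simpa using hu.1
  · rw [div_le_iff₀ hpos]; exact hu.2

/-- The sum is the integral of `H ∘ c m`, where `c m u` is the right end of the cell containing `u`.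
These tags tend to `u` from the right, so right-continuity and dominated convergence suffice, even
if `μ` has atoms. -/
lemma tendsto_riemann_sum {μ : Measure ℝ≥0} {r : ℝ≥0} (hμ : μ (Ioc 0 r) ≠ ∞) {H : ℝ≥0 → ℝ} {C : ℝ}
    (hC : ∀ u ≤ r, |H u| ≤ C) (hH : ∀ u, u < r → ContinuousWithinAt H (Ici u) u) :
    Tendsto (fun m : ℕ => ∑ k ∈ Finset.range (m + 1), H (grid 0 r m (k + 1)) *
      μ.real (Ioc (grid 0 r m k) (grid 0 r m (k + 1)))) atTop (𝓝 (∫ u in Ioc 0 r, H u ∂μ)) := by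
  rcases eq_zero_or_pos (a := r) with rfl | hr
  · simp [grid]
  have hfin : IsFiniteMeasure (μ.restrict (Ioc 0 r)) := ⟨by
    rw [Measure.restrict_apply_univ]; exact hμ.lt_top⟩
  set c : ℕ → ℝ≥0 → ℝ≥0 := fun m u => grid 0 r m ⌈u / (r / (m + 1))⌉₊ with hc
  have hcmeas : ∀ m, Measurable fun u => H (c m u) := fun m => by
    have h1 : Measurable fun u : ℝ≥0 => ⌈u / (r / (m + 1))⌉₊ :=
      Nat.measurable_ceil.comp (measurable_id.div_const _)
    exact (measurable_from_nat (f := fun k : ℕ => H (grid 0 r m k))).comp h1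
  have hle : ∀ m u, u ≤ c m u := fun m u => by
    have hpos : 0 < r / ((m : ℝ≥0) + 1) := by positivity
    simp only [hc, grid, tsub_zero, zero_add]
    rw [← div_le_iff₀ hpos]
    exact Nat.le_ceil _
  have hler : ∀ m, ∀ u ≤ r, c m u ≤ r := fun m u hu => by
    have hpos : 0 < r / ((m : ℝ≥0) + 1) := by positivity
    refine (grid_mem zero_le ?_).2
    rw [Nat.ceil_le, div_le_iff₀ hpos]
    push_cast
    rw [mul_div_cancel₀ _ (by positivity)]
    exact hu
  have hclose : ∀ m u, c m u ≤ u + r * (1 / (m + 1)) := fun m u => by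
    have hpos : 0 < r / ((m : ℝ≥0) + 1) := by positivity
    have h1 : (⌈u / (r / ((m : ℝ≥0) + 1))⌉₊ : ℝ≥0) ≤ u / (r / (m + 1)) + 1 :=
      (Nat.ceil_lt_add_one zero_le).le
    simp only [hc, grid, tsub_zero, zero_add]
    refine (mul_le_mul_left h1 _).trans (le_of_eq ?_)
    rw [add_mul, div_mul_cancel₀ _ hpos.ne', one_mul, mul_one_div]
  have hsum : ∀ m : ℕ, ∫ u in Ioc 0 r, H (c m u) ∂μ = ∑ k ∈ Finset.range (m + 1),
      H (grid 0 r m (k + 1)) * μ.real (Ioc (grid 0 r m k) (grid 0 r m (k + 1))) := by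
    intro m
    have hU : Ioc 0 r = ⋃ k ∈ Finset.range (m + 1), Ioc (grid 0 r m k) (grid 0 r m (k + 1)) := by
      have hU := (grid_mono 0 r m).biUnion_Ico_Ioc_map_succ 0 (m + 1)
      rw [grid_zero, grid_last zero_le] at hU
      rw [← hU]
      ext u
      simp
    have hint : IntegrableOn (fun u => H (c m u)) (Ioc 0 r) μ := by
      refine Integrable.of_bound (hcmeas m).aestronglyMeasurable C ?_
      filter_upwards [ae_restrict_mem measurableSet_Ioc] with u hu
      exact hC _ (hler m u hu.2)
    rw [hU, integral_biUnion_finset (s := fun k => Ioc (grid 0 r m k) (grid 0 r m (k + 1))) _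
      (fun k _ => measurableSet_Ioc)
      ((grid_mono 0 r m).pairwise_disjoint_on_Ioc_succ.set_pairwise _)
      (fun k hk => hint.mono_set (by
        rw [hU]; exact fun u hu => mem_iUnion₂.2 ⟨k, hk, hu⟩))]
    refine Finset.sum_congr rfl fun k _ => ?_
    rw [setIntegral_congr_fun measurableSet_Ioc
      (g := fun _ => H (grid 0 r m (k + 1))) (fun u hu => by simp only [hc, grid_ceil hr hu]),
      setIntegral_const, smul_eq_mul, mul_comm]
  simp_rw [← hsum]
  refine tendsto_integral_of_dominated_convergence (fun _ => C)
    (fun m => (hcmeas m).aestronglyMeasurable) (integrable_const _) (fun m => ?_) ?_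
  · filter_upwards [ae_restrict_mem measurableSet_Ioc] with u hu
    exact hC _ (hler m u hu.2)
  · filter_upwards [ae_restrict_mem measurableSet_Ioc] with u hu
    -- At `u = r` the tag is `r` itself, so no continuity is required there.
    rcases hu.2.eq_or_lt with rfl | hur
    · have : ∀ m, c m u = u := fun m => le_antisymm (hler m u le_rfl) (hle m u)
      simp only [this]
      exact tendsto_const_nhds
    · refine (hH u hur).tendsto.comp
        (tendsto_nhdsWithin_iff.2 ⟨?_, Eventually.of_forall fun m => hle m u⟩)
      have hlim : Tendsto (fun m : ℕ => u + r * (1 / ((m : ℝ≥0) + 1))) atTop (𝓝 (u + r * 0)) :=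
        tendsto_const_nhds.add (tendsto_one_div_add_atTop_nhds_zero_nat.const_mul r)
      rw [mul_zero, add_zero] at hlim
      exact tendsto_of_tendsto_of_tendsto_of_le_of_le tendsto_const_nhds hlim
        (fun m => hle m u) fun m => hclose m u

/-! ### The Stieltjes measure of a counting path -/

lemma countingMeasure_eq {n : ℝ≥0 → ℕ} (hm : Monotone fun r => (n r : ℝ)) :
    countingMeasure n = hm.stieltjesFunction.measure := by
  rw [countingMeasure, dif_pos hm]

lemma stieltjesFunction_apply {n : ℝ≥0 → ℕ} (hm : Monotone fun r => (n r : ℝ))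
    (hr : ∀ t, ∀ᶠ u in 𝓝[>] t, n u = n t) (t : ℝ≥0) : hm.stieltjesFunction t = n t := by
  rw [Monotone.stieltjesFunction_eq]
  refine rightLim_eq_of_tendsto ?_
  exact tendsto_const_nhds.congr' ((hr t).mono fun u hu => by simp only [hu])

lemma countingMeasure_Ioc {n : ℝ≥0 → ℕ} (hm : Monotone n)
    (hr : ∀ t, ∀ᶠ u in 𝓝[>] t, n u = n t) (a b : ℝ≥0) :
    countingMeasure n (Ioc a b) = ((n b - n a : ℕ) : ℝ≥0∞) := by
  have hm' : Monotone fun r => (n r : ℝ) := fun _ _ h => Nat.cast_le.2 (hm h)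
  rw [countingMeasure_eq hm', StieltjesFunction.measure_Ioc, stieltjesFunction_apply hm' hr,
    stieltjesFunction_apply hm' hr]
  rcases le_total a b with h | h
  · rw [← Nat.cast_sub (hm h), ENNReal.ofReal_natCast]
  · rw [Nat.sub_eq_zero_of_le (hm h), ENNReal.ofReal_of_nonpos (sub_nonpos.2 (hm' h))]
    simp

lemma countingMeasure_real_Ioc {n : ℝ≥0 → ℕ} (hm : Monotone n)
    (hr : ∀ t, ∀ᶠ u in 𝓝[>] t, n u = n t) (a b : ℝ≥0) :
    (countingMeasure n).real (Ioc a b) = ((n b - n a : ℕ) : ℝ) := by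
  rw [measureReal_def, countingMeasure_Ioc hm hr, ENNReal.toReal_natCast]

lemma countingMeasure_Ioc_ne_top {n : ℝ≥0 → ℕ} (hm : Monotone n)
    (hr : ∀ t, ∀ᶠ u in 𝓝[>] t, n u = n t) (a b : ℝ≥0) :
    countingMeasure n (Ioc a b) ≠ ∞ := by
  rw [countingMeasure_Ioc hm hr]
  exact ENNReal.natCast_ne_top _

/-! ### Compensation formula -/

section Compensation

variable {Ω : Type*} [MeasurableSpace Ω] {P : Measure Ω}
  {l : ℝ≥0 → ℝ≥0} {N : ℝ≥0 → Ω → ℕ}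

lemma IsPoissonProcess.right (hN : IsPoissonProcess P l N) : ∀ᵐ ω ∂P,
    Monotone (fun t => N t ω) ∧ ∀ t, ∀ᶠ u in 𝓝[>] t, N u ω = N t ω := by
  filter_upwards [hN.path] with ω hω
  refine ⟨hω.2.1, fun t => ?_⟩
  have := hω.2.2 t
  rw [ContinuousWithinAt, nhds_discrete, tendsto_pure] at this
  exact this.filter_mono (nhdsWithin_mono _ Ioi_subset_Ici_self)

/-- Compensation formula: for a bounded right-continuous integrand whose value at each time is
independent of the past increments of the Poisson process, the expectation of the integral against
the Poisson process is the integral of the expectation against the intensity measure. -/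
lemma IsPoissonProcess.integral_compensation [IsProbabilityMeasure P] (hN : IsPoissonProcess P l N) {α : ℝ≥0}
    (hl : ∀ t, l t ≤ α) {r : ℝ≥0} {H : ℝ≥0 → Ω → ℝ} (hH1 : ∀ u ω, |H u ω| ≤ 1)
    (hrc : ∀ᵐ ω ∂P, ∀ u, u < r → ContinuousWithinAt (fun v => H v ω) (Ici u) u)
    (hmeas : ∀ u ≤ r, AEStronglyMeasurable (H u) P)
    (hind : ∀ u v, v ≤ u → u ≤ r → ∫ ω, H u ω * ((N u ω - N v ω : ℕ) : ℝ) ∂P =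
      (∫ ω, H u ω ∂P) * ∫ ω, ((N u ω - N v ω : ℕ) : ℝ) ∂P) :
    Integrable (fun ω => ∫ u in Ioc 0 r, H u ω ∂countingMeasure (fun t => N t ω)) P ∧
      ∫ ω, ∫ u in Ioc 0 r, H u ω ∂countingMeasure (fun t => N t ω) ∂P =
        ∫ u in Ioc 0 r, (∫ ω, H u ω ∂P) ∂intensityMeasure l := by
  set τ : ℕ → ℕ → ℝ≥0 := grid 0 r
  have hτ : ∀ m k, k < m + 1 → τ m (k + 1) ≤ r := fun m k hk =>
    (grid_mem (zero_le (a := r)) (m := m) (k := k + 1) hk).2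
  have hτm : ∀ m k, τ m k ≤ τ m (k + 1) := fun m k => grid_mono 0 r m k.le_succ
  -- The integrand is evaluated at the right end of each cell, because it is independent of what
  -- happened before that time. The expectation therefore factorizes term by term.
  set F : ℕ → Ω → ℝ := fun m ω => ∑ k ∈ Finset.range (m + 1),
    H (τ m (k + 1)) ω * ((N (τ m (k + 1)) ω - N (τ m k) ω : ℕ) : ℝ) with hF
  have hFmeas : ∀ m, AEStronglyMeasurable (F m) P := fun m =>
    Finset.aestronglyMeasurable_fun_sum _ fun k hk =>
      (hmeas _ (hτ m k (Finset.mem_range.1 hk))).mul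
        (hN.integrable_sub (hτm m k)).aestronglyMeasurable
  have hlim : ∀ᵐ ω ∂P, Tendsto (fun m => F m ω) atTop
      (𝓝 (∫ u in Ioc 0 r, H u ω ∂countingMeasure (fun t => N t ω))) := by
    filter_upwards [hN.right, hrc] with ω h1 h2
    have := tendsto_riemann_sum (countingMeasure_Ioc_ne_top h1.1 h1.2 0 r)
      (H := fun u => H u ω) (C := 1) (fun u _ => hH1 u ω) h2
    simpa only [countingMeasure_real_Ioc h1.1 h1.2] using this
  have hbound : ∀ m, ∀ᵐ ω ∂P, ‖F m ω‖ ≤ ((N r ω - N 0 ω : ℕ) : ℝ) := fun m => by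
    filter_upwards [hN.path] with ω hω
    calc ‖F m ω‖ ≤ ∑ k ∈ Finset.range (m + 1),
          ‖H (τ m (k + 1)) ω * ((N (τ m (k + 1)) ω - N (τ m k) ω : ℕ) : ℝ)‖ := norm_sum_le _ _
      _ ≤ ∑ k ∈ Finset.range (m + 1), ((N (τ m (k + 1)) ω - N (τ m k) ω : ℕ) : ℝ) := by
          refine Finset.sum_le_sum fun k _ => ?_
          rw [norm_mul, Real.norm_natCast]
          exact mul_le_of_le_one_left (Nat.cast_nonneg _) (hH1 _ _)
      _ = ((N r ω - N 0 ω : ℕ) : ℝ) := by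
          have := sum_Ico_increments (f := fun k => N (τ m k) ω)
            (hω.2.1.comp (grid_mono 0 r m)) 0 (m + 1)
          rw [← Finset.range_eq_Ico] at this
          simp only [τ, grid_zero, grid_last (zero_le (a := r))] at this ⊢
          exact_mod_cast this
  have hdom := hN.integrable_sub (zero_le (a := r))
  refine ⟨?_, ?_⟩
  · refine hdom.mono' (aestronglyMeasurable_of_tendsto_ae atTop hFmeas hlim) ?_
    filter_upwards [hlim, ae_all_iff.2 hbound] with ω h1 h2
    exact le_of_tendsto' h1.norm h2
  · have h1 := tendsto_integral_of_dominated_convergence _ hFmeas hdom hbound hlim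
    have h2 : Tendsto (fun m => ∫ ω, F m ω ∂P) atTop
        (𝓝 (∫ u in Ioc 0 r, (∫ ω, H u ω ∂P) ∂intensityMeasure l)) := by
      have h3 := tendsto_riemann_sum (μ := intensityMeasure l) (r := r)
        (H := fun u => ∫ ω, H u ω ∂P) (C := 1) (intensityMeasure_Ioc_lt_top hl 0 r).ne
        (fun u _ => by
          have := norm_integral_le_of_norm_le_const (μ := P) (f := H u) (C := 1) (ae_of_all _ fun ω => hH1 u ω)
          simpa using this)
        (fun u hu => by
          refine continuousWithinAt_of_dominated (bound := fun _ => 1) ?_ ?_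
            (integrable_const _) ?_
          · filter_upwards [inter_mem_nhdsWithin (Ici u) (Iio_mem_nhds hu)] with v hv
            exact hmeas v (le_of_lt hv.2)
          · exact Eventually.of_forall fun v => ae_of_all _ fun ω => hH1 v ω
          · filter_upwards [hrc] with ω hω
            exact hω u hu)
      refine h3.congr fun m => ?_
      rw [integral_finsetSum]
      · refine Finset.sum_congr rfl fun k hk => ?_
        rw [hind _ _ (hτm m k) (hτ m k (Finset.mem_range.1 hk)), hN.integral_sub (hτm m k)]
      · intro k hk
        exact (hN.integrable_sub (hτm m k)).bdd_mul (c := 1)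
          (hmeas _ (hτ m k (Finset.mem_range.1 hk))) (ae_of_all _ fun ω => hH1 _ _)
    exact tendsto_nhds_unique h1 h2

end Compensation

end Stirring

namespace Stirring

/-! ### Integration by parts for pure jump functions -/

lemma eventually_forall_Ioc {r : ℝ≥0} {p : ℝ≥0 → Prop} (h : ∀ᶠ u in 𝓝[>] r, p u) :
    ∀ᶠ u in 𝓝[>] r, ∀ v ∈ Ioc r u, p v := by
  obtain ⟨b, hb, hsub⟩ := (mem_nhdsGT_iff_exists_Ioo_subset' (lt_add_one r)).1 h
  filter_upwards [Ioo_mem_nhdsGT hb] with u hu v hv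
  exact hsub ⟨hv.1, hv.2.trans_lt hu.2⟩

lemma eventually_forall_Ico {r : ℝ≥0} (hr : 0 < r) {p : ℝ≥0 → Prop} (h : ∀ᶠ u in 𝓝[<] r, p u) :
    ∀ᶠ u in 𝓝[<] r, ∀ v ∈ Ico u r, p v := by
  obtain ⟨b, hb, hsub⟩ := (mem_nhdsLT_iff_exists_Ioo_subset' hr).1 h
  filter_upwards [Ioo_mem_nhdsLT hb] with u hu v hv
  exact hsub ⟨hu.1.trans_le hv.1, hv.2⟩

lemma leftLim_eq_of_eventually {β : Type*} [TopologicalSpace β] [T2Space β] {g : ℝ≥0 → β}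
    {r : ℝ≥0} (hr : 0 < r) {c : β} (h : ∀ᶠ u in 𝓝[<] r, g u = c) : Function.leftLim g r = c := by
  have := nhdsLT_neBot_of_pos hr
  exact leftLim_eq_of_tendsto (tendsto_const_nhds.congr' (h.mono fun u hu => hu.symm))

/-- The path is constant on `[u, r)`, so `(u, r)` is a null set and only the atom at `r`
contributes. -/
lemma setIntegral_countingMeasure_of_jump {n : ℝ≥0 → ℕ} (hm : Monotone n)
    (hr : ∀ t, ∀ᶠ u in 𝓝[>] t, n u = n t) {u r : ℝ≥0} (hur : u < r)
    (h : ∀ v ∈ Ico u r, n v = n u) (F : ℝ≥0 → ℝ) :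
    ∫ v in Ioc u r, F v ∂countingMeasure n = F r * ((n r : ℝ) - n u) := by
  have hm' : Monotone fun r => (n r : ℝ) := fun _ _ h => Nat.cast_le.2 (hm h)
  have h0 : countingMeasure n (Ioo u r) = 0 := by
    have hst : (hm'.stieltjesFunction : ℝ≥0 → ℝ) = fun r => (n r : ℝ) :=
      funext (stieltjesFunction_apply hm' hr)
    rw [countingMeasure_eq hm', StieltjesFunction.measure_Ioo, hst,
      leftLim_eq_of_eventually (zero_le.trans_lt hur) (c := (n u : ℝ))]
    · simp
    · filter_upwards [Ioo_mem_nhdsLT hur] with v hv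
      rw [h v ⟨hv.1.le, hv.2⟩]
  have hset : Ioc u r =ᵐ[countingMeasure n] ({r} : Set ℝ≥0) := by
    have h1 := ae_eq_set_union (ae_eq_empty.2 h0)
      (ae_eq_refl (μ := countingMeasure n) ({r} : Set ℝ≥0))
    rwa [Ioo_union_right hur, empty_union] at h1
  rw [setIntegral_congr_set hset, integral_singleton, ← measureReal_congr hset,
    countingMeasure_real_Ioc hm hr, Nat.cast_sub (hm hur.le), smul_eq_mul, mul_comm]

/-- The difference `Φ` of the two sides is locally constant, hence constant by continuous induction.
Just after a time, `g` is constant and no `n z` moves. Just before `r`, with `g = c` there, the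
identity reads f(r)g(r) - f(u)c = f(r)(g(r) - c) + c(f(r) - f(u)). This explains the pairing of `f`
with the jumps and of `leftLim g` with the drift, and requires no continuity of `f`. -/
lemma integral_by_parts_of_jump {ι : Type*} [Fintype ι] {n : ι → ℝ≥0 → ℕ}
    (hm : ∀ z, Monotone (n z)) (hr : ∀ z t, ∀ᶠ u in 𝓝[>] t, n z u = n z t)
    {Λ : ι → Measure ℝ≥0} {φ K : ι → ℝ≥0 → ℝ} {f g : ℝ≥0 → ℝ} {t : ℝ≥0}
    (hφ : ∀ z, IntegrableOn (φ z) (Ioc 0 t) (Λ z))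
    (hgφ : ∀ z, IntegrableOn (fun r => Function.leftLim g r * φ z r) (Ioc 0 t) (Λ z))
    (hK : ∀ z, IntegrableOn (fun r => f r * K z r) (Ioc 0 t) (countingMeasure (n z)))
    (hf : ∀ r ≤ t, f r = f 0 + ∑ z, ∫ u in Ioc 0 r, φ z u ∂Λ z)
    (hgr : ∀ r < t, ∀ᶠ u in 𝓝[>] r, g u = g r)
    (hgl : ∀ r, 0 < r → r ≤ t → ∃ c, (∀ᶠ u in 𝓝[<] r, g u = c) ∧
      g r - c = ∑ z, K z r * ((n z r : ℝ) - Function.leftLim (n z) r)) :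
    f t * g t - f 0 * g 0 = (∑ z, ∫ r in Ioc 0 t, f r * K z r ∂countingMeasure (n z)) +
      ∑ z, ∫ r in Ioc 0 t, Function.leftLim g r * φ z r ∂Λ z := by
  have split : ∀ (μ : Measure ℝ≥0) (F : ℝ≥0 → ℝ), IntegrableOn F (Ioc 0 t) μ → ∀ u v, u ≤ v →
      v ≤ t → ∫ r in Ioc 0 v, F r ∂μ = (∫ r in Ioc 0 u, F r ∂μ) + ∫ r in Ioc u v, F r ∂μ := by
    intro μ F hF u v huv hvt
    rw [← Ioc_union_Ioc_eq_Ioc (zero_le (a := u)) huv,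
      setIntegral_union (Ioc_disjoint_Ioc_of_le le_rfl) measurableSet_Ioc
      (hF.mono_set (Ioc_subset_Ioc le_rfl (huv.trans hvt)))
      (hF.mono_set (Ioc_subset_Ioc zero_le hvt))]
  set Φ : ℝ≥0 → ℝ := fun r => f r * g r -
    (∑ z, ∫ u in Ioc 0 r, f u * K z u ∂countingMeasure (n z)) -
    ∑ z, ∫ u in Ioc 0 r, Function.leftLim g u * φ z u ∂Λ z with hΦ
  have hfinc : ∀ u v, u ≤ v → v ≤ t → f v = f u + ∑ z, ∫ r in Ioc u v, φ z r ∂Λ z := by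
    intro u v huv hvt
    rw [hf v hvt, hf u (huv.trans hvt), add_assoc, ← Finset.sum_add_distrib]
    congr 1
    exact Finset.sum_congr rfl fun z _ => split _ _ (hφ z) u v huv hvt
  have key : ∀ u v, u ≤ v → v ≤ t →
      (f v * g v - f u * g u = (∑ z, ∫ r in Ioc u v, f r * K z r ∂countingMeasure (n z)) +
      ∑ z, ∫ r in Ioc u v, Function.leftLim g r * φ z r ∂Λ z) → Φ u = Φ v := by
    intro u v huv hvt h
    have h1 : ∑ z, ∫ r in Ioc 0 v, f r * K z r ∂countingMeasure (n z) =
        (∑ z, ∫ r in Ioc 0 u, f r * K z r ∂countingMeasure (n z)) +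
        ∑ z, ∫ r in Ioc u v, f r * K z r ∂countingMeasure (n z) := by
      rw [← Finset.sum_add_distrib]
      exact Finset.sum_congr rfl fun z _ => split _ _ (hK z) u v huv hvt
    have h2 : ∑ z, ∫ r in Ioc 0 v, Function.leftLim g r * φ z r ∂Λ z =
        (∑ z, ∫ r in Ioc 0 u, Function.leftLim g r * φ z r ∂Λ z) +
        ∑ z, ∫ r in Ioc u v, Function.leftLim g r * φ z r ∂Λ z := by
      rw [← Finset.sum_add_distrib]
      exact Finset.sum_congr rfl fun z _ => split _ _ (hgφ z) u v huv hvt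
    simp only [hΦ]
    rw [h1, h2]
    linarith
  have drift : ∀ u v c, u ≤ v → v ≤ t → (∀ r ∈ Ioc u v, Function.leftLim g r = c) →
      ∑ z, ∫ r in Ioc u v, Function.leftLim g r * φ z r ∂Λ z = c * (f v - f u) := by
    intro u v c huv hvt hc
    rw [hfinc u v huv hvt, add_sub_cancel_left, Finset.mul_sum]
    refine Finset.sum_congr rfl fun z _ => ?_
    rw [← integral_const_mul]
    exact setIntegral_congr_fun measurableSet_Ioc fun r hr => by simp only [hc r hr]
  have hconst : Φ 0 = Φ t := by
    refine rel_of_local (R := fun u v => Φ u = Φ v) zero_le rfl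
      (fun u v w _ _ _ _ h1 h2 => h1.trans h2) (fun r _ hrt => ?_) fun r h0 hrt => ?_
    · have hn : ∀ᶠ u in 𝓝[>] r, ∀ z, n z u = n z r := eventually_all.2 fun z => hr z r
      filter_upwards [eventually_forall_Ioc (hgr r hrt), hn, Ioo_mem_nhdsGT hrt] with u hg hn hu
      refine key r u hu.1.le hu.2.le ?_
      rw [drift r u (g r) hu.1.le hu.2.le fun v hv => ?_, Finset.sum_eq_zero fun z _ => ?_]
      · rw [hg u ⟨hu.1, le_rfl⟩]; ring
      · rw [Measure.restrict_eq_zero.2, integral_zero_measure]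
        rw [countingMeasure_Ioc (hm z) (hr z), hn z]
        simp
      · refine leftLim_eq_of_eventually (zero_le.trans_lt hv.1) ?_
        filter_upwards [Ioo_mem_nhdsLT hv.1] with w hw
        exact hg w ⟨hw.1, hw.2.le.trans hv.2⟩
    · obtain ⟨c, hc, hjump⟩ := hgl r h0 hrt
      have hn : ∀ᶠ u in 𝓝[<] r, ∀ z, n z u = Function.leftLim (n z) r :=
        eventually_all.2 fun z => eventually_left_eq_leftLim (hm z) r
      filter_upwards [eventually_forall_Ico h0 hc, eventually_forall_Ico h0 hn,
        self_mem_nhdsWithin] with u hg hn (hu : u < r)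
      refine key u r hu.le hrt ?_
      rw [drift u r c hu.le hrt fun v hv => ?_]
      · have : ∀ z, ∫ v in Ioc u r, f v * K z v ∂countingMeasure (n z) =
            f r * (K z r * ((n z r : ℝ) - Function.leftLim (n z) r)) := fun z => by
          rw [setIntegral_countingMeasure_of_jump (hm z) (hr z) hu
            (fun v hv => (hn v hv z).trans (hn u ⟨le_rfl, hu⟩ z).symm), hn u ⟨le_rfl, hu⟩ z,
            mul_assoc]
        simp_rw [this]
        rw [← Finset.mul_sum, ← hjump, hg u ⟨le_rfl, hu⟩]
        ring
      · rcases hv.2.eq_or_lt with rfl | hvr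
        · exact leftLim_eq_of_eventually h0 hc
        · refine leftLim_eq_of_eventually (zero_le.trans_lt hv.1) ?_
          filter_upwards [Ioo_mem_nhdsLT hv.1] with w hw
          exact hg w ⟨hw.1.le, hw.2.trans hvr⟩
  simp only [hΦ, Ioc_self, Measure.restrict_empty, integral_zero_measure, Finset.sum_const_zero,
    sub_zero] at hconst
  linarith

/-! ### Jumps of the walks -/

section Jumps

variable {d : ℕ} {n : Bond d → ℝ≥0 → ℕ}

open Classical in
lemma IsGood.jump_eq (hn : IsGood n) (b : Bond d) (r : ℝ≥0) :
    (n b r : ℝ) - Function.leftLim (n b) r = if IsEvent (n b) r then 1 else 0 := by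
  have h1 := hn.simple b r
  have h2 := (hn.mono b).leftLim_le (le_refl r)
  have h3 := isEvent_iff (hn.mono b) r
  split_ifs with h
  · have : n b r = Function.leftLim (n b) r + 1 := by have := h3.1 h; omega
    rw [this]; push_cast; ring
  · have : n b r = Function.leftLim (n b) r := by
      by_contra h'
      exact h (h3.2 (Ne.symm h'))
    rw [this, sub_self]

/-- At most one bond at `y` has an event at `r`, and then its jump is one, so the sum selects the
difference along the crossed bond. -/
lemma IsGood.sum_jump (hn : IsGood n) {r : ℝ≥0} {y w : Site d} (hyw : Cross n r y w)
    (A : Site d → ℝ) :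
    ∑ z : (lattice d).neighborSet y, (A z - A y) *
      ((n (bond z.2) r : ℝ) - Function.leftLim (n (bond z.2)) r) = A w - A y := by
  classical
  simp only [hn.jump_eq]
  rcases hyw with ⟨rfl, h⟩ | ⟨h, he⟩
  · rw [sub_self]
    exact Finset.sum_eq_zero fun z _ => by rw [if_neg (h z.1 z.2), mul_zero]
  · rw [Finset.sum_eq_single (⟨w, h⟩ : (lattice d).neighborSet y)]
    · rw [if_pos he, mul_one]
    · intro z _ hz
      rw [if_neg fun he' => hz ?_, mul_zero]
      exact Subtype.ext (eq_of_bond_eq (hn.distinct _ _ r he' he))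
    · exact fun h' => absurd (Finset.mem_univ _) h'

/-- The indicator that the backward walk started from `x` at time `t` is at `y` at time `u`. -/
noncomputable def backInd (n : Bond d → ℝ≥0 → ℕ) (t : ℝ≥0) (x y : Site d) (u : ℝ≥0) : ℝ :=
  if backwardWalk n (min u t) t x = y then 1 else 0

lemma abs_backInd_le (n : Bond d → ℝ≥0 → ℕ) (t : ℝ≥0) (x y : Site d) (u : ℝ≥0) :
    |backInd n t x y u| ≤ 1 := by
  unfold backInd; split_ifs <;> simp

/-- Freezing the indicator after time `t` makes it right-continuous on the whole half-line, as
measurability requires. -/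
lemma backInd_right (hn : IsGood n) (t : ℝ≥0) (x y : Site d) (u : ℝ≥0) :
    ∀ᶠ v in 𝓝[>] u, backInd n t x y v = backInd n t x y u := by
  rcases lt_or_ge u t with h | h
  · filter_upwards [(isTraj_backwardWalk hn t x).right u zero_le h, Ioo_mem_nhdsGT h] with v hv hv'
    simp only [backInd, min_eq_left hv'.2.le, min_eq_left h.le, hv]
  · filter_upwards [self_mem_nhdsWithin] with v (hv : u < v)
    simp only [backInd, min_eq_right h, min_eq_right (h.trans hv.le)]

lemma tendsto_backInd_right (hn : IsGood n) (t : ℝ≥0) (x y : Site d) (u : ℝ≥0) :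
    Tendsto (backInd n t x y) (𝓝[>] u) (𝓝 (backInd n t x y u)) :=
  tendsto_const_nhds.congr' ((backInd_right hn t x y u).mono fun _ h => h.symm)

lemma integrableOn_backInd (hn : IsGood n) (t : ℝ≥0) (x y : Site d) {μ : Measure ℝ≥0} {r : ℝ≥0}
    (hμ : μ (Ioc 0 r) ≠ ∞) : IntegrableOn (backInd n t x y) (Ioc 0 r) μ := by
  have : IsFiniteMeasure (μ.restrict (Ioc 0 r)) := ⟨by
    rw [Measure.restrict_apply_univ]; exact hμ.lt_top⟩
  exact Integrable.of_bound
    (measurable_of_rightContinuous (tendsto_backInd_right hn t x y)).aestronglyMeasurable 1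
    (ae_of_all _ fun u => abs_backInd_le n t x y u)

/-- Evolution of the backward walk, as a function of its final time. -/
lemma backInd_sub (hn : IsGood n) {r t : ℝ≥0} (hrt : r ≤ t) (x y : Site d) :
    backInd n t x y r - backInd n t x y 0 = ∑ z : (lattice d).neighborSet y,
      ((∫ u in Ioc 0 r, backInd n t x y u ∂countingMeasure (n (bond z.2))) -
        ∫ u in Ioc 0 r, backInd n t x z u ∂countingMeasure (n (bond z.2))) := by
  have hfin : ∀ z : (lattice d).neighborSet y, countingMeasure (n (bond z.2)) (Ioc 0 r) ≠ ∞ :=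
    fun z => countingMeasure_Ioc_ne_top (hn.mono _) (hn.right _) 0 r
  -- With `f = 1` and no drift, integration by parts just adds up jumps. The integrand `K` uses
  -- values at `u`, not left limits, so that it depends on increments after `u` only.
  have := integral_by_parts_of_jump (ι := (lattice d).neighborSet y)
    (n := fun z => n (bond z.2)) (Λ := fun _ => 0) (φ := fun _ _ => 0)
    (K := fun z u => backInd n t x y u - backInd n t x z u) (f := fun _ => 1)
    (g := backInd n t x y) (t := r) (fun z => hn.mono _) (fun z => hn.right _) (by simp) (by simp)
    (fun z => by
      simp only [one_mul]
      exact (integrableOn_backInd hn t x y (hfin z)).sub (integrableOn_backInd hn t x z (hfin z)))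
    (by simp) (fun u _ => backInd_right hn t x y u) (fun u h0 hur => by
      obtain ⟨y', hy', hc⟩ := (isTraj_backwardWalk hn t x).left u h0 (hur.trans hrt)
      refine ⟨if y' = y then 1 else 0, ?_, ?_⟩
      · filter_upwards [hy', self_mem_nhdsWithin] with v hv (hvu : v < u)
        simp only [backInd, min_eq_left (hvu.le.trans (hur.trans hrt)), hv]
      · obtain ⟨w, hw⟩ := exists_cross n u y
        have h1 := hn.sum_jump hw fun z => -backInd n t x z u
        simp only [neg_sub_neg] at h1
        rw [h1]
        -- The walk is at `y` just before `u` exactly when it is at the partner `w` of `y` at `u`;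
        -- this turns the left limit into a value at `u`.
        have h2 : y' = y ↔ backwardWalk n (min u t) t x = w := by
          rw [min_eq_left (hur.trans hrt)]
          constructor
          · rintro rfl; exact hc.unique hn hw
          · rintro e; rw [← e] at hw; exact hc.unique_left hn hw
        simp only [backInd, h2])
  simp only [one_mul, mul_zero, integral_zero, Finset.sum_const_zero, add_zero] at this
  rw [this]
  exact Finset.sum_congr rfl fun z _ => integral_sub (integrableOn_backInd hn t x y (hfin z))
    (integrableOn_backInd hn t x z (hfin z))

end Jumps

end Stirring

namespace Stirring

/-! ### Transition probabilities of the backward walk -/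

section Transition

variable {d : ℕ} {Ω : Type*} [MeasurableSpace Ω] {P : Measure Ω} [IsProbabilityMeasure P]
  {lam : Bond d → ℝ≥0 → ℝ≥0} {α : ℝ≥0} {N : Bond d → ℝ≥0 → Ω → ℕ}

omit [IsProbabilityMeasure P] in
lemma backwardProb_nonneg (r t : ℝ≥0) (x y : Site d) : 0 ≤ backwardProb P N r t x y :=
  measureReal_nonneg

lemma backwardProb_le_one (r t : ℝ≥0) (x y : Site d) : backwardProb P N r t x y ≤ 1 :=
  measureReal_le_one

omit [IsProbabilityMeasure P] in
lemma IsPoissonFamily.measurableSet_chainEvent (hN : IsPoissonFamily P lam N) {u t : ℝ≥0}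
    (hut : u ≤ t) (x y : Site d) : MeasurableSet (chainEvent N u t x y) :=
  Stirring.measurableSet_chainEvent hut (fun c a b _ _ _ => (hN.poisson c).measurable_sub a b) x y

omit [IsProbabilityMeasure P] in
lemma backwardWalk_ae_eq_chainEvent (hgood : ∀ᵐ ω ∂P, IsGood (realization N ω)) {u t : ℝ≥0}
    (hut : u ≤ t) (x y : Site d) :
    {ω | backwardWalk (realization N ω) u t x = y} =ᵐ[P] chainEvent N u t x y := by
  filter_upwards [hgood] with ω hω
  exact propext (backwardWalk_eq_iff_eventually hω hut x y)

omit [IsProbabilityMeasure P] in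
lemma backwardProb_eq_chainEvent (hgood : ∀ᵐ ω ∂P, IsGood (realization N ω)) {u t : ℝ≥0}
    (hut : u ≤ t) (x y : Site d) :
    backwardProb P N u t x y = P.real (chainEvent N u t x y) :=
  measureReal_congr (backwardWalk_ae_eq_chainEvent hgood hut x y)

omit [IsProbabilityMeasure P] in
lemma backInd_ae_eq (hgood : ∀ᵐ ω ∂P, IsGood (realization N ω)) {u t : ℝ≥0}
    (hut : u ≤ t) (x y : Site d) :
    (fun ω => backInd (realization N ω) t x y u) =ᵐ[P]
      (chainEvent N u t x y).indicator fun _ => (1 : ℝ) := by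
  filter_upwards [hgood] with ω hω
  have h : backwardWalk (realization N ω) u t x = y ↔ ω ∈ chainEvent N u t x y :=
    backwardWalk_eq_iff_eventually hω hut x y
  by_cases hc : ω ∈ chainEvent N u t x y
  · rw [indicator_of_mem hc, backInd, min_eq_left hut, if_pos (h.2 hc)]
  · rw [indicator_of_notMem hc, backInd, min_eq_left hut, if_neg (h.not.2 hc)]

omit [IsProbabilityMeasure P] in
lemma integral_backInd (hgood : ∀ᵐ ω ∂P, IsGood (realization N ω))
    (hN : IsPoissonFamily P lam N) {u t : ℝ≥0} (hut : u ≤ t) (x y : Site d) :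
    ∫ ω, backInd (realization N ω) t x y u ∂P = backwardProb P N u t x y := by
  rw [integral_congr_ae (backInd_ae_eq hgood hut x y), backwardProb_eq_chainEvent hgood hut,
    integral_indicator (hN.measurableSet_chainEvent hut x y)]
  simp

omit [IsProbabilityMeasure P] in
lemma aestronglyMeasurable_backInd (hgood : ∀ᵐ ω ∂P, IsGood (realization N ω))
    (hN : IsPoissonFamily P lam N) {u t : ℝ≥0} (hut : u ≤ t) (x y : Site d) :
    AEStronglyMeasurable (fun ω => backInd (realization N ω) t x y u) P :=
  (aestronglyMeasurable_const.indicator (hN.measurableSet_chainEvent hut x y)).congr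
    (backInd_ae_eq hgood hut x y).symm

/-- The walk from `t` back to `u` is built from increments after `u`, whereas `N b u - N b v` lies
before `u`. -/
lemma integral_backInd_mul_increment (hgood : ∀ᵐ ω ∂P, IsGood (realization N ω))
    (hN : IsPoissonFamily P lam N) {v u t : ℝ≥0} (hvu : v ≤ u) (hut : u ≤ t) (x y : Site d)
    (b : Bond d) :
    ∫ ω, backInd (realization N ω) t x y u * ((N b u ω - N b v ω : ℕ) : ℝ) ∂P =
      (∫ ω, backInd (realization N ω) t x y u ∂P) * ∫ ω, ((N b u ω - N b v ω : ℕ) : ℝ) ∂P := by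
  have hXY : IndepFun ((chainEvent N u t x y).indicator fun _ => (1 : ℝ))
      (fun ω => ((N b u ω - N b v ω : ℕ) : ℝ)) P := by
    obtain ⟨m₁, m₂, hind, h1, h2⟩ := hN.indep_past_future u
    have hX : Measurable[m₂] ((chainEvent N u t x y).indicator fun _ => (1 : ℝ)) :=
      (measurable_const (a := (1 : ℝ))).indicator (Stirring.measurableSet_chainEvent hut
        (fun c a b ha hab _ => h2 c a b ha (ha.trans hab)) x y)
    have hY : Measurable[m₁] fun ω => ((N b u ω - N b v ω : ℕ) : ℝ) :=
      measurable_from_nat.comp (h1 b v u hvu le_rfl)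
    exact indep_of_indep_of_le hind.symm hX.comap_le hY.comap_le
  have hXY' := hXY.congr (backInd_ae_eq hgood hut x y).symm ae_eq_rfl
  exact hXY'.integral_mul_eq_mul_integral (aestronglyMeasurable_backInd hgood hN hut x y)
    ((hN.poisson b).integrable_sub hvu).aestronglyMeasurable

omit [IsProbabilityMeasure P] in
lemma ae_continuousWithinAt_backInd (hgood : ∀ᵐ ω ∂P, IsGood (realization N ω)) (t : ℝ≥0)
    (x y : Site d) : ∀ᵐ ω ∂P, ∀ u,
      ContinuousWithinAt (fun v => backInd (realization N ω) t x y v) (Ici u) u := by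
  filter_upwards [hgood] with ω hω u
  rw [← continuousWithinAt_Ioi_iff_Ici]
  exact tendsto_backInd_right hω t x y u

lemma integral_backInd_countingMeasure (hgood : ∀ᵐ ω ∂P, IsGood (realization N ω))
    (hbound : ∀ b t, lam b t ≤ α) (hN : IsPoissonFamily P lam N) {r t : ℝ≥0} (hrt : r ≤ t)
    (x y : Site d) (b : Bond d) :
    Integrable (fun ω => ∫ u in Ioc 0 r, backInd (realization N ω) t x y u
      ∂countingMeasure (realization N ω b)) P ∧
    ∫ ω, ∫ u in Ioc 0 r, backInd (realization N ω) t x y u ∂countingMeasure (realization N ω b) ∂P =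
      ∫ u in Ioc 0 r, backwardProb P N u t x y ∂intensityMeasure (lam b) := by
  have := (hN.poisson b).integral_compensation (hbound b) (r := r)
    (H := fun u ω => backInd (realization N ω) t x y u) (fun u ω => abs_backInd_le _ t x y u)
    ((ae_continuousWithinAt_backInd hgood t x y).mono fun ω h u _ => h u)
    (fun u hu => aestronglyMeasurable_backInd hgood hN (hu.trans hrt) x y)
    (fun u v hvu hur => integral_backInd_mul_increment hgood hN hvu (hur.trans hrt) x y b)
  refine ⟨this.1, this.2.trans ?_⟩
  exact setIntegral_congr_fun measurableSet_Ioc fun u hu =>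
    integral_backInd hgood hN (hu.2.trans hrt) x y

lemma continuousWithinAt_backwardProb (hgood : ∀ᵐ ω ∂P, IsGood (realization N ω))
    (hN : IsPoissonFamily P lam N) {u t : ℝ≥0} (hut : u < t) (x y : Site d) :
    ContinuousWithinAt (fun v => backwardProb P N v t x y) (Ici u) u := by
  have h : ContinuousWithinAt (fun v => ∫ ω, backInd (realization N ω) t x y v ∂P) (Ici u) u := by
    refine continuousWithinAt_of_dominated (bound := fun _ => 1) ?_ ?_ (integrable_const _) ?_
    · filter_upwards [inter_mem_nhdsWithin (Ici u) (Iio_mem_nhds hut)] with v hv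
      exact aestronglyMeasurable_backInd hgood hN (le_of_lt hv.2) x y
    · exact Eventually.of_forall fun v => ae_of_all _ fun ω => abs_backInd_le _ t x y v
    · exact (ae_continuousWithinAt_backInd hgood t x y).mono fun ω h => h u
  refine h.congr_of_eventuallyEq ?_ (integral_backInd hgood hN hut.le x y).symm
  filter_upwards [inter_mem_nhdsWithin (Ici u) (Iio_mem_nhds hut)] with v hv
  exact (integral_backInd hgood hN (le_of_lt hv.2) x y).symm

lemma measurable_backwardProb_min (hgood : ∀ᵐ ω ∂P, IsGood (realization N ω))
    (hN : IsPoissonFamily P lam N) (t : ℝ≥0) (x y : Site d) :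
    Measurable fun v => backwardProb P N (min v t) t x y := by
  refine measurable_of_rightContinuous fun u => ?_
  rcases lt_or_ge u t with h | h
  · have := continuousWithinAt_Ioi_iff_Ici.2 (continuousWithinAt_backwardProb hgood hN h x y)
    simp only [min_eq_left h.le]
    refine this.tendsto.congr' ?_
    filter_upwards [Ioo_mem_nhdsGT h] with v hv
    rw [min_eq_left hv.2.le]
  · refine tendsto_const_nhds.congr' ?_
    filter_upwards [self_mem_nhdsWithin] with v (hv : u < v)
    rw [min_eq_right h, min_eq_right (h.trans hv.le)]

lemma aestronglyMeasurable_backwardProb (hgood : ∀ᵐ ω ∂P, IsGood (realization N ω))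
    (hN : IsPoissonFamily P lam N) {r t : ℝ≥0} (hrt : r ≤ t) (x y : Site d) (μ : Measure ℝ≥0) :
    AEStronglyMeasurable (fun v => backwardProb P N v t x y) (μ.restrict (Ioc 0 r)) := by
  refine (measurable_backwardProb_min hgood hN t x y).aestronglyMeasurable.congr ?_
  filter_upwards [ae_restrict_mem measurableSet_Ioc] with u hu
  rw [min_eq_left (hu.2.trans hrt)]

lemma integrableOn_backwardProb (hgood : ∀ᵐ ω ∂P, IsGood (realization N ω))
    (hN : IsPoissonFamily P lam N) {r t : ℝ≥0} (hrt : r ≤ t) (x y : Site d) {μ : Measure ℝ≥0}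
    (hμ : μ (Ioc 0 r) ≠ ∞) : IntegrableOn (fun v => backwardProb P N v t x y) (Ioc 0 r) μ := by
  have : IsFiniteMeasure (μ.restrict (Ioc 0 r)) := ⟨by
    rw [Measure.restrict_apply_univ]; exact hμ.lt_top⟩
  refine Integrable.of_bound (aestronglyMeasurable_backwardProb hgood hN hrt x y μ) 1
    (ae_of_all _ fun u => ?_)
  rw [Real.norm_of_nonneg (backwardProb_nonneg _ _ _ _)]
  exact backwardProb_le_one _ _ _ _

/-- Kolmogorov equation for the backward walk. -/
lemma backwardProb_eq (hgood : ∀ᵐ ω ∂P, IsGood (realization N ω))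
    (hbound : ∀ b t, lam b t ≤ α) (hN : IsPoissonFamily P lam N) {r t : ℝ≥0} (hrt : r ≤ t)
    (x y : Site d) :
    backwardProb P N r t x y = backwardProb P N 0 t x y + ∑ z : (lattice d).neighborSet y,
      ∫ u in Ioc 0 r, (backwardProb P N u t x y - backwardProb P N u t x z)
        ∂intensityMeasure (lam (bond z.2)) := by
  have hint : ∀ u ≤ t, ∀ w, Integrable (fun ω => backInd (realization N ω) t x w u) P :=
    fun u hu w => Integrable.of_bound (aestronglyMeasurable_backInd hgood hN hu x w) 1
      (ae_of_all _ fun ω => abs_backInd_le _ t x w u)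
  have h1 : ∫ ω, (backInd (realization N ω) t x y r - backInd (realization N ω) t x y 0) ∂P =
      ∫ ω, (∑ z : (lattice d).neighborSet y,
        ((∫ u in Ioc 0 r, backInd (realization N ω) t x y u
          ∂countingMeasure (realization N ω (bond z.2))) -
        ∫ u in Ioc 0 r, backInd (realization N ω) t x z u
          ∂countingMeasure (realization N ω (bond z.2)))) ∂P :=
    integral_congr_ae (hgood.mono fun ω hω => backInd_sub hω hrt x y)
  have hI := fun w b => integral_backInd_countingMeasure hgood hbound hN hrt x w b
  rw [integral_sub (hint r hrt y) (hint 0 zero_le y), integral_backInd hgood hN hrt,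
    integral_backInd hgood hN zero_le, integral_finsetSum] at h1
  swap
  · exact fun z _ => (hI y (bond z.2)).1.sub (hI z (bond z.2)).1
  rw [← sub_eq_iff_eq_add', h1]
  refine Finset.sum_congr rfl fun z _ => ?_
  rw [integral_sub (hI y (bond z.2)).1 (hI z (bond z.2)).1, (hI y _).2, (hI z _).2, integral_sub]
  · exact integrableOn_backwardProb hgood hN hrt x y (intensityMeasure_Ioc_lt_top (hbound _) 0 r).ne
  · exact integrableOn_backwardProb hgood hN hrt x z (intensityMeasure_Ioc_lt_top (hbound _) 0 r).ne

lemma backwardProb_self (hgood : ∀ᵐ ω ∂P, IsGood (realization N ω))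
    (t : ℝ≥0) (x y : Site d) : backwardProb P N t t x y = if y = x then 1 else 0 := by
  have : {ω | backwardWalk (realization N ω) t t x = y} =ᵐ[P] {_ω : Ω | x = y} := by
    filter_upwards [hgood] with ω hω
    show (backwardWalk (realization N ω) t t x = y) = (x = y)
    rw [backwardWalk_self hω]
  rw [backwardProb, measureReal_congr this]
  by_cases h : x = y
  · simp [h]
  · simp [h, Ne.symm h]

/-- The chain events for distinct endpoints are disjoint, because a discretized walk has at most one
endpoint. -/
lemma sum_backwardProb_le_one (hgood : ∀ᵐ ω ∂P, IsGood (realization N ω))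
    (hN : IsPoissonFamily P lam N) {r t : ℝ≥0} (hrt : r ≤ t) (x : Site d) (s : Finset (Site d)) :
    ∑ y ∈ s, backwardProb P N r t x y ≤ 1 := by
  simp only [backwardProb_eq_chainEvent hgood hrt]
  rw [← measureReal_biUnion_finset]
  · exact measureReal_le_one
  · intro y _ y' _ hne
    refine Set.disjoint_left.2 fun ω h h' => hne ?_
    obtain ⟨m, h1, h2⟩ := (Filter.Eventually.and h h').exists
    exact h1.unique h2
  · exact fun y _ => hN.measurableSet_chainEvent hrt x y

lemma summable_backwardProb (hgood : ∀ᵐ ω ∂P, IsGood (realization N ω))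
    (hN : IsPoissonFamily P lam N) {r t : ℝ≥0} (hrt : r ≤ t) (x : Site d) :
    Summable fun y => backwardProb P N r t x y :=
  summable_of_sum_le (fun _ => backwardProb_nonneg _ _ _ _)
    (sum_backwardProb_le_one hgood hN hrt x)

/-- The backward walks started at time `T ≥ t` dominate those started at time `t`. -/
lemma exists_backwardProb_le (hgood : ∀ᵐ ω ∂P, IsGood (realization N ω))
    (hN : IsPoissonFamily P lam N) {t T : ℝ≥0} (htT : t ≤ T) (x : Site d) :
    ∃ C : ℝ, ∀ r ≤ t, ∀ y, backwardProb P N r t x y ≤ C * backwardProb P N r T x y := by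
  classical
  -- On `B` no bond at `x` rings in `(t, T]`, so the walk from `x` at time `T` is still at `x` at
  -- time `t`. `B` has positive probability and is independent of the increments before `t`, whence
  -- the constant `1 / P(B)`.
  set B : Set Ω := ⋂ z : (lattice d).neighborSet x,
    {ω | N (bond z.2) T ω - N (bond z.2) t ω = 0} with hB
  have hBpos : 0 < P B := by
    have hinj : Function.Injective fun z : (lattice d).neighborSet x => bond z.2 :=
      fun z z' h => Subtype.ext (eq_of_bond_eq h)
    have h := (hN.indep.precomp hinj).measure_inter_preimage_eq_mul Finset.univ
      (sets := fun _ => {f : ℝ≥0 → ℕ | f T - f t = 0}) fun z _ => by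
        have h : Measurable fun f : ℝ≥0 → ℕ => f T - f t := by fun_prop
        exact h (measurableSet_singleton 0)
    have hB' : B = ⋂ z ∈ (Finset.univ : Finset ((lattice d).neighborSet x)),
        (fun ω t => N (bond z.2) t ω) ⁻¹' {f : ℝ≥0 → ℕ | f T - f t = 0} := by
      simp only [Finset.mem_univ, iInter_true]; rfl
    rw [hB']
    refine lt_of_lt_of_eq ?_ h.symm
    exact CanonicallyOrderedAdd.prod_pos.2 fun z _ =>
      (hN.poisson (bond z.2)).measure_sub_eq_zero_pos htT
  have hBpos' : 0 < P.real B := ENNReal.toReal_pos hBpos.ne' (measure_ne_top _ _)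
  refine ⟨(P.real B)⁻¹, fun r hrt y => ?_⟩
  rw [inv_mul_eq_div, le_div_iff₀ hBpos']
  have hAB : P (chainEvent N r t x y ∩ B) = P (chainEvent N r t x y) * P B := by
    obtain ⟨m₁, m₂, hind, h1, h2⟩ := hN.indep_past_future t
    have hA : MeasurableSet[m₁] (chainEvent N r t x y) :=
      Stirring.measurableSet_chainEvent hrt (fun c a b _ hab hb => h1 c a b (hab.trans hb) hb) x y
    have hB2 : MeasurableSet[m₂] B := MeasurableSet.iInter fun z =>
      h2 (bond z.2) t T le_rfl htT (measurableSet_singleton 0)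
    exact (Indep_iff m₁ m₂ P).1 hind _ _ hA hB2
  rw [backwardProb_eq_chainEvent hgood hrt, measureReal_def, measureReal_def, ← ENNReal.toReal_mul,
    ← hAB, ← measureReal_def, backwardProb]
  refine ENNReal.toReal_mono (measure_ne_top _ _) (measure_mono_ae ?_)
  filter_upwards [hgood] with ω hω h
  obtain ⟨ha, hb⟩ := h
  have ha' := (backwardWalk_eq_iff_eventually hω hrt x y).2 ha
  show backwardWalk (realization N ω) r T x = y
  rw [← backwardWalk_comp hω hrt htT, backwardWalk_of_eq hω htT fun z hz => ?_, ha']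
  have hz' : N (bond hz) T ω - N (bond hz) t ω = 0 := mem_iInter.1 hb ⟨z, hz⟩
  have h3 := hω.mono (bond hz) htT
  simp only [realization] at h3 ⊢
  omega

end Transition

end Stirring

namespace Stirring

/-! ### Summability over the sites of the time integrals of the transition probabilities. -/

lemma timeVolume_Ioc_ne_top (a b : ℝ≥0) : timeVolume (Ioc a b) ≠ ∞ := by
  rw [timeVolume_Ioc]; exact ENNReal.coe_ne_top

/-- A series of nonnegative integrable functions whose integrals are summable converges almost
everywhere. -/
lemma ae_summable_of_summable_integral {Ω ι : Type*} [MeasurableSpace Ω] [Countable ι]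
    {P : Measure Ω} {F : ι → Ω → ℝ} (hF : ∀ i, Integrable (F i) P) (h0 : ∀ i, 0 ≤ᵐ[P] F i)
    (hsum : Summable fun i => ∫ ω, F i ω ∂P) : ∀ᵐ ω ∂P, Summable fun i => F i ω := by
  have h1 : ∫⁻ ω, ∑' i, ENNReal.ofReal (F i ω) ∂P ≠ ∞ := by
    rw [lintegral_tsum fun i => (hF i).aestronglyMeasurable.aemeasurable.ennreal_ofReal]
    simp_rw [← fun i => ofReal_integral_eq_lintegral_ofReal (hF i) (h0 i)]
    exact hsum.tsum_ofReal_ne_top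
  have h2 := ae_lt_top' (AEMeasurable.tsum fun i =>
    (hF i).aestronglyMeasurable.aemeasurable.ennreal_ofReal) h1
  filter_upwards [h2, ae_all_iff.2 h0] with ω hω h0
  have := ENNReal.summable_toReal hω.ne
  exact this.congr fun i => ENNReal.toReal_ofReal (h0 i)

section Transition

variable {d : ℕ} {Ω : Type*} [MeasurableSpace Ω] {P : Measure Ω} [IsProbabilityMeasure P]
  {lam : Bond d → ℝ≥0 → ℝ≥0} {α : ℝ≥0} {N : Bond d → ℝ≥0 → Ω → ℕ}

lemma summable_integral_backwardProb (hgood : ∀ᵐ ω ∂P, IsGood (realization N ω))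
    (hN : IsPoissonFamily P lam N) (t : ℝ≥0) (x : Site d) :
    Summable fun y => ∫ u in Ioc 0 t, backwardProb P N u t x y ∂timeVolume := by
  have hint := fun y => integrableOn_backwardProb hgood hN (le_refl t) x y
    (timeVolume_Ioc_ne_top 0 t)
  refine summable_of_sum_le (c := timeVolume.real (Ioc 0 t))
    (fun y => integral_nonneg fun u => backwardProb_nonneg _ _ _ _) fun s => ?_
  rw [← integral_finsetSum _ fun y _ => hint y]
  have : ∫ _u in Ioc 0 t, (1 : ℝ) ∂timeVolume = timeVolume.real (Ioc 0 t) := by simp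
  rw [← this]
  refine setIntegral_mono_on (integrable_finsetSum _ fun y _ => hint y) ?_ measurableSet_Ioc
    fun u hu => sum_backwardProb_le_one hgood hN hu.2 x s
  exact integrableOn_const (timeVolume_Ioc_ne_top 0 t)

lemma integral_intensityMeasure_le {l : ℝ≥0 → ℝ≥0} (hl : ∀ t, l t ≤ α) {t : ℝ≥0} {f : ℝ≥0 → ℝ}
    (h0 : ∀ u, 0 ≤ f u) (hf : IntegrableOn f (Ioc 0 t) timeVolume) :
    ∫ u in Ioc 0 t, f u ∂intensityMeasure l ≤ α * ∫ u in Ioc 0 t, f u ∂timeVolume := by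
  have h1 : ∫ u in Ioc 0 t, f u ∂intensityMeasure l ≤ ∫ u in Ioc 0 t, f u ∂(α • timeVolume) := by
    refine integral_mono_measure (Measure.restrict_mono_measure (intensityMeasure_le hl) _)
      (ae_of_all _ h0) ?_
    rw [Measure.restrict_smul]
    exact hf.smul_measure_nnreal
  refine h1.trans (le_of_eq ?_)
  rw [Measure.restrict_smul, integral_smul_nnreal_measure]
  rfl

lemma integral_backwardProb_countingMeasure (hgood : ∀ᵐ ω ∂P, IsGood (realization N ω))
    (hbound : ∀ b t, lam b t ≤ α) (hN : IsPoissonFamily P lam N) (t : ℝ≥0) (x y : Site d)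
    (b : Bond d) :
    Integrable (fun ω => ∫ u in Ioc 0 t, backwardProb P N u t x y
      ∂countingMeasure (realization N ω b)) P ∧
    ∫ ω, ∫ u in Ioc 0 t, backwardProb P N u t x y ∂countingMeasure (realization N ω b) ∂P =
      ∫ u in Ioc 0 t, backwardProb P N u t x y ∂intensityMeasure (lam b) := by
  have := (hN.poisson b).integral_compensation (hbound b) (r := t)
    (H := fun u _ => backwardProb P N u t x y)
    (fun u ω => by
      rw [abs_of_nonneg (backwardProb_nonneg _ _ _ _)]; exact backwardProb_le_one _ _ _ _)
    (ae_of_all _ fun ω u hu => continuousWithinAt_backwardProb hgood hN hu x y)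
    (fun u hu => aestronglyMeasurable_const)
    (fun u v hvu hur => by rw [integral_const_mul, integral_const]; simp)
  refine ⟨this.1, this.2.trans ?_⟩
  simp

/-- By compensation, the expectation of the sum is at most 3^d α ∑_y ∫ p̂ du, which is finite
because p̂ has total mass at most one. -/
lemma ae_summable_integral_countingMeasure (hgood : ∀ᵐ ω ∂P, IsGood (realization N ω))
    (hbound : ∀ b t, lam b t ≤ α) (hN : IsPoissonFamily P lam N) (t : ℝ≥0) (x : Site d) :
    ∀ᵐ ω ∂P, Summable fun y => ∑ z : (lattice d).neighborSet y,
      ∫ u in Ioc 0 t, backwardProb P N u t x y ∂countingMeasure (realization N ω (bond z.2)) := by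
  have hE := fun y b => integral_backwardProb_countingMeasure hgood hbound hN t x y b
  refine ae_summable_of_summable_integral
    (fun y => integrable_finsetSum _ fun (z : (lattice d).neighborSet y) _ => (hE y (bond z.2)).1)
    (fun y => ae_of_all _ fun ω => Finset.sum_nonneg fun z _ =>
      integral_nonneg fun u => backwardProb_nonneg _ _ _ _) ?_
  refine Summable.of_nonneg_of_le (fun y => integral_nonneg fun ω => Finset.sum_nonneg fun z _ =>
      integral_nonneg fun u => backwardProb_nonneg _ _ _ _) (fun y => ?_)
    ((summable_integral_backwardProb hgood hN t x).mul_left ((3 ^ d : ℕ) * α : ℝ))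
  rw [integral_finsetSum]
  swap
  · exact fun z _ => (hE y (bond z.2)).1
  calc ∑ z : (lattice d).neighborSet y, ∫ ω, ∫ u in Ioc 0 t, backwardProb P N u t x y
        ∂countingMeasure (realization N ω (bond z.2)) ∂P
      ≤ ∑ _z : (lattice d).neighborSet y,
          α * ∫ u in Ioc 0 t, backwardProb P N u t x y ∂timeVolume := by
        refine Finset.sum_le_sum fun z _ => ?_
        rw [(hE y (bond z.2)).2]
        exact integral_intensityMeasure_le (hbound _) (fun u => backwardProb_nonneg _ _ _ _)
          (integrableOn_backwardProb hgood hN le_rfl x y (timeVolume_Ioc_ne_top 0 t))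
    _ ≤ ((3 ^ d : ℕ) * α : ℝ) * ∫ u in Ioc 0 t, backwardProb P N u t x y ∂timeVolume := by
        rw [Finset.sum_const, nsmul_eq_mul, ← mul_assoc]
        refine mul_le_mul_of_nonneg_right (mul_le_mul_of_nonneg_right ?_ α.2)
          (integral_nonneg fun u => backwardProb_nonneg _ _ _ _)
        exact_mod_cast card_neighborSet_le y

end Transition

/-! ### Occupation variables -/

section Occupation

variable {d : ℕ} {n : Bond d → ℝ≥0 → ℕ} {η : Site d → ℝ}

lemma eventually_occupation_right (hn : IsGood n) (η : Site d → ℝ) (r : ℝ≥0) (y : Site d) :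
    ∀ᶠ u in 𝓝[>] r, occupation n η u y = occupation n η r y :=
  (eventually_backwardWalk_right hn zero_le y).mono fun u hu => by rw [occupation, hu, occupation]

/-- An event exchanges the contents of its endpoints, so the value at `y` just before `r` is the
value at its partner at `r`. -/
lemma eventually_occupation_left (hn : IsGood n) (η : Site d → ℝ) {r : ℝ≥0} (hr : 0 < r)
    {y w : Site d} (hyw : Cross n r y w) :
    ∀ᶠ u in 𝓝[<] r, occupation n η u y = occupation n η r w :=
  (eventually_backwardWalk_left hn hr hyw).mono fun u hu => by rw [occupation, hu, occupation]

lemma leftLim_occupation (hn : IsGood n) (η : Site d → ℝ) {r : ℝ≥0} (hr : 0 < r) {y w : Site d}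
    (hyw : Cross n r y w) :
    Function.leftLim (fun u => occupation n η u y) r = occupation n η r w :=
  leftLim_eq_of_eventually hr (eventually_occupation_left hn η hr hyw)

lemma measurable_leftLim_occupation (hn : IsGood n) (η : Site d → ℝ) (y : Site d) :
    Measurable (Function.leftLim fun u => occupation n η u y) := by
  refine measurable_leftLim fun r => ?_
  rcases eq_zero_or_pos (a := r) with rfl | hr
  · exact ⟨0, by simp⟩
  · obtain ⟨w, hw⟩ := exists_cross n r y
    exact ⟨occupation n η r w, tendsto_const_nhds.congr'
      ((eventually_occupation_left hn η hr hw).mono fun u hu => hu.symm)⟩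

lemma leftLim_occupation_mem (hn : IsGood n) (hη : ∀ x, η x = 0 ∨ η x = 1) (r : ℝ≥0) (y : Site d) :
    Function.leftLim (fun u => occupation n η u y) r ∈ Icc (0 : ℝ) 1 := by
  have key : ∀ x, η x ∈ Icc (0 : ℝ) 1 := fun x => by rcases hη x with h | h <;> simp [h]
  rcases eq_zero_or_pos (a := r) with rfl | hr
  · rw [leftLim_eq_of_isBot (a := (0 : ℝ≥0)) isBot_bot]
    exact key _
  · obtain ⟨w, hw⟩ := exists_cross n r y
    rw [leftLim_occupation hn η hr hw]
    exact key _

lemma abs_leftDiff_le (hn : IsGood n) (hη : ∀ x, η x = 0 ∨ η x = 1) (r : ℝ≥0) (y z : Site d) :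
    |leftDiff (occupation n η) r y z| ≤ 1 := by
  have h1 := leftLim_occupation_mem hn hη r y
  have h2 := leftLim_occupation_mem hn hη r z
  rw [leftDiff, abs_le]
  constructor <;> linarith [h1.1, h1.2, h2.1, h2.2]

lemma measurable_leftDiff (hn : IsGood n) (η : Site d → ℝ) (y z : Site d) :
    Measurable fun r => leftDiff (occupation n η) r y z :=
  (measurable_leftLim_occupation hn η z).sub (measurable_leftLim_occupation hn η y)

end Occupation

/-! ### Exchanges along the bonds cancel out -/

/-- Absolute summability over pairs permits swapping the two indices, which changes the sign of the
total. -/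
lemma tsum_tsum_eq_zero_of_antisymm {ι : Type*} {A : ι → ι → ℝ} (hA : ∀ y z, A y z = -A z y)
    (hs : Summable fun p : ι × ι => A p.1 p.2) : HasSum (fun y => ∑' z, A y z) 0 := by
  have h1 : ∑' p : ι × ι, A p.1 p.2 = -∑' p : ι × ι, A p.1 p.2 := by
    rw [← tsum_neg, ← (Equiv.prodComm ι ι).tsum_eq]
    exact tsum_congr fun p => hA _ _
  have h2 : ∑' p : ι × ι, A p.1 p.2 = 0 := by linarith
  have h3 := hs.prod.hasSum
  rwa [← hs.tsum_prod, h2] at h3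

open Classical in
/-- Extension by zero of a function of the oriented bonds. -/
noncomputable def onBonds {d : ℕ} (a : (y z : Site d) → (lattice d).Adj y z → ℝ) (y z : Site d) :
    ℝ := if h : (lattice d).Adj y z then a y z h else 0

lemma onBonds_of_adj {d : ℕ} (a : (y z : Site d) → (lattice d).Adj y z → ℝ) {y z : Site d}
    (h : (lattice d).Adj y z) : onBonds a y z = a y z h := dif_pos h

lemma hasSum_onBonds {d : ℕ} (a : (y z : Site d) → (lattice d).Adj y z → ℝ) (y : Site d) :
    HasSum (onBonds a y) (∑ z : (lattice d).neighborSet y, a y z z.2) := by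
  have h1 : ∀ z : (lattice d).neighborSet y, a y z z.2 = onBonds a y z := fun z =>
    (onBonds_of_adj a z.2).symm
  simp_rw [h1]
  refine (hasSum_subtype_iff_of_support_subset (s := (lattice d).neighborSet y) ?_).1
    (hasSum_fintype fun z : (lattice d).neighborSet y => onBonds a y z)
  intro z hz
  by_contra h
  exact hz (dif_neg h)

/-- Each `I y` is counted once per neighbour, at most 3^d times; the `I z` part follows by reversing
the bonds. -/
lemma summable_onBonds {d : ℕ} {a : (y z : Site d) → (lattice d).Adj y z → ℝ} {I : Site d → ℝ}
    (hI0 : ∀ y, 0 ≤ I y) (hI : Summable I) (ha : ∀ y z h, |a y z h| ≤ I y + I z) :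
    Summable fun p : Site d × Site d => onBonds a p.1 p.2 := by
  have h1 : Summable fun p : Site d × Site d => onBonds (fun y _ _ => I y) p.1 p.2 := by
    rw [summable_prod_of_nonneg]
    · refine ⟨fun y => (hasSum_onBonds _ y).summable, ?_⟩
      simp_rw [fun y => (hasSum_onBonds (fun y _ _ => I y) y).tsum_eq]
      refine Summable.of_nonneg_of_le (fun y => Finset.sum_nonneg fun _ _ => hI0 y) (fun y => ?_)
        (hI.mul_left ((3 ^ d : ℕ) : ℝ))
      rw [Finset.sum_const, nsmul_eq_mul]
      exact mul_le_mul_of_nonneg_right (by exact_mod_cast card_neighborSet_le y) (hI0 y)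
    · intro p
      beta_reduce
      by_cases h : (lattice d).Adj p.1 p.2
      · rw [onBonds_of_adj _ h]
        exact hI0 p.1
      · exact (dif_neg h : onBonds (fun y _ _ => I y) p.1 p.2 = 0).ge
  have h2 := (Equiv.prodComm (Site d) (Site d)).summable_iff.2 h1
  refine Summable.of_norm_bounded (h1.add h2) fun p => ?_
  by_cases h : (lattice d).Adj p.1 p.2
  · simp only [Function.comp_apply, Equiv.prodComm_apply, Prod.fst_swap, Prod.snd_swap,
      onBonds_of_adj _ h, onBonds_of_adj _ h.symm]
    exact ha _ _ h
  · have h' : ¬ (lattice d).Adj p.2 p.1 := fun h' => h h'.symm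
    simp [onBonds, h, h']

end Stirring

namespace Stirring

/-! ### The mild solution representation -/

section MildSolution

variable {d : ℕ} {Ω : Type*} [MeasurableSpace Ω] {P : Measure Ω} [IsProbabilityMeasure P]
  {lam : Bond d → ℝ≥0 → ℝ≥0} {α : ℝ≥0} {N : Bond d → ℝ≥0 → Ω → ℕ} {n : Bond d → ℝ≥0 → ℕ}
  {η : Site d → ℝ}

lemma integrableOn_mul_leftDiff (hgood : ∀ᵐ ω ∂P, IsGood (realization N ω))
    (hN : IsPoissonFamily P lam N) (hn : IsGood n) (hη : ∀ x, η x = 0 ∨ η x = 1) (t : ℝ≥0)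
    (x y z : Site d) {μ : Measure ℝ≥0} (hμ : μ (Ioc 0 t) ≠ ∞) :
    IntegrableOn (fun r => backwardProb P N r t x y * leftDiff (occupation n η) r y z)
      (Ioc 0 t) μ := by
  refine (integrableOn_backwardProb hgood hN le_rfl x y hμ).mul_bdd (c := 1)
    (measurable_leftDiff hn η y z).aestronglyMeasurable (ae_of_all _ fun r => ?_)
  exact abs_leftDiff_le hn hη r y z

lemma integrableOn_mul_leftLim (hgood : ∀ᵐ ω ∂P, IsGood (realization N ω))
    (hN : IsPoissonFamily P lam N) (hn : IsGood n) (hη : ∀ x, η x = 0 ∨ η x = 1) (t : ℝ≥0)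
    (x y z : Site d) {μ : Measure ℝ≥0} (hμ : μ (Ioc 0 t) ≠ ∞) :
    IntegrableOn (fun r => backwardProb P N r t x y *
      Function.leftLim (fun u => occupation n η u z) r) (Ioc 0 t) μ := by
  refine (integrableOn_backwardProb hgood hN le_rfl x y hμ).mul_bdd (c := 1)
    (measurable_leftLim_occupation hn η z).aestronglyMeasurable (ae_of_all _ fun r => ?_)
  have := leftLim_occupation_mem hn hη r z
  rw [Real.norm_eq_abs, abs_of_nonneg this.1]
  exact this.2

lemma integrableM_backwardProb (hgood : ∀ᵐ ω ∂P, IsGood (realization N ω))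
    (hbound : ∀ b t, lam b t ≤ α) (hN : IsPoissonFamily P lam N) (hn : IsGood n)
    (hη : ∀ x, η x = 0 ∨ η x = 1) (t : ℝ≥0) (x y : Site d) :
    IntegrableM lam n (occupation n η) t y fun r => backwardProb P N r t x y := fun z =>
  ⟨integrableOn_mul_leftDiff hgood hN hn hη t x y z
      (countingMeasure_Ioc_ne_top (hn.mono _) (hn.right _) 0 t),
    integrableOn_mul_leftDiff hgood hN hn hη t x y z (intensityMeasure_Ioc_lt_top (hbound _) 0 t).ne⟩

lemma integral_abs_mul_leftDiff_le (hgood : ∀ᵐ ω ∂P, IsGood (realization N ω))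
    (hN : IsPoissonFamily P lam N) (hn : IsGood n) (hη : ∀ x, η x = 0 ∨ η x = 1) (t : ℝ≥0)
    (x y z : Site d) {μ : Measure ℝ≥0} (hμ : μ (Ioc 0 t) ≠ ∞) :
    ∫ r in Ioc 0 t, |backwardProb P N r t x y * leftDiff (occupation n η) r y z| ∂μ ≤
      ∫ r in Ioc 0 t, backwardProb P N r t x y ∂μ := by
  refine integral_mono (integrableOn_mul_leftDiff hgood hN hn hη t x y z hμ).abs
    (integrableOn_backwardProb hgood hN le_rfl x y hμ) fun r => ?_
  simp only [abs_mul, abs_of_nonneg (backwardProb_nonneg (P := P) (N := N) r t x y)]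
  exact mul_le_of_le_one_right (backwardProb_nonneg _ _ _ _) (abs_leftDiff_le hn hη r y z)

/-- The differences are at most one in absolute value. The Poisson part is compared with time `T`,
where summability is known for this realization; the intensity part is bounded deterministically. -/
lemma summable_integralAbsM (hgood : ∀ᵐ ω ∂P, IsGood (realization N ω))
    (hbound : ∀ b t, lam b t ≤ α) (hN : IsPoissonFamily P lam N) (hn : IsGood n)
    (hη : ∀ x, η x = 0 ∨ η x = 1) {t T : ℝ≥0} (htT : t ≤ T) (x : Site d)
    (hT : Summable fun y => ∑ z : (lattice d).neighborSet y,
      ∫ u in Ioc 0 T, backwardProb P N u T x y ∂countingMeasure (n (bond z.2))) :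
    Summable fun y => integralAbsM lam n (occupation n η) t y
      fun r => backwardProb P N r t x y := by
  obtain ⟨C, hC⟩ := exists_backwardProb_le hgood hN htT x
  have hcount : ∀ b s, countingMeasure (n b) (Ioc 0 s) ≠ ∞ := fun b s =>
    countingMeasure_Ioc_ne_top (hn.mono _) (hn.right _) 0 s
  have hint : ∀ b s, intensityMeasure (lam b) (Ioc 0 s) ≠ ∞ := fun b s =>
    (intensityMeasure_Ioc_lt_top (hbound _) 0 s).ne
  refine Summable.of_nonneg_of_le (fun y => Finset.sum_nonneg fun z _ => add_nonneg
    (integral_nonneg fun r => abs_nonneg _) (integral_nonneg fun r => abs_nonneg _)) (fun y => ?_)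
    ((hT.mul_left |C|).add
      ((summable_integral_backwardProb hgood hN t x).mul_left ((3 ^ d : ℕ) * α : ℝ)))
  rw [integralAbsM, Finset.sum_add_distrib]
  refine add_le_add ?_ ?_
  · rw [Finset.mul_sum]
    refine Finset.sum_le_sum fun z _ =>
      (integral_abs_mul_leftDiff_le hgood hN hn hη t x y z (hcount _ t)).trans ?_
    have hi : IntegrableOn (fun r => |C| * backwardProb P N r T x y) (Ioc 0 T)
        (countingMeasure (n (bond z.2))) :=
      (integrableOn_backwardProb hgood hN le_rfl x y (hcount _ T)).const_mul |C|
    rw [← integral_const_mul]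
    refine (setIntegral_mono_on (integrableOn_backwardProb hgood hN le_rfl x y (hcount _ t))
      (hi.mono_set (Ioc_subset_Ioc le_rfl htT)) measurableSet_Ioc fun r hr =>
        (hC r hr.2 y).trans (mul_le_mul_of_nonneg_right (le_abs_self C)
          (backwardProb_nonneg _ _ _ _))).trans ?_
    exact setIntegral_mono_set hi
      (ae_of_all _ fun r => mul_nonneg (abs_nonneg _) (backwardProb_nonneg _ _ _ _))
      (Ioc_subset_Ioc le_rfl htT).eventuallyLE
  · calc _ ≤ ∑ _z : (lattice d).neighborSet y,
          α * ∫ u in Ioc 0 t, backwardProb P N u t x y ∂timeVolume :=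
        Finset.sum_le_sum fun z _ =>
          (integral_abs_mul_leftDiff_le hgood hN hn hη t x y z (hint _ t)).trans
            (integral_intensityMeasure_le (hbound _) (fun u => backwardProb_nonneg _ _ _ _)
              (integrableOn_backwardProb hgood hN le_rfl x y (timeVolume_Ioc_ne_top 0 t)))
      _ ≤ _ := by
        rw [Finset.sum_const, nsmul_eq_mul, ← mul_assoc]
        refine mul_le_mul_of_nonneg_right (mul_le_mul_of_nonneg_right ?_ α.2)
          (integral_nonneg fun u => backwardProb_nonneg _ _ _ _)
        exact_mod_cast card_neighborSet_le y

/-- The net exchange along a bond `{y, z}` in the integration by parts formula. -/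
noncomputable def exchange (P : Measure Ω) (lam : Bond d → ℝ≥0 → ℝ≥0) (N : Bond d → ℝ≥0 → Ω → ℕ)
    (n : Bond d → ℝ≥0 → ℕ) (η : Site d → ℝ) (t : ℝ≥0) (x y z : Site d)
    (h : (lattice d).Adj y z) : ℝ :=
  ∫ r in Ioc 0 t, (backwardProb P N r t x y * Function.leftLim (fun u => occupation n η u z) r -
    backwardProb P N r t x z * Function.leftLim (fun u => occupation n η u y) r)
      ∂intensityMeasure (lam (bond h))

omit [IsProbabilityMeasure P] in
lemma exchange_symm (t : ℝ≥0) (x : Site d) {y z : Site d} (h : (lattice d).Adj y z) :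
    exchange P lam N n η t x y z h = -exchange P lam N n η t x z y h.symm := by
  rw [exchange, exchange, ← integral_neg, bond_symm h]
  simp only [neg_sub]

lemma abs_exchange_le (hgood : ∀ᵐ ω ∂P, IsGood (realization N ω))
    (hbound : ∀ b t, lam b t ≤ α) (hN : IsPoissonFamily P lam N) (hn : IsGood n)
    (hη : ∀ x, η x = 0 ∨ η x = 1) (t : ℝ≥0) (x y z : Site d) (h : (lattice d).Adj y z) :
    |exchange P lam N n η t x y z h| ≤
      α * (∫ u in Ioc 0 t, backwardProb P N u t x y ∂timeVolume) +
      α * ∫ u in Ioc 0 t, backwardProb P N u t x z ∂timeVolume := by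
  have hp := fun w => integrableOn_backwardProb hgood hN (le_refl t) x w
    (timeVolume_Ioc_ne_top 0 t)
  have hq := fun w => integrableOn_backwardProb hgood hN (le_refl t) x w
    (intensityMeasure_Ioc_lt_top (hbound (bond h)) 0 t).ne
  refine abs_integral_le_integral_abs.trans ?_
  refine le_trans (integral_mono_of_nonneg (ae_of_all _ fun r => abs_nonneg _)
    ((hq y).add (hq z)) (ae_of_all _ fun r => ?_)) ?_
  · have hy := leftLim_occupation_mem hn hη r y
    have hz := leftLim_occupation_mem hn hη r z
    have py := backwardProb_nonneg (P := P) (N := N) r t x y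
    have pz := backwardProb_nonneg (P := P) (N := N) r t x z
    refine (abs_sub _ _).trans (add_le_add ?_ ?_)
    · rw [abs_of_nonneg (mul_nonneg py hz.1)]
      exact mul_le_of_le_one_right py hz.2
    · rw [abs_of_nonneg (mul_nonneg pz hy.1)]
      exact mul_le_of_le_one_right pz hy.2
  · have h0 := fun w u => backwardProb_nonneg (P := P) (N := N) u t x w
    simp only [Pi.add_apply]
    rw [integral_add (hq y) (hq z)]
    exact add_le_add (integral_intensityMeasure_le (hbound _) (h0 y) (hp y))
      (integral_intensityMeasure_le (hbound _) (h0 z) (hp z))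

lemma hasSum_exchange (hgood : ∀ᵐ ω ∂P, IsGood (realization N ω))
    (hbound : ∀ b t, lam b t ≤ α) (hN : IsPoissonFamily P lam N) (hn : IsGood n)
    (hη : ∀ x, η x = 0 ∨ η x = 1) (t : ℝ≥0) (x : Site d) :
    HasSum (fun y => ∑ z : (lattice d).neighborSet y, exchange P lam N n η t x y z z.2) 0 := by
  have h1 : Summable fun p : Site d × Site d => onBonds (exchange P lam N n η t x) p.1 p.2 :=
    summable_onBonds (fun y => mul_nonneg α.2 (integral_nonneg fun u => backwardProb_nonneg _ _ _ _))
      ((summable_integral_backwardProb hgood hN t x).mul_left (α : ℝ))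
      (abs_exchange_le hgood hbound hN hn hη t x)
  have h2 := tsum_tsum_eq_zero_of_antisymm (fun y z => ?_) h1
  · simpa only [fun y => (hasSum_onBonds (exchange P lam N n η t x) y).tsum_eq] using h2
  · by_cases h : (lattice d).Adj y z
    · rw [onBonds_of_adj _ h, onBonds_of_adj _ h.symm, exchange_symm t x h]
    · have h' : ¬ (lattice d).Adj z y := fun h' => h h'.symm
      simp [onBonds, h, h']

/-- The drift from the Kolmogorov equation and the compensator combine pointwise: with p the
transition probability and ζ the left limits, ζ(y)(p(y) - p(z)) + p(y)(ζ(z) - ζ(y)) = p(y)ζ(z) -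
p(z)ζ(y). -/
lemma integralM_backwardProb (hgood : ∀ᵐ ω ∂P, IsGood (realization N ω))
    (hbound : ∀ b t, lam b t ≤ α) (hN : IsPoissonFamily P lam N) (hn : IsGood n)
    (hη : ∀ x, η x = 0 ∨ η x = 1) (t : ℝ≥0) (x y : Site d) :
    integralM lam n (occupation n η) t y (fun r => backwardProb P N r t x y) =
      backwardProb P N t t x y * occupation n η t y -
        backwardProb P N 0 t x y * occupation n η 0 y -
        ∑ z : (lattice d).neighborSet y, exchange P lam N n η t x y z z.2 := by
  have hint : ∀ b, intensityMeasure (lam b) (Ioc 0 t) ≠ ∞ := fun b =>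
    (intensityMeasure_Ioc_lt_top (hbound _) 0 t).ne
  have hM := integrableM_backwardProb hgood hbound hN hn hη t x y
  have hL := fun y z b => integrableOn_mul_leftLim hgood hN hn hη t x y z (hint b)
  have key := integral_by_parts_of_jump (ι := (lattice d).neighborSet y)
    (n := fun z => n (bond z.2)) (fun z => hn.mono _) (fun z => hn.right _)
    (Λ := fun z => intensityMeasure (lam (bond z.2)))
    (φ := fun z r => backwardProb P N r t x y - backwardProb P N r t x z)
    (K := fun z r => leftDiff (occupation n η) r y z)
    (f := fun r => backwardProb P N r t x y) (g := fun r => occupation n η r y) (t := t)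
    (fun z => (integrableOn_backwardProb hgood hN le_rfl x y (hint _)).sub
      (integrableOn_backwardProb hgood hN le_rfl x z (hint _)))
    (fun z => ((hL y y _).sub (hL z y _)).congr
      (ae_of_all _ fun r => by simp only [Pi.sub_apply]; ring))
    (fun z => (hM z).1)
    (fun r hr => backwardProb_eq hgood hbound hN hr x y)
    (fun r _ => eventually_occupation_right hn η r y)
    (fun r h0 _ => by
      obtain ⟨w, hw⟩ := exists_cross n r y
      refine ⟨_, eventually_occupation_left hn η h0 hw, ?_⟩
      -- Both ends of the jump are rewritten as left limits: the value at `y` at time `r` is the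
      -- left limit at its partner `w`, by symmetry of crossing.
      rw [← leftLim_occupation hn η h0 hw, ← leftLim_occupation hn η h0 hw.symm]
      exact (hn.sum_jump hw fun z => Function.leftLim (fun u => occupation n η u z) r).symm)
  rw [key, integralM, Finset.sum_sub_distrib, add_sub_assoc, sub_eq_add_neg]
  congr 1
  rw [← Finset.sum_sub_distrib, ← Finset.sum_neg_distrib]
  refine Finset.sum_congr rfl fun z _ => ?_
  unfold exchange
  rw [← integral_neg, ← integral_sub]
  · refine integral_congr_ae (ae_of_all _ fun r => ?_)
    simp only [leftDiff]
    ring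
  · exact ((hL y y _).sub (hL z y _)).congr
      (ae_of_all _ fun r => by simp only [Pi.sub_apply]; ring)
  · exact (hL y z _).sub (hL z y _)

lemma summable_abs_backwardProb_mul (hgood : ∀ᵐ ω ∂P, IsGood (realization N ω))
    (hN : IsPoissonFamily P lam N) (hη : ∀ x, η x = 0 ∨ η x = 1) (t : ℝ≥0) (x : Site d) :
    Summable fun y => |backwardProb P N 0 t x y * η y| := by
  refine Summable.of_nonneg_of_le (fun y => abs_nonneg _) (fun y => ?_)
    (summable_backwardProb hgood hN (zero_le (a := t)) x)
  have h := backwardProb_nonneg (P := P) (N := N) 0 t x y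
  rcases hη y with e | e <;> simp [e, h, abs_of_nonneg h]

lemma mildSolution_eq_occupation (hgood : ∀ᵐ ω ∂P, IsGood (realization N ω))
    (hbound : ∀ b t, lam b t ≤ α) (hN : IsPoissonFamily P lam N) {ω : Ω}
    (hn : IsGood (realization N ω)) (hη : ∀ x, η x = 0 ∨ η x = 1) (t : ℝ≥0) (x : Site d) :
    mildSolution P lam N η t x ω = occupation (realization N ω) η t x := by
  classical
  have h1 : HasSum (fun y => backwardProb P N t t x y * occupation (realization N ω) η t y)
      (occupation (realization N ω) η t x) := by
    have h := hasSum_single (f := fun y => backwardProb P N t t x y *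
      occupation (realization N ω) η t y) x fun y hy => by
        rw [backwardProb_self hgood, if_neg hy, zero_mul]
    rwa [backwardProb_self hgood, if_pos rfl, one_mul] at h
  have h2 : HasSum (fun y => backwardProb P N 0 t x y * occupation (realization N ω) η 0 y)
      (backwardSemigroup P N 0 t η x) := by
    simp only [occupation, backwardWalk_self hn]
    exact (summable_abs_backwardProb_mul hgood hN hη t x).of_abs.hasSum
  have h3 := (h1.sub h2).sub (hasSum_exchange hgood hbound hN hn hη t x)
  simp only [← integralM_backwardProb hgood hbound hN hn hη t x] at h3
  rw [mildSolution, h3.tsum_eq]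
  ring

end MildSolution

end Stirring

/-- Mild solution representation of the stirring process. -/
theorem proposition4p3 {d : ℕ} (hd : 1 ≤ d)
    {Ω : Type*} [MeasurableSpace Ω] (P : Measure Ω) [IsProbabilityMeasure P]
    (lam : Stirring.Bond d → ℝ≥0 → ℝ≥0)
    (hcadlag : ∀ b, Stirring.IsCadlag (lam b))
    (α : ℝ≥0) (hbound : ∀ b t, lam b t ≤ α)
    (N : Stirring.Bond d → ℝ≥0 → Ω → ℕ) (hN : Stirring.IsPoissonFamily P lam N)
    (η : Stirring.Site d → ℝ) (hη : ∀ x, η x = 0 ∨ η x = 1) :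
    ∀ᵐ ω ∂P, Stirring.WalksWellDefined (Stirring.realization N ω) ∧
      ∀ (t : ℝ≥0) (x : Stirring.Site d),
        Summable (fun y => |Stirring.backwardProb P N 0 t x y * η y|) ∧
        (∀ y, Stirring.IntegrableM lam (Stirring.realization N ω)
          (Stirring.occupation (Stirring.realization N ω) η) t y
          (fun r => Stirring.backwardProb P N r t x y)) ∧
        Summable (fun y => Stirring.integralAbsM lam (Stirring.realization N ω)
          (Stirring.occupation (Stirring.realization N ω) η) t y
          (fun r => Stirring.backwardProb P N r t x y)) ∧
        Stirring.mildSolution P lam N η t x ω =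
          Stirring.occupation (Stirring.realization N ω) η t x := by
  have hgood := hN.ae_isGood hbound
  -- Only integer times are used, so that countably many null sets are discarded; other times are
  -- handled by domination.
  have hsum : ∀ᵐ ω ∂P, ∀ (T : ℕ) (x : Stirring.Site d), Summable fun y =>
      ∑ z : (Stirring.lattice d).neighborSet y, ∫ u in Ioc 0 (T : ℝ≥0),
        Stirring.backwardProb P N u T x y
          ∂Stirring.countingMeasure (Stirring.realization N ω (Stirring.bond z.2)) :=
    ae_all_iff.2 fun T => ae_all_iff.2 fun x =>
      Stirring.ae_summable_integral_countingMeasure hgood hbound hN T x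
  filter_upwards [hgood, hsum] with ω hn hs
  refine ⟨hn.walksWellDefined, fun t x => ?_⟩
  obtain ⟨T, hT⟩ := exists_nat_ge t
  exact ⟨Stirring.summable_abs_backwardProb_mul hgood hN hη t x,
    Stirring.integrableM_backwardProb hgood hbound hN hn hη t x,
    Stirring.summable_integralAbsM hgood hbound hN hn hη hT x (hs T x),
    Stirring.mildSolution_eq_occupation hgood hbound hN hn hη t x⟩
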